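/- Let $n\ge 2$, let $M$ be a nonempty smooth manifold (Hausdorff, second countable) of dimension $n+1$, and put $\ell=4$ if $n\ge 3$ and $\ell=5$ if $n=2$. A smooth path structure on $M$ is a family of unparametrized oriented curves (paths) which in every chart, with $x=(x^0,\dots,x^n)$, are the solutions, up to orientation-preserving reparametrization, of $$x^i_{tt}+h^i(x,x_t)=\nu\,x^i_t,\qquad 0\le i\le n,$$ where $\nu=\nu(t)$ is an arbitrary function and $h=(h^i)$ is smooth for $x_t\neq 0$ and positively homogeneous of degree two in $x_t$; $h$ is determined by the path structure up to adding multiples of $x_t$, and the systems in two charts have the same solutions on the overlap. The weak (respectively strong, or Whitney) $C^\ell$ topology on the set of path structures is given by closeness, on compact sets (respectively on locally finite families of compact sets), of the partial derivatives up to order $\ell$ in $(x,x_t)$ of the representatives $h$ normalized by $h\perp x_t$ in the charts. A path structure is called variational if there is a smooth autonomous Lagrangian $\hat L(x,x_t,x_{tt},\dots,x_{(r)})$ on $M$, of some order $r\ge 1$, whose extremals are precisely the paths with all their parametrizations, and whose Euler–Lagrange equations are equivalent to the equations of the path structure in the following sense: in each chart, over an open dense set $\Omega$ of nonzero tangent vectors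 $(x,x_t)$, the Euler–Lagrange covector equals $g\cdot(x_{tt}+h)$, where the matrix $g$ depends smoothly on the $2r$-jet of the curve and its kernel is spanned by $x_t$. (For $r=1$ this says that $\partial^2\hat L/\partial x_t\partial x_t$ has rank $n$ on $\Omega$.) It is called Finsler if its paths, with all their parametrizations, are precisely the extremals of a (possibly irreversible) Finsler metric, that is, of a positive smooth function $\hat L(x,x_t)$, $x_t\ne0$, positively homogeneous of degree one in $x_t$, such that $\hat L^2$ has positive definite Hessian in $x_t$. Corollary. A generic smooth path structure on $M$ in the $C^\ell$ topology is not variational, and hence not Finsler. More precisely, there is a set $\mathcal U$ of path structures on $M$ that is open in the weak $C^\ell$ topology and dense in the strong $C^\ell$ topology (hence open and dense in both) such that no element of $\mathcal U$ is variational and no element of $\mathcal U$ is Finsler. In other words, every path structure can be deformed by an arbitrarily small deformation into one that stays non-variational under all sufficiently small perturbations. -/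

import Mathlib

open Set
open scoped Manifold ContDiff Topology

/-- The model space `ℝ^{n+1}` with coordinates `(x⁰, …, xⁿ)`. -/
abbrev Coord (n : ℕ) : Type := EuclideanSpace ℝ (Fin (n + 1))

/-- The nonzero tangent vectors `(x, v)` over the image of a chart. -/
def slitTangent {n : ℕ} {M : Type*} [TopologicalSpace M]
    (φ : OpenPartialHomeomorph M (Coord n)) : Set (Coord n × Coord n) :=
  φ.target ×ˢ {v | v ≠ 0}

/-- At time `t` the curve `c` satisfies `c'' + h(c, c') = ν c'` for some number `ν`. -/
def SolvesAt {n : ℕ} (h : Coord n × Coord n → Coord n) (c : ℝ → Coord n) (t : ℝ) : Prop :=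
  ∃ ν : ℝ, iteratedDeriv 2 c t + h (c t, deriv c t) = ν • deriv c t

/-- A smooth path structure on an `(n+1)`-manifold `M`. In each chart `φ` its paths are, up to
orientation-preserving reparametrization, the solutions of `c'' + h_φ(c, c') = ν c'`, where `h_φ` is
smooth off the zero section and positively homogeneous of degree two in the velocity. The
systems in two charts have the same solutions on the overlap of the charts.
The functions `h_φ` matter only on `slitTangent φ` and only modulo multiples of the velocity; all
notions below depend only on that class. -/
structure PathStructure (n : ℕ) (M : Type*) [TopologicalSpace M] [ChartedSpace (Coord n) M] where
  h : atlas (Coord n) M → Coord n × Coord n → Coord n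
  smooth : ∀ φ, ContDiffOn ℝ ∞ (h φ) (slitTangent φ.1)
  homogeneous : ∀ φ, ∀ x ∈ φ.1.target, ∀ v : Coord n, v ≠ 0 → ∀ lam : ℝ, 0 < lam →
    h φ (x, lam • v) = lam ^ 2 • h φ (x, v)
  compatible : ∀ (φ ψ : atlas (Coord n) M) (c : ℝ → Coord n) (t : ℝ), ContDiffAt ℝ ∞ c t →
    c t ∈ φ.1.target → φ.1.symm (c t) ∈ ψ.1.source → deriv c t ≠ 0 →
    (SolvesAt (h φ) c t ↔ SolvesAt (h ψ) (fun s => ψ.1 (φ.1.symm (c s))) t)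

section Topology

variable {n : ℕ} {M : Type*} [TopologicalSpace M] [ChartedSpace (Coord n) M]

/-- The representative of the path structure in a chart whose value at `(x, v)` is orthogonal to
`v`; it is the only one, among the functions that differ from `h_φ` by multiples of `v`. -/
noncomputable def PathStructure.normal (P : PathStructure n M) (φ : atlas (Coord n) M)
    (z : Coord n × Coord n) : Coord n :=
  P.h φ z - (inner ℝ z.2 (P.h φ z) / ‖z.2‖ ^ 2) • z.2

/-- Over `K`, and in the chart `φ`, the structures `P` and `Q` and their partial derivatives up to
order `k` in `(x, v)` differ by less than `ε`. (By homogeneity unit vectors `v` suffice.) -/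
def CkClose (k : ℕ) (φ : atlas (Coord n) M) (K : Set M) (ε : ℝ) (P Q : PathStructure n M) :
    Prop :=
  ∀ p ∈ K, ∀ v : Coord n, ‖v‖ = 1 → ∀ j ≤ k,
    ‖iteratedFDeriv ℝ j (fun z => Q.normal φ z - P.normal φ z) (φ.1 p, v)‖ < ε

/-- The weak `C^k` topology (uniform convergence of derivatives up to order `k` on compact sets) on
path structures. -/
@[reducible] def weakTopology (n : ℕ) (M : Type*) [TopologicalSpace M] [ChartedSpace (Coord n) M] (k : ℕ) :
    TopologicalSpace (PathStructure n M) :=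
  TopologicalSpace.generateFrom
    {N | ∃ (P : PathStructure n M) (φ : atlas (Coord n) M) (K : Set M) (ε : ℝ),
      IsCompact K ∧ K ⊆ φ.1.source ∧ 0 < ε ∧ N = {Q | CkClose k φ K ε P Q}}

/-- The strong (Whitney) `C^k` topology on path structures: here closeness is prescribed on a
locally finite sequence of compact sets. On a compact manifold it is the weak one. -/
@[reducible] def strongTopology (n : ℕ) (M : Type*) [TopologicalSpace M] [ChartedSpace (Coord n) M] (k : ℕ) :
    TopologicalSpace (PathStructure n M) :=
  TopologicalSpace.generateFrom
    {N | ∃ (P : PathStructure n M) (φ : ℕ → atlas (Coord n) M) (K : ℕ → Set M) (ε : ℕ → ℝ),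
      LocallyFinite K ∧ (∀ i, IsCompact (K i) ∧ K i ⊆ (φ i).1.source ∧ 0 < ε i) ∧
      N = {Q | ∀ i, CkClose k (φ i) (K i) (ε i) P Q}}

end Topology

/-- The `r`-jet `(c, c', …, c^{(r)})` of a curve at time `t`. -/
noncomputable def jet {n : ℕ} (r : ℕ) (c : ℝ → Coord n) (t : ℝ) : Fin (r + 1) → Coord n :=
  fun k => iteratedDeriv k c t

/-- A smooth autonomous Lagrangian of order `r ≥ 1` on `M`: a smooth function of the `r`-jets of
regular curves in `M`, written as a function of `(x, x_t, x_tt, …)` in each chart. -/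
structure Lagrangian (n : ℕ) (M : Type*) [TopologicalSpace M] [ChartedSpace (Coord n) M]
    (r : ℕ) where
  L : atlas (Coord n) M → (Fin (r + 1) → Coord n) → ℝ
  smooth : ∀ φ, ContDiffOn ℝ ∞ (L φ) {j | (j 0, j 1) ∈ slitTangent φ.1}
  compatible : ∀ (φ ψ : atlas (Coord n) M) (c : ℝ → Coord n) (t : ℝ), ContDiffAt ℝ ∞ c t →
    c t ∈ φ.1.target → φ.1.symm (c t) ∈ ψ.1.source → deriv c t ≠ 0 →
    L φ (jet r c t) = L ψ (jet r (fun s => ψ.1 (φ.1.symm (c s))) t)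

/-- The Euler-Lagrange expression `∑ₖ (-1)ᵏ (d/dt)ᵏ (∂L/∂x_{(k)})` of the curve `c` at time `t`, as
a covector, evaluated on `ξ`. -/
noncomputable def eulerLagrange {n : ℕ} (r : ℕ) (L : (Fin (r + 1) → Coord n) → ℝ)
    (c : ℝ → Coord n) (t : ℝ) (ξ : Coord n) : ℝ :=
  ∑ k : Fin (r + 1), (-1) ^ (k : ℕ) *
    iteratedDeriv k (fun s => fderiv ℝ L (jet r c s) (Pi.single k ξ)) t

section Variational

variable {n : ℕ} {M : Type*} [TopologicalSpace M] [ChartedSpace (Coord n) M]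

/-- The extremals of the Lagrangian are precisely the paths, with any parametrization. (Both
conditions are local in time, so curves inside one chart suffice.) -/
def ExtremalsArePaths {r : ℕ} (Λ : Lagrangian n M r) (P : PathStructure n M) : Prop :=
  ∀ (φ : atlas (Coord n) M) (a b : ℝ) (c : ℝ → Coord n), a < b →
    ContDiffOn ℝ ∞ c (Ioo a b) →
    (∀ t ∈ Ioo a b, c t ∈ φ.1.target ∧ deriv c t ≠ 0) →
    ((∀ t ∈ Ioo a b, ∀ ξ, eulerLagrange r (Λ.L φ) c t ξ = 0) ↔
      ∀ t ∈ Ioo a b, SolvesAt (P.h φ) c t)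

/-- Over an open dense set `Ω` of nonzero tangent vectors, the Euler-Lagrange equations and the
equations of the path structure can be expressed algebraically through each other: the
Euler-Lagrange covector is `g · (x_tt + h)`, where the matrix `g` depends smoothly on the jet and
its kernel is spanned by the velocity `x_t`. For a Lagrangian of order one, `g` is minus the
Hessian matrix `∂²L/∂x_t∂x_t`. -/
def AlgebraicallyEquivalent {r : ℕ} (Λ : Lagrangian n M r) (P : PathStructure n M) : Prop :=
  ∀ φ : atlas (Coord n) M, ∃ (Ω : Set (Coord n × Coord n))
    (g : (Fin (2 * r + 1) → Coord n) → Coord n →L[ℝ] Coord n →L[ℝ] ℝ),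
    IsOpen Ω ∧ Ω ⊆ slitTangent φ.1 ∧ slitTangent φ.1 ⊆ closure Ω ∧
    ContDiffOn ℝ ∞ g {j | (j 0, j 1) ∈ Ω} ∧
    (∀ j, (j 0, j 1) ∈ Ω → ∀ w, g j w = 0 ↔ ∃ ν : ℝ, w = ν • j 1) ∧
    ∀ (c : ℝ → Coord n) (t : ℝ), ContDiffAt ℝ ∞ c t → (c t, deriv c t) ∈ Ω →
      ∀ ξ, eulerLagrange r (Λ.L φ) c t ξ =
        g (jet (2 * r) c t) (iteratedDeriv 2 c t + P.h φ (c t, deriv c t)) ξ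

/-- A path structure is variational if its paths are precisely the extremals of an autonomous
Lagrangian of some order, whose Euler-Lagrange equations are (at generic tangent vectors)
equivalent to the equations of the path structure. -/
def IsVariational (P : PathStructure n M) : Prop :=
  ∃ (r : ℕ) (Λ : Lagrangian n M r), 1 ≤ r ∧ ExtremalsArePaths Λ P ∧ AlgebraicallyEquivalent Λ P

/-- A (possibly irreversible) Finsler metric: a Lagrangian of order one, positive, positively
homogeneous of degree one, whose square has positive definite Hessian in the velocities. -/
def IsFinslerMetric (Λ : Lagrangian n M 1) : Prop :=
  ∀ φ : atlas (Coord n) M, ∀ x ∈ φ.1.target, ∀ v : Coord n, v ≠ 0 →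
    0 < Λ.L φ ![x, v] ∧
    (∀ lam : ℝ, 0 < lam → Λ.L φ ![x, lam • v] = lam * Λ.L φ ![x, v]) ∧
    ∀ w : Coord n, w ≠ 0 → 0 < fderiv ℝ (fderiv ℝ (fun u => Λ.L φ ![x, u] ^ 2)) v w w

/-- The paths are precisely the unparametrized geodesics of some Finsler metric. -/
def IsFinsler (P : PathStructure n M) : Prop :=
  ∃ Λ : Lagrangian n M 1, IsFinslerMetric Λ ∧ ExtremalsArePaths Λ P

end Variational

/-! For an equation x'' + h(x, x') = 0 write A and B for the position and velocity derivatives of h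
along a path. In a frame P along the path with P' = -½BP, the substitution x = Py turns the
linearized equation x'' + Bx' + Ax = 0 into y'' + P⁻¹ΦPy = 0. Here Φ = A - ½B' - ¼B² is `jacobiEnd
h`, and differentiation in this frame is ∇T = T' + ½[B, T], which is `dynDeriv h`. The whole proof
rests on the scalar tr(Φ[∇Φ, ∇²Φ]), the `obstruction`. The set 𝒰 consists of the structures whose
obstruction is nonzero at one fixed tangent vector in one chart.

Vanishing for variational structures. An Euler-Lagrange operator is the gradient of an action, so
its linearization is formally self-adjoint, by symmetry of second derivatives. Along a path the
derivative of the multiplier g drops out, because it is multiplied by x'' + h = 0, and the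
linearization is g(D² + BD + A). Self-adjointness says that g is symmetric, that ∇g = 0 and that gΦ
is symmetric (`multiplier_along_path`, the Helmholtz conditions). It does not matter that g depends
on higher jets, since only its restriction to a path is used. Differentiating along the path, g∇Φ
and g∇²Φ are symmetric too (`symmetric_covariant`). For g-symmetric X, Y, Z the g-adjoint of XYZ is
ZYX, whence tr(X[Y, Z]) = 0; the kernel of g is harmless because its generator is an eigenvector of
all three (`traceComm_eq_zero_of_symmetric`). Continuity carries the vanishing from the dense set Ω
to all tangent vectors. As g annihilates the velocity, the argument applies to the normalized
representative of h, and no invariance of the obstruction under h ↦ h + νx' is needed.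

Openness. Φ involves two derivatives of h and each ∇ one more, so the obstruction at a point is a
continuous function of the 4-jet of h.

Density. Let u be the fixed velocity. Adding to h a field that vanishes to order 1, 2 or 3 on a
hyperplane of positions transverse to u changes, at the given vector, Φ, or only ∇Φ among Φ and ∇Φ,
or only ∇²Φ among all three. The changes can be multiples of e⊗f, f⊗e and e⊗e, with e, f orthonormal
and orthogonal to u, which is possible because n ≥ 2. The obstruction is affine in each of its three
slots and tr((e⊗f)[f⊗e, e⊗e]) = 1, so three small perturbations make it nonzero. They have compact
support in a chart, hence are small in the strong topology.

Finsler metrics. Homogeneity and positive definiteness force the velocity Hessian of the metric to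
have kernel spanned by the velocity, so Finsler structures are variational. -/

/-! ### Jacobi endomorphism, dynamical covariant derivative and the obstruction -/

section Operators

variable {E F : Type*} [NormedAddCommGroup E] [NormedSpace ℝ E] [NormedAddCommGroup F]
  [NormedSpace ℝ F]

/-- The derivative of `h` in the position variables. -/
noncomputable def posDeriv (h : E × E → F) (z : E × E) : E →L[ℝ] F :=
  (fderiv ℝ h z).comp (ContinuousLinearMap.inl ℝ E E)

/-- The derivative of `h` in the velocity variables. -/
noncomputable def velDeriv (h : E × E → F) (z : E × E) : E →L[ℝ] F :=
  (fderiv ℝ h z).comp (ContinuousLinearMap.inr ℝ E E)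

/-- The derivative of `f` along the spray `(v, -h)`. -/
noncomputable def sprayDeriv (h : E × E → E) (f : E × E → F) (z : E × E) : F :=
  fderiv ℝ f z (z.2, -h z)

/-- The Jacobi endomorphism of the equation `x'' + h(x, x') = 0`. -/
noncomputable def jacobiEnd (h : E × E → E) (z : E × E) : E →L[ℝ] E :=
  posDeriv h z - (1 / 2 : ℝ) • sprayDeriv h (velDeriv h) z
    - (1 / 4 : ℝ) • (velDeriv h z).comp (velDeriv h z)

/-- The dynamical covariant derivative of a field of endomorphisms. -/
noncomputable def dynDeriv (h : E × E → E) (T : E × E → E →L[ℝ] E) (z : E × E) : E →L[ℝ] E :=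
  sprayDeriv h T z
    + (1 / 2 : ℝ) • ((velDeriv h z).comp (T z) - (T z).comp (velDeriv h z))

/-- The alternating trilinear form `tr (X [Y, Z])` on endomorphisms. -/
noncomputable def traceComm (X Y Z : E →L[ℝ] E) : ℝ :=
  LinearMap.trace ℝ E (X.comp (Y.comp Z - Z.comp Y) : E →L[ℝ] E)

/-- The obstruction to the existence of a multiplier for `x'' + h(x, x') = 0`. -/
noncomputable def obstruction (h : E × E → E) (z : E × E) : ℝ :=
  traceComm (jacobiEnd h z) (dynDeriv h (jacobiEnd h) z) (dynDeriv h (dynDeriv h (jacobiEnd h)) z)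

variable {U : Set (E × E)}

theorem ContDiffOn.fderiv_infty {G : Type*} [NormedAddCommGroup G] [NormedSpace ℝ G] {f : G → F}
    {U : Set G} (hf : ContDiffOn ℝ ∞ f U) (hU : IsOpen U) : ContDiffOn ℝ ∞ (fderiv ℝ f) U :=
  hf.fderiv_of_isOpen hU (by simp)

theorem ContDiffOn.posDeriv {h : E × E → F} (hh : ContDiffOn ℝ ∞ h U) (hU : IsOpen U) :
    ContDiffOn ℝ ∞ (posDeriv h) U :=
  (hh.fderiv_infty hU).clm_comp contDiffOn_const

theorem ContDiffOn.velDeriv {h : E × E → F} (hh : ContDiffOn ℝ ∞ h U) (hU : IsOpen U) :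
    ContDiffOn ℝ ∞ (velDeriv h) U :=
  (hh.fderiv_infty hU).clm_comp contDiffOn_const

theorem ContDiffOn.sprayDeriv {h : E × E → E} (hh : ContDiffOn ℝ ∞ h U) {f : E × E → F}
    (hf : ContDiffOn ℝ ∞ f U) (hU : IsOpen U) : ContDiffOn ℝ ∞ (sprayDeriv h f) U :=
  (hf.fderiv_infty hU).clm_apply (contDiffOn_snd.prodMk hh.neg)

theorem ContDiffOn.jacobiEnd {h : E × E → E} (hh : ContDiffOn ℝ ∞ h U) (hU : IsOpen U) :
    ContDiffOn ℝ ∞ (jacobiEnd h) U :=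
  ((hh.posDeriv hU).sub ((hh.sprayDeriv (hh.velDeriv hU) hU).const_smul _)).sub
    (((hh.velDeriv hU).clm_comp (hh.velDeriv hU)).const_smul _)

theorem ContDiffOn.dynDeriv {h : E × E → E} (hh : ContDiffOn ℝ ∞ h U) {T : E × E → E →L[ℝ] E}
    (hT : ContDiffOn ℝ ∞ T U) (hU : IsOpen U) : ContDiffOn ℝ ∞ (dynDeriv h T) U :=
  (hh.sprayDeriv hT hU).add
    ((((hh.velDeriv hU).clm_comp hT).sub (hT.clm_comp (hh.velDeriv hU))).const_smul _)

/-- `traceComm` as a continuous function. -/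
theorem continuous_traceComm [FiniteDimensional ℝ E] :
    Continuous fun p : (E →L[ℝ] E) × (E →L[ℝ] E) × (E →L[ℝ] E) => traceComm p.1 p.2.1 p.2.2 := by
  have : Continuous fun X : E →L[ℝ] E => LinearMap.trace ℝ E (X : E →ₗ[ℝ] E) :=
    LinearMap.continuous_of_finiteDimensional
      ((LinearMap.trace ℝ E).comp (ContinuousLinearMap.coeLM ℝ))
  refine this.comp ?_
  fun_prop

theorem ContDiffOn.continuousOn_obstruction [FiniteDimensional ℝ E] {h : E × E → E}
    (hh : ContDiffOn ℝ ∞ h U) (hU : IsOpen U) : ContinuousOn (obstruction h) U := by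
  have h1 := hh.jacobiEnd hU
  have h2 := hh.dynDeriv h1 hU
  have h3 := hh.dynDeriv h2 hU
  exact continuous_traceComm.comp_continuousOn
    (h1.continuousOn.prodMk (h2.continuousOn.prodMk h3.continuousOn))

end Operators

/-! ### Endomorphisms symmetric for a form with one-dimensional kernel -/

section LinearAlgebra

variable {E : Type*} [NormedAddCommGroup E] [InnerProductSpace ℝ E] [FiniteDimensional ℝ E]

/-- Three endomorphisms that are symmetric for a symmetric form with one-dimensional kernel have
vanishing `traceComm`. -/
theorem traceComm_eq_zero_of_symmetric {g : E →L[ℝ] E →L[ℝ] ℝ} {v : E} (hv : v ≠ 0)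
    (hg : ∀ x y, g x y = g y x) (hker : ∀ w, g w = 0 ↔ ∃ ν : ℝ, w = ν • v)
    {X Y Z : E →L[ℝ] E} (hX : ∀ x y, g (X x) y = g (X y) x) (hY : ∀ x y, g (Y x) y = g (Y y) x)
    (hZ : ∀ x y, g (Z x) y = g (Z y) x) : traceComm X Y Z = 0 := by
  have hgv : g v = 0 := (hker v).2 ⟨1, by simp⟩
  -- Symmetry puts `T v` into the kernel of `g`: g(Tv, y) = g(Ty, v) = 0.
  have eig : ∀ {T : E →L[ℝ] E}, (∀ x y, g (T x) y = g (T y) x) → ∃ ν : ℝ, T v = ν • v := by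
    intro T hT
    refine (hker _).1 (ContinuousLinearMap.ext fun y => ?_)
    rw [hT, hg, hgv]; rfl
  obtain ⟨a, ha⟩ := eig hX
  obtain ⟨b, hb⟩ := eig hY
  obtain ⟨c, hc⟩ := eig hZ
  -- a linear functional with value one at `v`
  set l : E →ₗ[ℝ] ℝ := ((‖v‖ ^ 2)⁻¹ : ℝ) • (innerSL ℝ v : E →ₗ[ℝ] ℝ) with hl
  have hlv : l v = 1 := by
    have : ‖v‖ ≠ 0 := norm_ne_zero_iff.2 hv
    simp [hl]; field_simp
  set R : E →ₗ[ℝ] E := l.smulRight v with hR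
  -- Adding l⊗l fills in the kernel direction, so that `G` is nondegenerate and can be used to take
  -- adjoints.
  set G : E →ₗ[ℝ] Module.Dual ℝ E :=
    { toFun := fun x => (g x : E →ₗ[ℝ] ℝ) + l x • l
      map_add' := fun x y => by ext; simp [add_mul]; ring
      map_smul' := fun r x => by ext; simp; ring } with hG
  have hGapp : ∀ x y, G x y = g x y + l x * l y := fun x y => by simp [hG]
  have hGinj : Function.Injective G := by
    refine (injective_iff_map_eq_zero G).2 fun x hx => ?_
    have hlx : l x = 0 := by
      have := congrArg (fun f => f v) hx
      simpa [hGapp, hg x v, hgv, hlv] using this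
    have : g x = 0 := by
      ext y
      have := congrArg (fun f => f y) hx
      simpa [hGapp, hlx] using this
    obtain ⟨ν, rfl⟩ := (hker x).1 this
    have : ν = 0 := by simpa [hlv] using hlx
    simp [this]
  set e : E ≃ₗ[ℝ] Module.Dual ℝ E :=
    LinearEquiv.ofInjectiveOfFinrankEq G hGinj Subspace.dual_finrank_eq.symm with he
  have heG : ∀ x, e x = G x := fun x => rfl
  have key : ∀ {A B C : E →L[ℝ] E}, (∀ x y, g (A x) y = g (A y) x) →
      (∀ x y, g (B x) y = g (B y) x) → (∀ x y, g (C x) y = g (C y) x) →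
      ∀ x y, g (A (B (C x))) y = g (C (B (A y))) x := by
    intro A B C hA hB hC x y
    rw [hA, hg, hB, hg, hC]
  set W : E →ₗ[ℝ] E := ((X.comp (Y.comp Z) : E →L[ℝ] E) : E →ₗ[ℝ] E) with hW
  set W' : E →ₗ[ℝ] E := ((Z.comp (Y.comp X) : E →L[ℝ] E) : E →ₗ[ℝ] E) with hW'
  have hWv : W v = (a * b * c) • v := by
    simp [hW, ha, hb, hc, smul_smul]; ring_nf
  have hWv' : W' v = (a * b * c) • v := by
    simp [hW', ha, hb, hc, smul_smul]
  -- Projecting along `v` onto the kernel of `l` removes the eigenvalue at `v` from the trace. That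
  -- eigenvalue is abc for both XYZ and ZYX, so comparing the compressed traces compares the full
  -- ones.
  have compress : ∀ {V : E →ₗ[ℝ] E} {d : ℝ}, V v = d • v →
      LinearMap.trace ℝ E ((LinearMap.id - R) ∘ₗ V) = LinearMap.trace ℝ E V - d := by
    intro V d hd
    rw [LinearMap.sub_comp, map_sub, LinearMap.id_comp]
    congr 1
    have : R ∘ₗ V = (l ∘ₗ V).smulRight v := by ext; simp [hR]
    rw [this, LinearMap.trace_smulRight]
    simp [hd, hlv]
  -- X, Y, Z need not be symmetric for `G`, only for `g`. After the projection, `G` sees only `g`,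
  -- so the compressions of XYZ and ZYX are `G`-adjoint to each other and therefore have equal
  -- traces.
  have adj : e.conj ((LinearMap.id - R) ∘ₗ W) =
      Module.Dual.transpose (R := ℝ) ((LinearMap.id - R) ∘ₗ W') := by
    refine LinearMap.ext fun φ => ?_
    obtain ⟨x, rfl⟩ := e.surjective φ
    refine LinearMap.ext fun y => ?_
    have hlR : ∀ u, l (u - R u) = 0 := fun u => by simp [hR, hlv]
    have hgR : ∀ u, g (u - R u) = g u := fun u => by simp [hR, hgv]
    have h1 : ∀ u w, G (u - R u) w = g u w := fun u w => by rw [hGapp, hlR, hgR]; simp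
    have h2 : ∀ u w, G w (u - R u) = g u w := fun u w => by
      rw [hGapp, hlR, hg, hgR]; simp
    simp only [LinearEquiv.conj_apply, LinearMap.comp_apply, LinearEquiv.coe_coe,
      Module.Dual.transpose_apply, heG, LinearMap.sub_apply,
      LinearMap.id_apply]
    have hs : e.symm (G x) = x := e.symm_apply_apply x
    rw [h1, h2, hs]
    exact key hX hY hZ x y
  have t1 := congrArg (LinearMap.trace ℝ _) adj
  rw [LinearMap.trace_conj', LinearMap.trace_transpose', compress hWv,
    compress hWv'] at t1
  have cyc : LinearMap.trace ℝ E (X.comp (Z.comp Y) : E →L[ℝ] E) = LinearMap.trace ℝ E W' := by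
    have e1 : ((X.comp (Z.comp Y) : E →L[ℝ] E) : E →ₗ[ℝ] E) =
      (X : E →ₗ[ℝ] E) * ((Z : E →ₗ[ℝ] E) * (Y : E →ₗ[ℝ] E)) := rfl
    have e2 : W' = (Z : E →ₗ[ℝ] E) * (Y : E →ₗ[ℝ] E) * (X : E →ₗ[ℝ] E) := rfl
    rw [e1, e2, LinearMap.trace_mul_comm]
  have : ((X.comp (Y.comp Z - Z.comp Y) : E →L[ℝ] E) : E →ₗ[ℝ] E) =
      W - (X.comp (Z.comp Y) : E →L[ℝ] E) := by
    ext; simp [hW]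
  rw [traceComm, this, map_sub, cyc]
  linarith

end LinearAlgebra

/-! ### Smooth integral curves and paths -/

section ODE

variable {E : Type*} [NormedAddCommGroup E] [NormedSpace ℝ E] [CompleteSpace E]

/-- Through every point there is a smooth integral curve of a smooth vector field. -/
theorem exists_smooth_integralCurve {X : E → E} {U : Set E} (hU : IsOpen U)
    (hX : ContDiffOn ℝ ∞ X U) {z : E} (hz : z ∈ U) :
    ∃ (ε : ℝ) (α : ℝ → E), 0 < ε ∧ α 0 = z ∧ (∀ t ∈ Ioo (-ε) ε, α t ∈ U) ∧
      (∀ t ∈ Ioo (-ε) ε, HasDerivAt α (X (α t)) t) ∧ ContDiffOn ℝ ∞ α (Ioo (-ε) ε) := by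
  have h1 : ContDiffAt ℝ 1 X z := ((hX z hz).contDiffAt (hU.mem_nhds hz)).of_le (by simp)
  obtain ⟨α, hα0, ε, hε, hα⟩ :=
    h1.exists_forall_mem_closedBall_exists_eq_forall_mem_Ioo_hasDerivAt₀ 0
  simp only [zero_sub, zero_add] at hα
  have hc : ContinuousAt α 0 := (hα 0 ⟨by linarith, hε⟩).continuousAt
  obtain ⟨δ, hδ, hδU⟩ := Metric.mem_nhds_iff.1
    (hc.preimage_mem_nhds (by rw [hα0]; exact hU.mem_nhds hz))
  -- The smoothness theorem for solutions is applied on a closed interval, so `[-η, η]` has to lie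
  -- strictly inside both the existence interval and the interval on which the curve stays in `U`.
  set η := min ε δ / 2 with hη
  have hηpos : 0 < η := by positivity
  have hηε : η < ε := by have := min_le_left ε δ; have : 0 < min ε δ := by positivity
                         linarith
  have hηδ : η < δ := by have := min_le_right ε δ; have : 0 < min ε δ := by positivity
                         linarith
  have hmem : ∀ t ∈ Icc (-η) η, α t ∈ U := fun t ht => hδU (by
    rw [Metric.mem_ball, Real.dist_eq, sub_zero, abs_lt]
    exact ⟨by linarith [ht.1], by linarith [ht.2]⟩)
  have hder : ∀ t ∈ Icc (-η) η, HasDerivAt α (X (α t)) t := fun t ht =>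
    hα t ⟨by linarith [ht.1], by linarith [ht.2]⟩
  refine ⟨η, α, hηpos, hα0, fun t ht => hmem t (Ioo_subset_Icc_self ht),
    fun t ht => hder t (Ioo_subset_Icc_self ht), ?_⟩
  refine ContDiffOn.mono ?_ Ioo_subset_Icc_self
  refine ODE.contDiffOn_enat_Icc_of_hasDerivWithinAt (n := ⊤) (f := fun _ => X) (u := U) ?_
    (fun t ht => (hder t ht).hasDerivWithinAt) hmem
  exact hX.comp contDiffOn_snd (fun p hp => hp.2)

/-- Smooth solutions of `x'' + h(x, x') = 0` with prescribed initial data. -/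
theorem exists_smooth_path {h : E × E → E} {U : Set (E × E)} (hU : IsOpen U)
    (hh : ContDiffOn ℝ ∞ h U) {z : E × E} (hz : z ∈ U) :
    ∃ (ε : ℝ) (c : ℝ → E), 0 < ε ∧ (c 0, deriv c 0) = z ∧ ContDiffOn ℝ ∞ c (Ioo (-ε) ε) ∧
      (∀ t ∈ Ioo (-ε) ε, (c t, deriv c t) ∈ U) ∧
      ∀ t ∈ Ioo (-ε) ε, iteratedDeriv 2 c t = -h (c t, deriv c t) := by
  obtain ⟨ε, α, hε, h0, hmem, hder, hsm⟩ := exists_smooth_integralCurve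
    (X := fun z : E × E => (z.2, -h z)) hU (contDiffOn_snd.prodMk hh.neg) hz
  have hc : ∀ t ∈ Ioo (-ε) ε, HasDerivAt (fun s => (α s).1) (α t).2 t := fun t ht =>
    (hder t ht).fst
  have hc' : ∀ t ∈ Ioo (-ε) ε, deriv (fun s => (α s).1) t = (α t).2 := fun t ht =>
    (hc t ht).deriv
  have hα : ∀ t ∈ Ioo (-ε) ε, ((α t).1, deriv (fun s => (α s).1) t) = α t := fun t ht => by
    rw [hc' t ht]
  refine ⟨ε, fun s => (α s).1, hε, ?_, contDiff_fst.comp_contDiffOn hsm, fun t ht => ?_,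
    fun t ht => ?_⟩
  · rw [← h0]; exact hα 0 ⟨by linarith, hε⟩
  · rw [hα t ht]; exact hmem t ht
  · rw [hα t ht, iteratedDeriv_succ, iteratedDeriv_one]
    have : deriv (fun s => (α s).1) =ᶠ[𝓝 t] fun s => (α s).2 :=
      Filter.eventually_of_mem (isOpen_Ioo.mem_nhds ht) hc'
    rw [this.deriv_eq]
    exact HasDerivAt.deriv (f := fun s => (α s).2) (hder t ht).snd

end ODE

/-! ### Integration by parts, the fundamental lemma and formal adjoints -/

section Integrals

open MeasureTheory intervalIntegral
open scoped Interval

theorem tsupport_iteratedDeriv_subset' {F : Type*} [NormedAddCommGroup F] [NormedSpace ℝ F]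
    (f : ℝ → F) (k : ℕ) : tsupport (iteratedDeriv k f) ⊆ tsupport f := by
  induction k with
  | zero => simp
  | succ k ih => rw [iteratedDeriv_succ]; exact tsupport_deriv_subset.trans ih

theorem ContDiffOn.iteratedDeriv_infty {F : Type*} [NormedAddCommGroup F] [NormedSpace ℝ F]
    {f : ℝ → F} {I : Set ℝ} (hI : IsOpen I) (hf : ContDiffOn ℝ ∞ f I) (k : ℕ) :
    ContDiffOn ℝ ∞ (iteratedDeriv k f) I := by
  induction k with
  | zero => simpa using hf
  | succ k ih =>
    rw [iteratedDeriv_succ]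
    exact ((contDiffOn_infty_iff_deriv_of_isOpen hI).1 ih).2

theorem ContDiffOn.hasDerivAt_of_mem {F : Type*} [NormedAddCommGroup F] [NormedSpace ℝ F]
    {f : ℝ → F} {I : Set ℝ} (hI : IsOpen I) (hf : ContDiffOn ℝ ∞ f I) {t : ℝ} (ht : t ∈ I) :
    HasDerivAt f (deriv f t) t :=
  (((hf t ht).contDiffAt (hI.mem_nhds ht)).differentiableAt (by simp)).hasDerivAt

/-- Repeated integration by parts against a compactly supported function. -/
theorem integral_mul_iteratedDeriv {f ρ : ℝ → ℝ} {I : Set ℝ} (hI : IsOpen I)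
    (hf : ContDiffOn ℝ ∞ f I) (hρ : ContDiff ℝ ∞ ρ) {α β : ℝ} (hαβ : α ≤ β) (hIcc : Icc α β ⊆ I)
    (hsupp : tsupport ρ ⊆ Ioo α β) (k : ℕ) :
    ∫ t in α..β, f t * iteratedDeriv k ρ t =
      (-1) ^ k * ∫ t in α..β, iteratedDeriv k f t * ρ t := by
  induction k generalizing f with
  | zero => simp
  | succ k ih =>
    have hf' : ContDiffOn ℝ ∞ (deriv f) I := ((contDiffOn_infty_iff_deriv_of_isOpen hI).1 hf).2
    have hρk : ContDiff ℝ ∞ (iteratedDeriv k ρ) := 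
      contDiffOn_univ.1 ((contDiffOn_univ.2 hρ).iteratedDeriv_infty isOpen_univ k)
    have h0 : ∀ t, t ∉ Ioo α β → iteratedDeriv k ρ t = 0 := fun t ht =>
      image_eq_zero_of_notMem_tsupport fun h => ht (hsupp (tsupport_iteratedDeriv_subset' ρ k h))
    have hu : uIcc α β = Icc α β := uIcc_of_le hαβ
    rw [iteratedDeriv_succ, integral_mul_deriv_eq_deriv_mul (u' := deriv f)
      (fun t ht => hf.hasDerivAt_of_mem hI (hIcc (hu ▸ ht)))
      (fun t _ => (hρk.differentiable (by simp) t).hasDerivAt)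
      ((hf'.continuousOn.mono (hu ▸ hIcc)).intervalIntegrable)
      ((hρk.continuous_deriv (by simp)).intervalIntegrable _ _),
      h0 β (by simp), h0 α (by simp), ih hf', iteratedDeriv_succ', pow_succ]
    ring

/-- If the integrals of a family of functions vanish identically, so does the integral of the
derivative in the parameter. -/
theorem integral_deriv_eq_zero_of_integral_eq_zero {w : ℝ × ℝ → ℝ} {D : Set (ℝ × ℝ)}
    (hD : IsOpen D) (hw : ContDiffOn ℝ ∞ w D) {α β : ℝ} (hαβ : α ≤ β)
    (h0 : ∀ t ∈ Icc α β, ((0 : ℝ), t) ∈ D)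
    (hint : ∀ᶠ a in 𝓝 (0 : ℝ), ∫ t in α..β, w (a, t) = 0) :
    ∫ t in α..β, fderiv ℝ w (0, t) (1, 0) = 0 := by
  obtain ⟨u, v, hu, hv, h0u, hIv, huv⟩ := generalized_tube_lemma
    (isCompact_singleton (x := (0 : ℝ))) (isCompact_Icc (a := α) (b := β)) hD
    (by rintro ⟨a, t⟩ ⟨rfl, ht⟩; exact h0 t ht)
  obtain ⟨δ, hδ, hδu⟩ := Metric.nhds_basis_closedBall.mem_iff.1 (hu.mem_nhds (h0u rfl))
  have hsub : Metric.closedBall (0 : ℝ) δ ×ˢ Icc α β ⊆ D := (prod_mono hδu hIv).trans huv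
  have hcw : ContinuousOn w D := hw.continuousOn
  have hcw' : ContinuousOn (fun p => fderiv ℝ w p (1, 0)) D :=
    (hw.fderiv_infty hD).continuousOn.clm_apply continuousOn_const
  obtain ⟨C, hC⟩ :=
    ((isCompact_closedBall (0 : ℝ) δ).prod isCompact_Icc).exists_bound_of_continuousOn
      (hcw'.mono hsub)
  have hu' : Ι α β ⊆ Icc α β := by rw [uIoc_of_le hαβ]; exact Ioc_subset_Icc_self
  have slice : ∀ {f : ℝ × ℝ → ℝ}, ContinuousOn f D → ∀ a ∈ Metric.closedBall (0 : ℝ) δ,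
      ContinuousOn (fun t => f (a, t)) (Icc α β) := fun hf a ha =>
    hf.comp (by fun_prop) fun t ht => hsub ⟨ha, ht⟩
  have key := hasDerivAt_integral_of_dominated_loc_of_deriv_le (μ := volume) (a := α) (b := β)
    (F := fun a t => w (a, t)) (F' := fun a t => fderiv ℝ w (a, t) (1, 0)) (x₀ := (0 : ℝ))
    (bound := fun _ => C) (Metric.closedBall_mem_nhds 0 hδ)
    (Filter.eventually_of_mem (Metric.closedBall_mem_nhds 0 hδ) fun a ha =>
      (((slice hcw a ha).mono hu').aestronglyMeasurable measurableSet_uIoc))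
    ((slice hcw 0 (Metric.mem_closedBall_self hδ.le)).intervalIntegrable_of_Icc hαβ)
    (((slice hcw' 0 (Metric.mem_closedBall_self hδ.le)).mono hu').aestronglyMeasurable
      measurableSet_uIoc)
    (Filter.Eventually.of_forall fun t ht a ha => hC (a, t) ⟨ha, hu' ht⟩)
    intervalIntegrable_const
    (Filter.Eventually.of_forall fun t ht a ha => by
      have hd : HasFDerivAt w (fderiv ℝ w (a, t)) (a, t) :=
        (((hw _ (hsub ⟨ha, hu' ht⟩)).contDiffAt
          (hD.mem_nhds (hsub ⟨ha, hu' ht⟩))).differentiableAt (by simp)).hasFDerivAt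
      exact hd.comp_hasDerivAt a ((hasDerivAt_id a).prodMk (hasDerivAt_const a t)))
  have hz : (fun a => ∫ t in α..β, w (a, t)) =ᶠ[𝓝 0] fun _ => 0 := hint
  exact key.2.unique ((hasDerivAt_const 0 (0 : ℝ)).congr_of_eventuallyEq hz)

/-- A continuous function on an interval that is orthogonal to all bump functions vanishes. -/
theorem eq_zero_of_integral_bump_mul_eq_zero {u : ℝ → ℝ} {α β : ℝ} (hu : ContinuousOn u (Ioo α β))
    (h : ∀ ρ : ℝ → ℝ, ContDiff ℝ ∞ ρ → tsupport ρ ⊆ Ioo α β → ∫ t in α..β, ρ t * u t = 0)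
    {t : ℝ} (ht : t ∈ Ioo α β) : u t = 0 := by
  have hαβ : α ≤ β := (ht.1.trans ht.2).le
  have hae := isOpen_Ioo.ae_eq_zero_of_integral_contDiff_smul_eq_zero (μ := volume) (f := u)
    (hu.locallyIntegrableOn measurableSet_Ioo) (fun ρ hρ _ hsupp => by
      rw [← h ρ hρ hsupp, intervalIntegral.integral_of_le hαβ]
      symm
      refine setIntegral_eq_integral_of_forall_compl_eq_zero fun x hx => ?_
      have : ρ x = 0 := image_eq_zero_of_notMem_tsupport fun h' =>
        hx (Ioo_subset_Ioc_self (hsupp h'))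
      simp [this])
  have : u =ᵐ[volume.restrict (Ioo α β)] fun _ => 0 :=
    (ae_restrict_iff' measurableSet_Ioo).2 hae
  exact Measure.eqOn_open_of_ae_eq this isOpen_Ioo hu continuousOn_const ht

/-- Bump functions that are one near a given point. -/
theorem exists_bump_eventuallyEq_one {E : Type*} [NormedAddCommGroup E] [InnerProductSpace ℝ E]
    [FiniteDimensional ℝ E] {U : Set E} (hU : IsOpen U) {x : E} (hx : x ∈ U) :
    ∃ χ : E → ℝ, ContDiff ℝ ∞ χ ∧ HasCompactSupport χ ∧ tsupport χ ⊆ U ∧ ∀ᶠ y in 𝓝 x, χ y = 1 := by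
  obtain ⟨δ, hδ, hδU⟩ := Metric.nhds_basis_closedBall.mem_iff.1 (hU.mem_nhds hx)
  let χ : ContDiffBump x := ⟨δ / 2, δ, half_pos hδ, half_lt_self hδ⟩
  exact ⟨χ, χ.contDiff, χ.hasCompactSupport, by rw [χ.tsupport_eq]; exact hδU, χ.eventuallyEq_one⟩

/-- There is a bump function with prescribed `2`-jet at a point of an interval. -/
theorem exists_bump_with_jet {α β t : ℝ} (ht : t ∈ Ioo α β) (x y z : ℝ) :
    ∃ σ : ℝ → ℝ, ContDiff ℝ ∞ σ ∧ tsupport σ ⊆ Ioo α β ∧ σ t = x ∧ deriv σ t = y ∧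
      iteratedDeriv 2 σ t = z := by
  obtain ⟨χ, hχ, -, hsupp, h1⟩ := exists_bump_eventuallyEq_one isOpen_Ioo ht
  set p : ℝ → ℝ := fun s => x + y * (s - t) + z / 2 * (s - t) ^ 2 with hp
  have hpd : ∀ s, HasDerivAt p (y + z * (s - t)) s := fun s => by
    have h := (((hasDerivAt_id s).sub_const t).const_mul y).const_add x |>.add
      ((((hasDerivAt_id s).sub_const t).pow 2).const_mul (z / 2))
    refine HasDerivAt.congr_deriv (f := p) h ?_
    simp; ring
  have hpd' : deriv p = fun s => y + z * (s - t) := funext fun s => (hpd s).deriv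
  have hpd2 : deriv (deriv p) t = z := by
    rw [hpd']
    simp
  have heq : (fun s => χ s * p s) =ᶠ[𝓝 t] p := by
    filter_upwards [h1] with s hs
    simp [hs]
  refine ⟨fun s => χ s * p s, hχ.mul (by fun_prop), (tsupport_mul_subset_left).trans hsupp,
    ?_, ?_, ?_⟩
  · exact heq.eq_of_nhds.trans (by simp [hp])
  · rw [heq.deriv_eq, hpd']; simp
  · rw [heq.iteratedDeriv_eq, iteratedDeriv_succ, iteratedDeriv_one, hpd2]

/-- Pointwise form of the symmetry of a bilinear expression of order two in compactly supported
functions. -/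
theorem adjoint_identities {I : Set ℝ} (hI : IsOpen I) {p q s p' q' s' : ℝ → ℝ}
    (hp : ContDiffOn ℝ ∞ p I) (hq : ContDiffOn ℝ ∞ q I) (hs : ContDiffOn ℝ ∞ s I)
    (hp' : ContDiffOn ℝ ∞ p' I) (hq' : ContDiffOn ℝ ∞ q' I) (hs' : ContDiffOn ℝ ∞ s' I)
    (h : ∀ (σ ρ : ℝ → ℝ) (α β : ℝ), ContDiff ℝ ∞ σ → ContDiff ℝ ∞ ρ → α ≤ β → Icc α β ⊆ I →
      tsupport σ ⊆ Ioo α β → tsupport ρ ⊆ Ioo α β →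
      ∫ t in α..β, ρ t * (p t * iteratedDeriv 2 σ t + q t * deriv σ t + s t * σ t) =
      ∫ t in α..β, σ t * (p' t * iteratedDeriv 2 ρ t + q' t * deriv ρ t + s' t * ρ t))
    {t : ℝ} (ht : t ∈ I) :
    p t = p' t ∧ q t = 2 * deriv p' t - q' t ∧
      s t = iteratedDeriv 2 p' t - deriv q' t + s' t := by
  obtain ⟨δ, hδ, hδI⟩ := Metric.nhds_basis_closedBall.mem_iff.1 (hI.mem_nhds ht)
  rw [Real.closedBall_eq_Icc] at hδI
  set α := t - δ
  set β := t + δ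
  have htI : t ∈ Ioo α β := ⟨by simp [α, hδ], by simp [β, hδ]⟩
  have hαβ : α ≤ β := (htI.1.trans htI.2).le
  -- Moving all derivatives off ρ shows that the first operator applied to σ equals the formal
  -- adjoint of the second; expanded, this is a linear relation on the 2-jet of σ at `t`.
  have key : ∀ σ : ℝ → ℝ, ContDiff ℝ ∞ σ → tsupport σ ⊆ Ioo α β →
      (p t - p' t) * iteratedDeriv 2 σ t + (q t - 2 * deriv p' t + q' t) * deriv σ t
        + (s t - iteratedDeriv 2 p' t + deriv q' t - s' t) * σ t = 0 := by
    intro σ hσ hσs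
    have hσ1 : ContDiffOn ℝ ∞ σ I := hσ.contDiffOn
    have hσ' : ContDiffOn ℝ ∞ (deriv σ) I := ((contDiffOn_infty_iff_deriv_of_isOpen hI).1 hσ1).2
    have hσ2 : ContDiffOn ℝ ∞ (iteratedDeriv 2 σ) I := hσ1.iteratedDeriv_infty hI 2
    have hp1 : ContDiffOn ℝ ∞ (deriv p') I := ((contDiffOn_infty_iff_deriv_of_isOpen hI).1 hp').2
    have hfp := hσ1.mul hp'
    have hfq := hσ1.mul hq'
    set fp : ℝ → ℝ := fun t => σ t * p' t with hfp_def
    set fq : ℝ → ℝ := fun t => σ t * q' t with hfq_def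
    have dp : ∀ t ∈ I, deriv fp t = deriv σ t * p' t + σ t * deriv p' t := fun t ht =>
      ((hσ1.hasDerivAt_of_mem hI ht).mul (hp'.hasDerivAt_of_mem hI ht)).deriv
    have dq : ∀ t ∈ I, deriv fq t = deriv σ t * q' t + σ t * deriv q' t := fun t ht =>
      ((hσ1.hasDerivAt_of_mem hI ht).mul (hq'.hasDerivAt_of_mem hI ht)).deriv
    have d2p : ∀ t ∈ I, iteratedDeriv 2 fp t = iteratedDeriv 2 σ t * p' t
        + 2 * (deriv σ t * deriv p' t) + σ t * iteratedDeriv 2 p' t := fun t ht => by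
      have e : deriv fp =ᶠ[𝓝 t] fun t => deriv σ t * p' t + σ t * deriv p' t :=
        Filter.eventually_of_mem (hI.mem_nhds ht) dp
      simp only [iteratedDeriv_succ, iteratedDeriv_zero]
      rw [e.deriv_eq]
      have := ((hσ'.hasDerivAt_of_mem hI ht).mul (hp'.hasDerivAt_of_mem hI ht)).add
        ((hσ1.hasDerivAt_of_mem hI ht).mul (hp1.hasDerivAt_of_mem hI ht))
      refine (HasDerivAt.deriv (f := fun t => deriv σ t * p' t + σ t * deriv p' t) this).trans ?_
      ring
    -- The first operator minus the formal adjoint of the second, applied to σ. It is orthogonal to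
    -- every bump function, hence zero.
    set u : ℝ → ℝ := fun t => p t * iteratedDeriv 2 σ t + q t * deriv σ t + s t * σ t
      - (iteratedDeriv 2 fp t - deriv fq t + σ t * s' t) with hu
    have hfp2 := hfp.iteratedDeriv_infty hI 2
    have hfq1 : ContDiffOn ℝ ∞ (deriv fq) I := ((contDiffOn_infty_iff_deriv_of_isOpen hI).1 hfq).2
    have huc : ContinuousOn u I :=
      ((((hp.mul hσ2).add (hq.mul hσ')).add (hs.mul hσ1)).sub
        ((hfp2.sub hfq1).add (hσ1.mul hs'))).continuousOn
    have hut : u t = 0 := by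
      refine eq_zero_of_integral_bump_mul_eq_zero (huc.mono (Ioo_subset_Icc_self.trans hδI))
        (fun ρ hρ hρs => ?_) htI
      have h1 := h σ ρ α β hσ hρ hαβ hδI hσs hρs
      have i1 := integral_mul_iteratedDeriv hI hfp hρ hαβ hδI hρs 2
      have i2 := integral_mul_iteratedDeriv hI hfq hρ hαβ hδI hρs 1
      have cint : ∀ {f : ℝ → ℝ}, ContDiffOn ℝ ∞ f I → IntervalIntegrable f volume α β :=
        fun hf => (hf.continuousOn.mono hδI).intervalIntegrable_of_Icc hαβ
      have hρ1 : ContDiffOn ℝ ∞ ρ I := hρ.contDiffOn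
      have hρ' : ContDiffOn ℝ ∞ (iteratedDeriv 1 ρ) I := hρ1.iteratedDeriv_infty hI 1
      have hρ2 : ContDiffOn ℝ ∞ (iteratedDeriv 2 ρ) I := hρ1.iteratedDeriv_infty hI 2
      have e1 : ∫ t in α..β, ρ t * u t =
          (∫ t in α..β, ρ t * (p t * iteratedDeriv 2 σ t + q t * deriv σ t + s t * σ t))
          - ((∫ t in α..β, iteratedDeriv 2 fp t * ρ t)
            - (∫ t in α..β, iteratedDeriv 1 fq t * ρ t) + ∫ t in α..β, σ t * s' t * ρ t) := by
        rw [← integral_sub (cint (hfp2.mul hρ1))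
            (cint ((hfq.iteratedDeriv_infty hI 1).mul hρ1)),
          ← integral_add ((cint (hfp2.mul hρ1)).sub
            (cint ((hfq.iteratedDeriv_infty hI 1).mul hρ1))) (cint ((hσ1.mul hs').mul hρ1)),
          ← integral_sub (cint (hρ1.mul (((hp.mul hσ2).add (hq.mul hσ')).add (hs.mul hσ1))))
            (((cint (hfp2.mul hρ1)).sub
            (cint ((hfq.iteratedDeriv_infty hI 1).mul hρ1))).add (cint ((hσ1.mul hs').mul hρ1)))]
        refine integral_congr fun t _ => ?_
        simp only [hu, iteratedDeriv_one]
        ring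
      have e2 : ∫ t in α..β, σ t * (p' t * iteratedDeriv 2 ρ t + q' t * deriv ρ t + s' t * ρ t) =
          (∫ t in α..β, fp t * iteratedDeriv 2 ρ t) + (∫ t in α..β, fq t * iteratedDeriv 1 ρ t)
            + ∫ t in α..β, σ t * s' t * ρ t := by
        rw [← integral_add (cint (hfp.mul hρ2)) (cint (hfq.mul hρ')),
          ← integral_add ((cint (hfp.mul hρ2)).add (cint (hfq.mul hρ')))
            (cint ((hσ1.mul hs').mul hρ1))]
        refine integral_congr fun t _ => ?_
        simp only [hfp_def, hfq_def, iteratedDeriv_one]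
        ring
      rw [e1, h1, e2, i1, i2]
      ring
    simp only [hu] at hut
    rw [d2p t ht, dq t ht] at hut
    linear_combination hut
  -- Bump functions whose 2-jet at `t` is a coordinate vector isolate the three coefficients.
  refine ⟨?_, ?_, ?_⟩
  · obtain ⟨σ, h1, h2, h3, h4, h5⟩ := exists_bump_with_jet htI 0 0 1
    have := key σ h1 h2
    rw [h3, h4, h5] at this
    linarith
  · obtain ⟨σ, h1, h2, h3, h4, h5⟩ := exists_bump_with_jet htI 0 1 0
    have := key σ h1 h2
    rw [h3, h4, h5] at this
    linarith
  · obtain ⟨σ, h1, h2, h3, h4, h5⟩ := exists_bump_with_jet htI 1 0 0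
    have := key σ h1 h2
    rw [h3, h4, h5] at this
    linarith

end Integrals

/-! ### First and second variation of a higher-order Lagrangian -/

section FirstVariation

open MeasureTheory intervalIntegral
open scoped Interval

variable {n r : ℕ}

theorem jet_zero (c : ℝ → Coord n) (t : ℝ) : jet r c t 0 = c t := by simp [jet]

theorem jet_one (hr : 1 ≤ r) (c : ℝ → Coord n) (t : ℝ) : jet r c t 1 = deriv c t := by
  -- The numeral `1 : Fin (r + 1)` is reduced modulo `r + 1`; it stands for the velocity only
  -- because `1 ≤ r`.
  have : 1 % (r + 1) = 1 := Nat.mod_eq_of_lt (by omega)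
  simp [jet, this, iteratedDeriv_one]

theorem ContDiffOn.jet {c : ℝ → Coord n} {I : Set ℝ} (hI : IsOpen I) (hc : ContDiffOn ℝ ∞ c I)
    (r : ℕ) : ContDiffOn ℝ ∞ (jet r c) I :=
  contDiffOn_pi.2 fun k => hc.iteratedDeriv_infty hI k

theorem isOpen_jetDomain {W : Set (Coord n × Coord n)} (hW : IsOpen W) (r : ℕ) :
    IsOpen {j : Fin (r + 1) → Coord n | (j 0, j 1) ∈ W} :=
  hW.preimage (by fun_prop)

/-- The first variation formula for compactly supported variations. -/
theorem integral_fderiv_jet (hr : 1 ≤ r) {L : (Fin (r + 1) → Coord n) → ℝ}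
    {W : Set (Coord n × Coord n)} (hW : IsOpen W) (hL : ContDiffOn ℝ ∞ L {j | (j 0, j 1) ∈ W})
    {c : ℝ → Coord n} {I : Set ℝ} (hI : IsOpen I) (hc : ContDiffOn ℝ ∞ c I)
    (hcW : ∀ t ∈ I, (c t, deriv c t) ∈ W) {ρ : ℝ → ℝ} (hρ : ContDiff ℝ ∞ ρ) {α β : ℝ}
    (hαβ : α ≤ β) (hIcc : Icc α β ⊆ I) (hsupp : tsupport ρ ⊆ Ioo α β) (ξ : Coord n) :
    ∫ t in α..β, fderiv ℝ L (jet r c t) (fun k => iteratedDeriv k ρ t • ξ) =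
      ∫ t in α..β, ρ t * eulerLagrange r L c t ξ := by
  have hmem : MapsTo (jet r c) I {j | (j 0, j 1) ∈ W} := fun t ht => by
    simpa only [mem_ofPred_eq, jet_zero, jet_one hr] using hcW t ht
  set f : Fin (r + 1) → ℝ → ℝ := fun k s => fderiv ℝ L (jet r c s) (Pi.single k ξ) with hf_def
  have hf : ∀ k, ContDiffOn ℝ ∞ (f k) I := fun k =>
    ((hL.fderiv_infty (isOpen_jetDomain hW r)).comp (hc.jet hI r) hmem).clm_apply contDiffOn_const
  have cint : ∀ {f : ℝ → ℝ}, ContDiffOn ℝ ∞ f I → IntervalIntegrable f volume α β :=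
    fun hf => (hf.continuousOn.mono hIcc).intervalIntegrable_of_Icc hαβ
  have hρ1 : ContDiffOn ℝ ∞ ρ I := hρ.contDiffOn
  have e1 : ∀ t, fderiv ℝ L (jet r c t) (fun k => iteratedDeriv k ρ t • ξ) =
      ∑ k, f k t * iteratedDeriv k ρ t := fun t => by
    have : (fun k : Fin (r + 1) => iteratedDeriv k ρ t • ξ) =
        ∑ k : Fin (r + 1), iteratedDeriv k ρ t • (Pi.single k ξ : Fin (r + 1) → Coord n) := by
      funext j
      simp [Finset.sum_apply, Pi.single_apply]
    rw [this, map_sum]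
    simp [hf_def, mul_comm]
  have e2 : ∀ t, ρ t * eulerLagrange r L c t ξ =
      ∑ k : Fin (r + 1), (-1) ^ (k : ℕ) * (iteratedDeriv k (f k) t * ρ t) := fun t => by
    rw [eulerLagrange, Finset.mul_sum]
    exact Finset.sum_congr rfl fun k _ => by simp only [hf_def]; ring
  simp only [e1, e2]
  rw [integral_finsetSum fun k _ => cint ((hf k).mul (hρ1.iteratedDeriv_infty hI k)),
    integral_finsetSum fun k _ =>
      cint (contDiffOn_const.mul (((hf k).iteratedDeriv_infty hI k).mul hρ1))]
  refine Finset.sum_congr rfl fun k _ => ?_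
  rw [intervalIntegral.integral_const_mul, integral_mul_iteratedDeriv hI (hf k) hρ hαβ hIcc hsupp]

theorem hasDerivAt_slice {F : Type*} [NormedAddCommGroup F] [NormedSpace ℝ F] {f : ℝ × ℝ → F}
    {a t : ℝ} (hf : DifferentiableAt ℝ f (a, t)) :
    HasDerivAt (fun a => f (a, t)) (fderiv ℝ f (a, t) (1, 0)) a :=
  hf.hasFDerivAt.comp_hasDerivAt (f := fun a => (a, t)) a
    ((hasDerivAt_id a).prodMk (hasDerivAt_const a t))

set_option maxHeartbeats 1600000 in
/-- The second variation of a Lagrangian along a path `c`, expressed through a multiplier `G` of the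
equation `x'' + h(x, x') = 0`. -/
theorem integral_secondVariation (hr : 1 ≤ r) {L : (Fin (r + 1) → Coord n) → ℝ}
    {W Ω : Set (Coord n × Coord n)} (hW : IsOpen W) (hΩ : IsOpen Ω) (hΩW : Ω ⊆ W)
    (hL : ContDiffOn ℝ ∞ L {j | (j 0, j 1) ∈ W})
    {G : (Fin (2 * r + 1) → Coord n) → Coord n →L[ℝ] Coord n →L[ℝ] ℝ}
    (hG : ContDiffOn ℝ ∞ G {j | (j 0, j 1) ∈ Ω}) {h : Coord n × Coord n → Coord n}
    (hh : ContDiffOn ℝ ∞ h W)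
    (hEL : ∀ (c : ℝ → Coord n) (t : ℝ), ContDiffAt ℝ ∞ c t → (c t, deriv c t) ∈ Ω → ∀ ξ,
      eulerLagrange r L c t ξ =
        G (jet (2 * r) c t) (iteratedDeriv 2 c t + h (c t, deriv c t)) ξ)
    {c : ℝ → Coord n} {I : Set ℝ} (hI : IsOpen I) (hc : ContDiffOn ℝ ∞ c I)
    (hcΩ : ∀ t ∈ I, (c t, deriv c t) ∈ Ω)
    (hpath : ∀ t ∈ I, iteratedDeriv 2 c t = -h (c t, deriv c t))
    {σ ρ : ℝ → ℝ} (hσ : ContDiff ℝ ∞ σ) (hρ : ContDiff ℝ ∞ ρ) {α β : ℝ}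
    (hαβ : α ≤ β) (hIcc : Icc α β ⊆ I) (hsupp : tsupport ρ ⊆ Ioo α β) (e₁ e₂ : Coord n) :
    ∫ t in α..β, ρ t * G (jet (2 * r) c t) (iteratedDeriv 2 σ t • e₁
        + fderiv ℝ h (c t, deriv c t) (σ t • e₁, deriv σ t • e₁)) e₂ =
      ∫ t in α..β, fderiv ℝ (fderiv ℝ L) (jet r c t) (fun k => iteratedDeriv k σ t • e₁)
        (fun k => iteratedDeriv k ρ t • e₂) := by
  have h2r : 1 ≤ 2 * r := by omega
  -- the varied curve
  set C : ℝ → ℝ → Coord n := fun a t => c t + a • (σ t • e₁) with hC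
  set J : ∀ m : ℕ, ℝ × ℝ → Fin (m + 1) → Coord n :=
    fun m p k => iteratedDeriv k c p.2 + p.1 • (iteratedDeriv k σ p.2 • e₁) with hJ
  have hσe : ContDiff ℝ ∞ fun t => σ t • e₁ := hσ.smul contDiff_const
  have hiter : ∀ (k : ℕ) (t : ℝ), iteratedDeriv k (fun t => σ t • e₁) t =
      iteratedDeriv k σ t • e₁ := fun k t =>
    iteratedDeriv_smul_const (hσ.contDiffAt.of_le (by exact_mod_cast le_top)) e₁
  have hCsm : ∀ a, ContDiffOn ℝ ∞ (C a) I := fun a => hc.add (hσe.const_smul a).contDiffOn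
  have hCiter : ∀ a, ∀ t ∈ I, ∀ k : ℕ, iteratedDeriv k (C a) t =
      iteratedDeriv k c t + a • (iteratedDeriv k σ t • e₁) := fun a t ht k => by
    have h1 : ContDiffAt ℝ k c t := ((hc t ht).contDiffAt (hI.mem_nhds ht)).of_le
      (by exact_mod_cast le_top)
    have h2 : ContDiffAt ℝ k (fun t => σ t • e₁) t := hσe.contDiffAt.of_le
      (by exact_mod_cast le_top)
    rw [← hiter k t, ← iteratedDeriv_const_smul h2 a]
    exact iteratedDeriv_add h1 (h2.const_smul a)
  have hCjet : ∀ m a, ∀ t ∈ I, jet m (C a) t = J m (a, t) := fun m a t ht =>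
    funext fun k => hCiter a t ht k
  have hCderiv : ∀ a, ∀ t ∈ I, deriv (C a) t = deriv c t + a • (deriv σ t • e₁) :=
    fun a t ht => by simpa [iteratedDeriv_one] using hCiter a t ht 1
  have hJsm : ∀ m, ContDiffOn ℝ ∞ (J m) (univ ×ˢ I) := fun m => contDiffOn_pi.2 fun k => by
    have h1 : ContDiffOn ℝ ∞ (fun p : ℝ × ℝ => iteratedDeriv k c p.2) (univ ×ˢ I) :=
      (hc.iteratedDeriv_infty hI k).comp contDiffOn_snd fun p hp => hp.2
    have h2 : ContDiffOn ℝ ∞ (fun p : ℝ × ℝ => iteratedDeriv k σ p.2) (univ ×ˢ I) :=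
      ((contDiffOn_univ.2 hσ).iteratedDeriv_infty isOpen_univ k).comp contDiffOn_snd
        fun p hp => trivial
    exact h1.add (contDiffOn_fst.smul (h2.smul contDiffOn_const))
  -- the pair (position, velocity) and its domain
  set Z : ℝ × ℝ → Coord n × Coord n :=
    fun p => (c p.2 + p.1 • (σ p.2 • e₁), deriv c p.2 + p.1 • (deriv σ p.2 • e₁)) with hZ
  have hJZ : ∀ m, 1 ≤ m → ∀ p, (J m p 0, J m p 1) = Z p := fun m hm p => by
    have : 1 % (m + 1) = 1 := Nat.mod_eq_of_lt (by omega)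
    simp [hJ, hZ, this, iteratedDeriv_one]
  have hZsm : ContDiffOn ℝ ∞ Z (univ ×ˢ I) := by
    have h1 := contDiffOn_pi.1 (hJsm r) 0
    have h2 := contDiffOn_pi.1 (hJsm r) 1
    exact (h1.prodMk h2).congr fun p _ => (hJZ r hr p).symm
  set D : Set (ℝ × ℝ) := (univ ×ˢ I) ∩ Z ⁻¹' Ω with hD
  have hDo : IsOpen D := hZsm.continuousOn.isOpen_inter_preimage (isOpen_univ.prod hI) hΩ
  have hD0 : ∀ t ∈ I, ((0 : ℝ), t) ∈ D := fun t ht => ⟨⟨trivial, ht⟩, by simpa [hZ] using hcΩ t ht⟩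
  have hρe : ContDiff ℝ ∞ fun t => (fun k : Fin (r + 1) => iteratedDeriv k ρ t • e₂) :=
    contDiff_pi.2 fun k => (contDiffOn_univ.1
      ((contDiffOn_univ.2 hρ).iteratedDeriv_infty isOpen_univ k)).smul contDiff_const
  -- the two integrands
  set w₁ : ℝ × ℝ → ℝ := fun p => fderiv ℝ L (J r p) (fun k => iteratedDeriv k ρ p.2 • e₂) with hw₁
  set q : ℝ × ℝ → Coord n := fun p => J (2 * r) p 2 + h (Z p) with hq
  set w₂ : ℝ × ℝ → ℝ := fun p => ρ p.2 * G (J (2 * r) p) (q p) e₂ with hw₂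
  have hv2 : ((2 : Fin (2 * r + 1)) : ℕ) = 2 := by
    obtain ⟨l, rfl⟩ := Nat.exists_eq_add_of_le' hr
    rfl
  have hw₁sm : ContDiffOn ℝ ∞ w₁ D :=
    ((hL.fderiv_infty (isOpen_jetDomain hW r)).comp ((hJsm r).mono inter_subset_left)
      fun p hp => by
        have := hp.2
        rw [mem_preimage, ← hJZ r hr] at this
        exact hΩW this).clm_apply (hρe.comp_contDiffOn contDiffOn_snd)
  have hqsm : ContDiffOn ℝ ∞ q D :=
    ((contDiffOn_pi.1 (hJsm (2 * r)) 2).mono inter_subset_left).add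
      (hh.comp (hZsm.mono inter_subset_left) fun p hp => hΩW hp.2)
  have hGJsm : ContDiffOn ℝ ∞ (fun p => G (J (2 * r) p)) D :=
    hG.comp ((hJsm (2 * r)).mono inter_subset_left) fun p hp => by
      have := hp.2
      rwa [mem_preimage, ← hJZ (2 * r) h2r] at this
  have hw₂sm : ContDiffOn ℝ ∞ w₂ D :=
    (hρ.comp_contDiffOn contDiffOn_snd).mul
      ((hGJsm.clm_apply hqsm).clm_apply contDiffOn_const)
  -- For small `a` the varied curve stays over Ω on `[α, β]`, and both integrals are the first
  -- variation of the action at `C a` in the direction ρe₂: `w₁` before integrating by parts, `w₂`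
  -- after doing so and inserting the multiplier form of the Euler-Lagrange covector.
  have hint : ∀ᶠ a in 𝓝 (0 : ℝ), ∫ t in α..β, (w₁ - w₂) (a, t) = 0 := by
    obtain ⟨u, v, hu, hv, h0u, hIv, huv⟩ :=
      generalized_tube_lemma (isCompact_singleton (x := (0 : ℝ)))
        (isCompact_Icc (a := α) (b := β)) hDo (by rintro ⟨a, t⟩ ⟨rfl, ht⟩; exact hD0 t (hIcc ht))
    filter_upwards [hu.mem_nhds (h0u rfl)] with a ha
    set I' : Set ℝ := {t | (a, t) ∈ D} with hI'
    have hI'o : IsOpen I' := hDo.preimage (by fun_prop : Continuous fun t : ℝ => (a, t))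
    have hI'I : I' ⊆ I := fun t ht => ht.1.2
    have hIcc' : Icc α β ⊆ I' := fun t ht => huv ⟨ha, hIv ht⟩
    have hZa : ∀ t ∈ I', (C a t, deriv (C a) t) ∈ Ω := fun t ht => by
      rw [hCderiv a t (hI'I ht)]; exact ht.2
    have fv := integral_fderiv_jet hr hW hL hI'o ((hCsm a).mono hI'I)
      (fun t ht => hΩW (hZa t ht)) hρ hαβ hIcc' hsupp e₂
    have cint : ∀ {f : ℝ × ℝ → ℝ}, ContDiffOn ℝ ∞ f D →
        IntervalIntegrable (fun t => f (a, t)) volume α β := fun hf =>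
      (hf.continuousOn.comp (by fun_prop) fun t ht => hIcc' ht).intervalIntegrable_of_Icc hαβ
    have : ∫ t in α..β, (w₁ - w₂) (a, t) =
        (∫ t in α..β, w₁ (a, t)) - ∫ t in α..β, w₂ (a, t) := integral_sub (cint hw₁sm) (cint hw₂sm)
    rw [this, sub_eq_zero]
    refine Eq.trans (integral_congr fun t ht => ?_) (fv.trans (integral_congr fun t ht => ?_))
    · rw [uIcc_of_le hαβ] at ht
      simp only [hw₁, hCjet r a t (hI'I (hIcc' ht))]
    · rw [uIcc_of_le hαβ] at ht
      have htI := hI'I (hIcc' ht)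
      simp only [hw₂]
      rw [hEL (C a) t ((hCsm a t htI).contDiffAt (hI.mem_nhds htI)) (hZa t (hIcc' ht)),
        hCjet (2 * r) a t htI, hCderiv a t htI, hCiter a t htI]
      simp only [hq, hJ, hZ, hv2, hC]
  have key := integral_deriv_eq_zero_of_integral_eq_zero hDo (hw₁sm.sub hw₂sm) hαβ
    (fun t ht => hD0 t (hIcc ht)) hint
  -- the derivatives in the parameter
  have dJ : ∀ m t, HasDerivAt (fun a => J m (a, t)) (fun k => iteratedDeriv k σ t • e₁) 0 :=
    fun m t => hasDerivAt_pi.2 fun k => by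
      have := ((hasDerivAt_id (0 : ℝ)).smul_const (iteratedDeriv k σ t • e₁)).const_add
        (iteratedDeriv k c t)
      simpa [hJ] using this
  have dZ : ∀ t, HasDerivAt (fun a => Z (a, t)) (σ t • e₁, deriv σ t • e₁) 0 := fun t => by
    have h1 := ((hasDerivAt_id (0 : ℝ)).smul_const (σ t • e₁)).const_add (c t)
    have h2 := ((hasDerivAt_id (0 : ℝ)).smul_const (deriv σ t • e₁)).const_add (deriv c t)
    simpa [hZ] using h1.prodMk h2
  have J0 : ∀ m, ∀ t ∈ I, J m (0, t) = jet m c t := fun m t ht => by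
    funext k; simp [hJ, jet]
  have Z0 : ∀ t, Z (0, t) = (c t, deriv c t) := fun t => by simp [hZ]
  have diffAt : ∀ {F : Type} [NormedAddCommGroup F] [NormedSpace ℝ F] {f : ℝ × ℝ → F},
      ContDiffOn ℝ ∞ f D → ∀ t ∈ I, DifferentiableAt ℝ f (0, t) :=
    fun hf t ht => ((hf _ (hD0 t ht)).contDiffAt (hDo.mem_nhds (hD0 t ht))).differentiableAt
      (by simp)
  have d₁ : ∀ t ∈ I, fderiv ℝ w₁ (0, t) (1, 0) =
      fderiv ℝ (fderiv ℝ L) (jet r c t) (fun k => iteratedDeriv k σ t • e₁)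
        (fun k => iteratedDeriv k ρ t • e₂) := fun t ht => by
    have h1 : HasDerivAt (fun a => w₁ (a, t)) (fderiv ℝ w₁ (0, t) (1, 0)) 0 :=
      hasDerivAt_slice (diffAt hw₁sm t ht)
    have hd : DifferentiableAt ℝ (fderiv ℝ L) (J r (0, t)) := by
      have hm : J r (0, t) ∈ {j : Fin (r + 1) → Coord n | (j 0, j 1) ∈ W} := by
        rw [mem_ofPred_eq, hJZ r hr, Z0]; exact hΩW (hcΩ t ht)
      exact (((hL.fderiv_infty (isOpen_jetDomain hW r)) _ hm).contDiffAt
        ((isOpen_jetDomain hW r).mem_nhds hm)).differentiableAt (by simp)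
    have h2 := (hd.hasFDerivAt.comp_hasDerivAt 0 (dJ r t)).clm_apply
      (hasDerivAt_const 0 (fun k : Fin (r + 1) => iteratedDeriv k ρ t • e₂))
    have := h1.unique h2
    rw [this, ← J0 r t ht]
    simp
  have d₂ : ∀ t ∈ I, fderiv ℝ w₂ (0, t) (1, 0) =
      ρ t * G (jet (2 * r) c t) (iteratedDeriv 2 σ t • e₁
        + fderiv ℝ h (c t, deriv c t) (σ t • e₁, deriv σ t • e₁)) e₂ := fun t ht => by
    have h1 : HasDerivAt (fun a => w₂ (a, t)) (fderiv ℝ w₂ (0, t) (1, 0)) 0 :=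
      hasDerivAt_slice (diffAt hw₂sm t ht)
    have hG1 : HasDerivAt (fun a => G (J (2 * r) (a, t)))
        (fderiv ℝ (fun p => G (J (2 * r) p)) (0, t) (1, 0)) 0 :=
      hasDerivAt_slice (diffAt hGJsm t ht)
    have hhd : DifferentiableAt ℝ h (Z (0, t)) := by
      have hm : Z (0, t) ∈ W := by rw [Z0]; exact hΩW (hcΩ t ht)
      exact ((hh _ hm).contDiffAt (hW.mem_nhds hm)).differentiableAt (by simp)
    have hq1 : HasDerivAt (fun a => q (a, t)) (iteratedDeriv 2 σ t • e₁
        + fderiv ℝ h (Z (0, t)) (σ t • e₁, deriv σ t • e₁)) 0 := by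
      have := (hasDerivAt_pi.1 (dJ (2 * r) t) 2).add (hhd.hasFDerivAt.comp_hasDerivAt 0 (dZ t))
      rw [hv2] at this
      exact this
    have h2 := ((hG1.clm_apply hq1).clm_apply (hasDerivAt_const 0 e₂)).const_mul (ρ t)
    -- The factor x'' + h vanishes on the path, so the unknown derivative of `G` in the parameter
    -- disappears from `h2`.
    have hq0 : q (0, t) = 0 := by
      simp only [hq, Z0, J0 (2 * r) t ht, jet, hv2, hpath t ht]; simp
    rw [h1.unique h2, hq0, ← J0 (2 * r) t ht, ← Z0]
    simp
  have e : ∫ t in α..β, fderiv ℝ (w₁ - w₂) (0, t) (1, 0) =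
      ∫ t in α..β, (fderiv ℝ w₁ (0, t) (1, 0) - fderiv ℝ w₂ (0, t) (1, 0)) :=
    integral_congr fun t ht => by
      rw [uIcc_of_le hαβ] at ht
      rw [fderiv_sub (diffAt hw₁sm t (hIcc ht)) (diffAt hw₂sm t (hIcc ht))]
      rfl
  have cint : ∀ {f : ℝ × ℝ → ℝ}, ContDiffOn ℝ ∞ f D →
      IntervalIntegrable (fun t => fderiv ℝ f (0, t) (1, 0)) volume α β := fun hf =>
    ContinuousOn.intervalIntegrable_of_Icc hαβ
      (((hf.fderiv_infty hDo).continuousOn.comp (by fun_prop) fun t ht => hD0 t (hIcc ht)).clm_apply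
        continuousOn_const)
  have key' := e.symm.trans key
  rw [integral_sub (cint hw₁sm) (cint hw₂sm), sub_eq_zero] at key'
  refine Eq.trans (integral_congr fun t ht => ?_) (key'.symm.trans (integral_congr fun t ht => ?_))
  · rw [uIcc_of_le hαβ] at ht
    exact (d₂ t (hIcc ht)).symm
  · rw [uIcc_of_le hαβ] at ht
    exact d₁ t (hIcc ht)

end FirstVariation

/-! ### Helmholtz conditions along a path and vanishing of the obstruction -/

section Multiplier

open MeasureTheory intervalIntegral

variable {n r : ℕ}

/-- The multiplier along a path is symmetric, is transported by the equation, and the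
Jacobi endomorphism is symmetric for it. -/
theorem multiplier_along_path (hr : 1 ≤ r) {L : (Fin (r + 1) → Coord n) → ℝ}
    {W Ω : Set (Coord n × Coord n)} (hW : IsOpen W) (hΩ : IsOpen Ω) (hΩW : Ω ⊆ W)
    (hL : ContDiffOn ℝ ∞ L {j | (j 0, j 1) ∈ W})
    {G : (Fin (2 * r + 1) → Coord n) → Coord n →L[ℝ] Coord n →L[ℝ] ℝ}
    (hG : ContDiffOn ℝ ∞ G {j | (j 0, j 1) ∈ Ω}) {h : Coord n × Coord n → Coord n}
    (hh : ContDiffOn ℝ ∞ h W)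
    (hEL : ∀ (c : ℝ → Coord n) (t : ℝ), ContDiffAt ℝ ∞ c t → (c t, deriv c t) ∈ Ω → ∀ ξ,
      eulerLagrange r L c t ξ =
        G (jet (2 * r) c t) (iteratedDeriv 2 c t + h (c t, deriv c t)) ξ)
    {c : ℝ → Coord n} {I : Set ℝ} (hI : IsOpen I) (hc : ContDiffOn ℝ ∞ c I)
    (hcΩ : ∀ t ∈ I, (c t, deriv c t) ∈ Ω)
    (hpath : ∀ t ∈ I, iteratedDeriv 2 c t = -h (c t, deriv c t)) {t : ℝ} (ht : t ∈ I)
    (e₁ e₂ : Coord n) :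
    let g : ℝ → Coord n →L[ℝ] Coord n →L[ℝ] ℝ := fun t => G (jet (2 * r) c t)
    let A : ℝ → Coord n →L[ℝ] Coord n := fun t => posDeriv h (c t, deriv c t)
    let B : ℝ → Coord n →L[ℝ] Coord n := fun t => velDeriv h (c t, deriv c t)
    g t e₁ e₂ = g t e₂ e₁ ∧
      g t (B t e₁) e₂ = 2 * deriv (fun t => g t e₂ e₁) t - g t (B t e₂) e₁ ∧
      g t (A t e₁) e₂ = iteratedDeriv 2 (fun t => g t e₂ e₁) t
        - deriv (fun t => g t (B t e₂) e₁) t + g t (A t e₂) e₁ := by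
  intro g A B
  have hg : ContDiffOn ℝ ∞ g I := hG.comp (hc.jet hI _) fun t ht => by
    simpa only [mem_ofPred_eq, jet_zero, jet_one (show 1 ≤ 2 * r by omega)] using hcΩ t ht
  have hz : ContDiffOn ℝ ∞ (fun t => (c t, deriv c t)) I :=
    hc.prodMk ((contDiffOn_infty_iff_deriv_of_isOpen hI).1 hc).2
  have hA : ContDiffOn ℝ ∞ A I := (hh.posDeriv hW).comp hz fun t ht => hΩW (hcΩ t ht)
  have hB : ContDiffOn ℝ ∞ B I := (hh.velDeriv hW).comp hz fun t ht => hΩW (hcΩ t ht)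
  have sm : ∀ (T : ℝ → Coord n →L[ℝ] Coord n), ContDiffOn ℝ ∞ T I → ∀ e e' : Coord n,
      ContDiffOn ℝ ∞ (fun t => g t (T t e) e') I := fun T hT e e' =>
    (hg.clm_apply (hT.clm_apply contDiffOn_const)).clm_apply contDiffOn_const
  have sm0 : ∀ e e' : Coord n, ContDiffOn ℝ ∞ (fun t => g t e e') I := fun e e' =>
    (hg.clm_apply contDiffOn_const).clm_apply contDiffOn_const
  have expand : ∀ (σ : ℝ → ℝ) (t : ℝ) (e e' : Coord n),
      G (jet (2 * r) c t) (iteratedDeriv 2 σ t • e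
        + fderiv ℝ h (c t, deriv c t) (σ t • e, deriv σ t • e)) e' =
      g t e e' * iteratedDeriv 2 σ t + g t (B t e) e' * deriv σ t + g t (A t e) e' * σ t := by
    intro σ t e e'
    have : fderiv ℝ h (c t, deriv c t) (σ t • e, deriv σ t • e) =
        σ t • A t e + deriv σ t • B t e := by
      have : ((σ t • e, deriv σ t • e) : Coord n × Coord n) =
        σ t • ContinuousLinearMap.inl ℝ _ _ e + deriv σ t • ContinuousLinearMap.inr ℝ _ _ e := by
        simp
      rw [this, map_add, map_smul, map_smul]; rfl
    rw [this]
    simp only [map_add, map_smul, _root_.add_apply, _root_.smul_apply,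
      smul_eq_mul, g]
    ring
  -- The second variation is evaluated with (σ, e₁) and (ρ, e₂) in both orders. The two values agree
  -- by symmetry of the second derivative of `L`, which is the self-adjointness of the linearized
  -- operator.
  refine adjoint_identities hI (sm0 e₁ e₂) (sm B hB e₁ e₂) (sm A hA e₁ e₂) (sm0 e₂ e₁)
    (sm B hB e₂ e₁) (sm A hA e₂ e₁) (fun σ ρ α β hσ hρ hαβ hIcc hσs hρs => ?_) ht
  have i1 := integral_secondVariation hr hW hΩ hΩW hL hG hh hEL hI hc hcΩ hpath hσ hρ hαβ hIcc
    hρs e₁ e₂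
  have i2 := integral_secondVariation hr hW hΩ hΩW hL hG hh hEL hI hc hcΩ hpath hρ hσ hαβ hIcc
    hσs e₂ e₁
  simp only [expand] at i1 i2
  rw [i1, i2]
  refine integral_congr fun t ht => ?_
  rw [uIcc_of_le hαβ] at ht
  have htI := hIcc ht
  have hm : jet r c t ∈ {j : Fin (r + 1) → Coord n | (j 0, j 1) ∈ W} := by
    simpa only [mem_ofPred_eq, jet_zero, jet_one hr] using hΩW (hcΩ t htI)
  have hLt : ContDiffAt ℝ ∞ L (jet r c t) :=
    (hL _ hm).contDiffAt ((isOpen_jetDomain hW r).mem_nhds hm)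
  exact (hLt.isSymmSndFDerivAt (by simpa using ENat.LEInfty.out)).eq _ _

theorem HasDerivAt.clm_apply_const {E F : Type*} [NormedAddCommGroup E] [NormedSpace ℝ E]
    [NormedAddCommGroup F] [NormedSpace ℝ F]
    {g : ℝ → E →L[ℝ] F} {g' : E →L[ℝ] F} {t : ℝ} (hg : HasDerivAt g g' t)
    (x : E) : HasDerivAt (fun s => g s x) (g' x) t := by
  simpa using hg.clm_apply (hasDerivAt_const t x)

theorem HasDerivAt.clm_apply_apply_const {E : Type*} [NormedAddCommGroup E] [NormedSpace ℝ E]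
    {g : ℝ → E →L[ℝ] E →L[ℝ] ℝ} {g' : E →L[ℝ] E →L[ℝ] ℝ} {t : ℝ} (hg : HasDerivAt g g' t)
    (x y : E) : HasDerivAt (fun s => g s x y) (g' x y) t :=
  (hg.clm_apply_const x).clm_apply_const y

theorem HasDerivAt.clm_apply_comp_const {E : Type*} [NormedAddCommGroup E] [NormedSpace ℝ E]
    {g : ℝ → E →L[ℝ] E →L[ℝ] ℝ} {g' : E →L[ℝ] E →L[ℝ] ℝ} {T : ℝ → E →L[ℝ] E} {T' : E →L[ℝ] E}
    {t : ℝ} (hg : HasDerivAt g g' t) (hT : HasDerivAt T T' t) (x y : E) :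
    HasDerivAt (fun s => g s (T s x) y) (g' (T t x) y + g t (T' x) y) t := by
  have h1 := hT.clm_apply_const x
  have h2 := hg.clm_apply h1
  exact h2.clm_apply_const y

/-- Symmetry with respect to a transported multiplier is preserved by the covariant derivative. -/
theorem symmetric_covariant {E : Type*} [NormedAddCommGroup E] [NormedSpace ℝ E]
    {I : Set ℝ} (hI : IsOpen I) {g g' : ℝ → E →L[ℝ] E →L[ℝ] ℝ} {B T T' : ℝ → E →L[ℝ] E}
    (hg : ∀ t ∈ I, HasDerivAt g (g' t) t)
    (hsymm : ∀ t ∈ I, ∀ x y, g t x y = g t y x)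
    (hB : ∀ t ∈ I, ∀ x y, 2 * g' t x y = g t (B t x) y + g t (B t y) x)
    (hT : ∀ t ∈ I, HasDerivAt T (T' t) t)
    (hgT : ∀ t ∈ I, ∀ x y, g t (T t x) y = g t (T t y) x) :
    ∀ t ∈ I, ∀ x y,
      g t ((T' t + (1 / 2 : ℝ) • ((B t).comp (T t) - (T t).comp (B t))) x) y =
      g t ((T' t + (1 / 2 : ℝ) • ((B t).comp (T t) - (T t).comp (B t))) y) x := by
  intro t ht x y
  have d : ∀ x y, HasDerivAt (fun s => g s (T s x) y)
      (g' t (T t x) y + g t (T' t x) y) t := fun x y =>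
    (hg t ht).clm_apply_comp_const (hT t ht) x y
  have e : g' t (T t x) y + g t (T' t x) y = g' t (T t y) x + g t (T' t y) x := by
    have ev : (fun s => g s (T s x) y) =ᶠ[𝓝 t] fun s => g s (T s y) x :=
      Filter.eventually_of_mem (hI.mem_nhds ht) fun s hs => hgT s hs x y
    exact (d x y).unique ((d y x).congr_of_eventuallyEq ev)
  -- By transport of g, the term g'(Tx, y) equals half of g(BTx, y) + g(TBy, x). Moving the second
  -- summand to the side with x and y exchanged produces the commutator ½[B, T].
  have a1 := hB t ht (T t x) y
  have a2 := hB t ht (T t y) x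
  have b1 : g t (B t y) (T t x) = g t (T t (B t y)) x := by
    rw [hsymm t ht, hgT t ht]
  have b2 : g t (B t x) (T t y) = g t (T t (B t x)) y := by
    rw [hsymm t ht, hgT t ht]
  simp only [_root_.add_apply, _root_.smul_apply, map_add, map_smul,
    _root_.sub_apply, map_sub, ContinuousLinearMap.comp_apply, smul_eq_mul]
  linarith

/-- The derivative along a path of a function of position and velocity. -/
theorem hasDerivAt_along_path {E F : Type*} [NormedAddCommGroup E] [NormedSpace ℝ E]
    [NormedAddCommGroup F] [NormedSpace ℝ F] {W : Set (E × E)} (hW : IsOpen W) {h : E × E → E}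
    {c : ℝ → E} {I : Set ℝ} (hI : IsOpen I) (hc : ContDiffOn ℝ ∞ c I)
    (hcW : ∀ t ∈ I, (c t, deriv c t) ∈ W)
    (hpath : ∀ t ∈ I, iteratedDeriv 2 c t = -h (c t, deriv c t)) {f : E × E → F}
    (hf : ContDiffOn ℝ ∞ f W) {t : ℝ} (ht : t ∈ I) :
    HasDerivAt (fun t => f (c t, deriv c t)) (sprayDeriv h f (c t, deriv c t)) t := by
  have h1 := (((contDiffOn_infty_iff_deriv_of_isOpen hI).1 hc).2).hasDerivAt_of_mem hI ht
  have h2 : deriv (deriv c) t = -h (c t, deriv c t) := by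
    rw [← hpath t ht, iteratedDeriv_succ, iteratedDeriv_one]
  rw [h2] at h1
  have hd : DifferentiableAt ℝ f (c t, deriv c t) :=
    ((hf _ (hcW t ht)).contDiffAt (hW.mem_nhds (hcW t ht))).differentiableAt (by simp)
  exact hd.hasFDerivAt.comp_hasDerivAt t ((hc.hasDerivAt_of_mem hI ht).prodMk h1)

/-- If the Euler-Lagrange equations of a Lagrangian are `G (x'' + h)` with a multiplier `G` whose
kernel is spanned by the velocity, the obstruction vanishes. -/
theorem obstruction_eq_zero (hr : 1 ≤ r) {L : (Fin (r + 1) → Coord n) → ℝ}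
    {W Ω : Set (Coord n × Coord n)} (hW : IsOpen W) (hΩ : IsOpen Ω) (hΩW : Ω ⊆ W)
    (hL : ContDiffOn ℝ ∞ L {j | (j 0, j 1) ∈ W})
    {G : (Fin (2 * r + 1) → Coord n) → Coord n →L[ℝ] Coord n →L[ℝ] ℝ}
    (hG : ContDiffOn ℝ ∞ G {j | (j 0, j 1) ∈ Ω})
    (hker : ∀ j, (j 0, j 1) ∈ Ω → ∀ w, G j w = 0 ↔ ∃ ν : ℝ, w = ν • j 1)
    {h : Coord n × Coord n → Coord n} (hh : ContDiffOn ℝ ∞ h W)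
    (hEL : ∀ (c : ℝ → Coord n) (t : ℝ), ContDiffAt ℝ ∞ c t → (c t, deriv c t) ∈ Ω → ∀ ξ,
      eulerLagrange r L c t ξ =
        G (jet (2 * r) c t) (iteratedDeriv 2 c t + h (c t, deriv c t)) ξ)
    {z : Coord n × Coord n} (hz : z ∈ Ω) (hz2 : z.2 ≠ 0) : obstruction h z = 0 := by
  -- The multiplier is a function of 2r-jets, so it is studied as a function of time along the path
  -- with initial data `z`.
  obtain ⟨ε, c, hε, hc0, hc, hcΩ, hpath⟩ := exists_smooth_path hΩ (hh.mono hΩW) hz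
  set I := Ioo (-ε) ε with hI_def
  have hI : IsOpen I := isOpen_Ioo
  have h0 : (0 : ℝ) ∈ I := ⟨by linarith, hε⟩
  set g : ℝ → Coord n →L[ℝ] Coord n →L[ℝ] ℝ := fun t => G (jet (2 * r) c t) with hg_def
  set B : ℝ → Coord n →L[ℝ] Coord n := fun t => velDeriv h (c t, deriv c t) with hB_def
  set A : ℝ → Coord n →L[ℝ] Coord n := fun t => posDeriv h (c t, deriv c t) with hA_def
  have M := fun t (ht : t ∈ I) e₁ e₂ => multiplier_along_path hr hW hΩ hΩW hL hG hh hEL hI hc hcΩ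
    hpath ht e₁ e₂
  have hjet : ∀ t, (jet (2 * r) c t 0, jet (2 * r) c t 1) = (c t, deriv c t) := fun t => by
    rw [jet_zero, jet_one (by omega)]
  have hgs : ContDiffOn ℝ ∞ g I := hG.comp (hc.jet hI _) fun t ht => by
    rw [mem_ofPred_eq, hjet]; exact hcΩ t ht
  have hsymm : ∀ t ∈ I, ∀ x y, g t x y = g t y x := fun t ht x y => (M t ht x y).1
  have hgB : ∀ t ∈ I, ∀ x y, 2 * deriv (fun t => g t x y) t = g t (B t x) y + g t (B t y) x :=
    fun t ht x y => by have := (M t ht y x).2.1; simp only [hg_def, hB_def] at this ⊢; linarith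
  obtain ⟨g', hgd⟩ : ∃ g' : ℝ → Coord n →L[ℝ] Coord n →L[ℝ] ℝ, ∀ t ∈ I, HasDerivAt g (g' t) t :=
    ⟨_, fun t ht => hgs.hasDerivAt_of_mem hI ht⟩
  have hgd' : ∀ t ∈ I, ∀ x y, 2 * g' t x y = g t (B t x) y + g t (B t y) x :=
    fun t ht x y => (congrArg (2 * ·) ((hgd t ht).clm_apply_apply_const x y).deriv).symm.trans
      (hgB t ht x y)
  have along := fun {F : Type} [NormedAddCommGroup F] [NormedSpace ℝ F]
    {f : Coord n × Coord n → F} (hf : ContDiffOn ℝ ∞ f W) (t : ℝ) (ht : t ∈ I) =>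
    hasDerivAt_along_path hW hI hc (fun t ht => hΩW (hcΩ t ht)) hpath hf ht
  have sB := hh.velDeriv hW
  set B' : ℝ → Coord n →L[ℝ] Coord n := fun t => sprayDeriv h (velDeriv h) (c t, deriv c t)
    with hB'_def
  have hBd : ∀ t ∈ I, HasDerivAt B (B' t) t := along sB
  have dgB : ∀ t ∈ I, ∀ x y, HasDerivAt (fun t => g t (B t x) y)
      (g' t (B t x) y + g t (B' t x) y) t := fun t ht x y =>
    (hgd t ht).clm_apply_comp_const (hBd t ht) x y
  have s1 := hh.jacobiEnd hW
  have s2 := hh.dynDeriv s1 hW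
  -- In the third Helmholtz identity g'' is replaced by the derivative of ½(g(B·,·) + g(·,B·)). The
  -- terms with B' yield -½B', and the remaining g'(B·,·), rewritten through the second identity,
  -- yield -¼B²; the terms g(Bx, By) cancel by symmetry.
  have hT1 : ∀ t ∈ I, ∀ x y, g t (jacobiEnd h (c t, deriv c t) x) y =
      g t (jacobiEnd h (c t, deriv c t) y) x := by
    intro t ht x y
    have m := (M t ht x y).2.2
    have d2 : iteratedDeriv 2 (fun t => g t y x) t =
        1 / 2 * ((g' t (B t y) x + g t (B' t y) x) +
          (g' t (B t x) y + g t (B' t x) y)) := by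
      rw [iteratedDeriv_succ, iteratedDeriv_one]
      have ev : deriv (fun t => g t y x) =ᶠ[𝓝 t]
          fun t => 1 / 2 * (g t (B t y) x + g t (B t x) y) :=
        Filter.eventually_of_mem (hI.mem_nhds ht) fun s hs => by
          have := hgB s hs y x
          simp only; linarith
      rw [ev.deriv_eq]
      exact (((dgB t ht y x).add (dgB t ht x y)).const_mul (1 / 2)).deriv
    have d1 : deriv (fun t => g t (B t y) x) t = g' t (B t y) x + g t (B' t y) x :=
      (dgB t ht y x).deriv
    change g t (A t x) y = iteratedDeriv 2 (fun t => g t y x) t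
      - deriv (fun t => g t (B t y) x) t + g t (A t y) x at m
    rw [d2, d1] at m
    have a1 := hgd' t ht (B t x) y
    have a2 := hgd' t ht (B t y) x
    have a3 := hsymm t ht (B t x) (B t y)
    change g t ((A t - (1 / 2 : ℝ) • B' t - (1 / 4 : ℝ) • (B t).comp (B t)) x) y =
      g t ((A t - (1 / 2 : ℝ) • B' t - (1 / 4 : ℝ) • (B t).comp (B t)) y) x
    simp only [_root_.smul_apply, map_smul,
      _root_.sub_apply, map_sub, ContinuousLinearMap.comp_apply, smul_eq_mul]
    linarith
  have hT2 := symmetric_covariant hI hgd hsymm hgd' (along s1) hT1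
  have hT3 := symmetric_covariant hI hgd hsymm hgd' (along s2) hT2
  have hz' : (c 0, deriv c 0) = z := hc0
  have e1 := hT1 0 h0
  have e2 := hT2 0 h0
  have e3 := hT3 0 h0
  simp only [hB_def, hz'] at e1 e2 e3
  refine traceComm_eq_zero_of_symmetric (g := g 0) hz2 (hsymm 0 h0) (fun w => ?_) e1 e2 e3
  have := hker (jet (2 * r) c 0) (by rw [hjet, hz']; exact hz) w
  rw [jet_one (by omega)] at this
  have hv : deriv c 0 = z.2 := congrArg Prod.snd hz'
  rwa [hv] at this

end Multiplier

/-! ### The normalized representative of a variational structure -/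

section Normal

theorem isOpen_slitTangent {n : ℕ} {M : Type*} [TopologicalSpace M]
    (φ : OpenPartialHomeomorph M (Coord n)) : IsOpen (slitTangent φ) :=
  φ.open_target.prod isOpen_ne

variable {n : ℕ} {M : Type*} [TopologicalSpace M] [ChartedSpace (Coord n) M]

theorem PathStructure.contDiffOn_normal (P : PathStructure n M) (φ : atlas (Coord n) M) :
    ContDiffOn ℝ ∞ (P.normal φ) (slitTangent φ.1) := by
  have h := P.smooth φ
  refine h.sub (ContDiffOn.smul (ContDiffOn.div (contDiffOn_snd.inner ℝ h)
    ((contDiffOn_snd.norm ℝ fun z hz => hz.2).pow 2) fun z hz => ?_) contDiffOn_snd)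
  exact pow_ne_zero 2 (norm_ne_zero_iff.2 hz.2)

theorem PathStructure.h_eq_normal_add (P : PathStructure n M) (φ : atlas (Coord n) M)
    (z : Coord n × Coord n) :
    P.h φ z = P.normal φ z + (inner ℝ z.2 (P.h φ z) / ‖z.2‖ ^ 2) • z.2 := by
  simp [PathStructure.normal]

/-- The obstruction vanishes identically for variational path structures. -/
theorem IsVariational.obstruction_eq_zero {P : PathStructure n M} (hP : IsVariational P)
    (φ : atlas (Coord n) M) {z : Coord n × Coord n} (hz : z ∈ slitTangent φ.1) :
    obstruction (P.normal φ) z = 0 := by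
  obtain ⟨r, Λ, hr, -, hA⟩ := hP
  obtain ⟨Ω, g, hΩ, hΩW, hdense, hg, hker, hEL⟩ := hA φ
  have hW := isOpen_slitTangent φ.1
  have hΩ0 : ∀ y ∈ Ω, obstruction (P.normal φ) y = 0 := fun y hy => by
    refine _root_.obstruction_eq_zero hr hW hΩ hΩW (Λ.smooth φ) hg hker (P.contDiffOn_normal φ)
      (fun c t hc hct ξ => ?_) hy (hΩW hy).2
    -- The multiplier annihilates the velocity, so the same Lagrangian and multiplier serve the
    -- normalized representative.
    rw [hEL c t hc hct ξ, P.h_eq_normal_add, ← add_assoc, map_add]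
    have : g (jet (2 * r) c t)
        ((inner ℝ (deriv c t) (P.h φ (c t, deriv c t)) / ‖deriv c t‖ ^ 2) • deriv c t) = 0 :=
      (hker _ (by rwa [jet_zero, jet_one (by omega)]) _).2 ⟨_, by rw [jet_one (by omega)]⟩
    simp only [this, add_zero]
  have hcont := (P.contDiffOn_normal φ).continuousOn_obstruction hW
  have hca : ContinuousAt (obstruction (P.normal φ)) z := hcont.continuousAt (hW.mem_nhds hz)
  by_contra hne
  have hev := hca.eventually_ne hne
  obtain ⟨y, hy, hyΩ⟩ := mem_closure_iff_nhds.1 (hdense hz) _ hev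
  exact hy (hΩ0 y hyΩ)

end Normal

/-! ### Finsler structures are variational -/

section Finsler

/-- Euler's identity gives df(v) = f(v) and Hess f(v, ·) = 0. If w is also in the kernel of Hess f,
a multiple of v can be subtracted from it to make df vanish. On the difference, Hess f² = 2 df² + 2f
Hess f is zero, so positive definiteness forces the difference to be zero. -/
theorem finsler_kernel {E : Type*} [NormedAddCommGroup E] [NormedSpace ℝ E] {f : E → ℝ}
    (hf : ContDiffOn ℝ ∞ f {u | u ≠ 0}) {v : E} (hv : v ≠ 0) (hpos : 0 < f v)
    (hhom : ∀ u : E, u ≠ 0 → ∀ lam : ℝ, 0 < lam → f (lam • u) = lam * f u)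
    (hess : ∀ w : E, w ≠ 0 → 0 < fderiv ℝ (fderiv ℝ (fun u => f u ^ 2)) v w w) (w : E) :
    fderiv ℝ (fderiv ℝ f) v w = 0 ↔ ∃ ν : ℝ, w = ν • v := by
  have hU : IsOpen {u : E | u ≠ 0} := isOpen_ne
  have hd : ∀ u : E, u ≠ 0 → HasFDerivAt f (fderiv ℝ f u) u := fun u hu =>
    (((hf u hu).contDiffAt (hU.mem_nhds hu)).differentiableAt (by simp)).hasFDerivAt
  have hd2 : HasFDerivAt (fderiv ℝ f) (fderiv ℝ (fderiv ℝ f) v) v :=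
    ((((hf.fderiv_infty hU) v hv).contDiffAt (hU.mem_nhds hv)).differentiableAt
      (by simp)).hasFDerivAt
  have line : HasDerivAt (fun s : ℝ => s • v) v 1 := by
    simpa using (hasDerivAt_id (1 : ℝ)).smul_const v
  have pos1 : ∀ᶠ s in 𝓝 (1 : ℝ), 0 < s := lt_mem_nhds one_pos
  have euler : fderiv ℝ f v v = f v := by
    have h1 : HasDerivAt (fun s : ℝ => f (s • v)) (fderiv ℝ f v v) 1 := by
      have := hd (((1 : ℝ)) • v) (by simpa using hv)
      have := this.comp_hasDerivAt 1 line
      simpa [Function.comp_def] using this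
    have h2 : HasDerivAt (fun s : ℝ => s * f v) (f v) 1 := by
      simpa using (hasDerivAt_id (1 : ℝ)).mul_const (f v)
    refine h1.unique (h2.congr_of_eventuallyEq ?_)
    filter_upwards [pos1] with s hs using hhom v hv s hs
  have hom1 : ∀ s : ℝ, 0 < s → fderiv ℝ f (s • v) = fderiv ℝ f v := fun s hs => by
    have h1 : HasFDerivAt (fun u => f (s • u)) (s • fderiv ℝ f (s • v)) v := by
      have h := (hd (s • v) (smul_ne_zero hs.ne' hv)).comp v
        ((hasFDerivAt_id (𝕜 := ℝ) v).const_smul s)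
      refine HasFDerivAt.congr_fderiv (f := fun u => f (s • u)) h ?_
      ext; simp
    have h2 : HasFDerivAt (fun u => s * f u) (s • fderiv ℝ f v) v := (hd v hv).const_mul s
    have h3 := h1.unique (h2.congr_of_eventuallyEq (by
      filter_upwards [hU.mem_nhds hv] with u hu using hhom u hu s hs))
    exact smul_right_injective _ hs.ne' h3
  have kerv : fderiv ℝ (fderiv ℝ f) v v = 0 := by
    have h1 : HasDerivAt (fun s : ℝ => fderiv ℝ f (s • v)) (fderiv ℝ (fderiv ℝ f) v v) 1 := by
      have h : HasFDerivAt (fderiv ℝ f) (fderiv ℝ (fderiv ℝ f) v) ((1 : ℝ) • v) := by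
        simpa using hd2
      exact h.comp_hasDerivAt 1 line
    refine h1.unique ((hasDerivAt_const (1 : ℝ) (fderiv ℝ f v)).congr_of_eventuallyEq ?_)
    filter_upwards [pos1] with s hs using hom1 s hs
  have hsq : ∀ a, fderiv ℝ (fderiv ℝ (fun u => f u ^ 2)) v a a =
      2 * (fderiv ℝ f v a) ^ 2 + 2 * f v * fderiv ℝ (fderiv ℝ f) v a a := fun a => by
    have ev : fderiv ℝ (fun u => f u ^ 2) =ᶠ[𝓝 v] fun u => (2 * f u) • fderiv ℝ f u := by
      filter_upwards [hU.mem_nhds hv] with u hu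
      have := (hd u hu).pow 2
      simpa using this.fderiv
    rw [ev.fderiv_eq]
    have := ((hd v hv).const_mul 2).smul hd2
    rw [HasFDerivAt.fderiv (f := fun u => (2 * f u) • fderiv ℝ f u) this]
    simp
    ring
  constructor
  · intro hw
    refine ⟨fderiv ℝ f v w / f v, ?_⟩
    by_contra hne
    have h0 := hess (w - (fderiv ℝ f v w / f v) • v) (sub_ne_zero.2 hne)
    rw [hsq] at h0
    simp only [map_sub, map_smul, hw, kerv, euler] at h0
    have : fderiv ℝ f v w - (fderiv ℝ f v w / f v) • f v = 0 := by
      rw [smul_eq_mul, div_mul_cancel₀ _ hpos.ne', sub_self]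
    rw [this] at h0
    simp at h0
  · rintro ⟨ν, rfl⟩
    rw [map_smul, kerv, smul_zero]

theorem ContDiffAt.hasDerivAt_jet {n : ℕ} {c : ℝ → Coord n} {t : ℝ} (hc : ContDiffAt ℝ ∞ c t)
    (r : ℕ) : HasDerivAt (jet r c) (fun k => iteratedDeriv (k + 1) c t) t := by
  refine hasDerivAt_pi.2 fun k => ?_
  have h : ∀ k : ℕ, ContDiffAt ℝ ∞ (iteratedDeriv k c) t := fun k => by
    induction k with
    | zero => simpa using hc
    | succ k ih =>
      have h1 : ContDiffAt ℝ ∞ (fderiv ℝ (iteratedDeriv k c)) t := ih.fderiv_right (by simp)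
      rw [iteratedDeriv_succ]
      exact h1.clm_apply contDiffAt_const
  rw [iteratedDeriv_succ]
  exact ((h k).differentiableAt (by simp)).hasDerivAt

/-- The Euler-Lagrange expression of a Lagrangian of order one. -/
theorem eulerLagrange_one {n : ℕ} {L : (Fin (1 + 1) → Coord n) → ℝ} {c : ℝ → Coord n} {t : ℝ}
    (hc : ContDiffAt ℝ ∞ c t) (hL : ContDiffAt ℝ ∞ L (jet 1 c t)) (ξ : Coord n) :
    eulerLagrange 1 L c t ξ = fderiv ℝ L (jet 1 c t) (Pi.single 0 ξ)
      - fderiv ℝ (fderiv ℝ L) (jet 1 c t)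
        (Pi.single 0 (deriv c t) + Pi.single 1 (iteratedDeriv 2 c t)) (Pi.single 1 ξ) := by
  have hd : HasFDerivAt (fderiv ℝ L) (fderiv ℝ (fderiv ℝ L) (jet 1 c t)) (jet 1 c t) :=
    ((hL.fderiv_right (m := ∞) (by simp)).differentiableAt (by simp)).hasFDerivAt
  have h1 := (hd.comp_hasDerivAt t (hc.hasDerivAt_jet 1)).clm_apply_const (Pi.single 1 ξ)
  have h2 : (fun k : Fin (1 + 1) => iteratedDeriv (k + 1) c t) =
      Pi.single 0 (deriv c t) + Pi.single 1 (iteratedDeriv 2 c t) := by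
    funext k
    fin_cases k <;> simp [iteratedDeriv_one]
  rw [h2] at h1
  have h3 : deriv (fun s => fderiv ℝ L (jet 1 c s) (Pi.single 1 ξ)) t = _ := h1.deriv
  rw [eulerLagrange, Fin.sum_univ_two]
  simp only [Fin.val_zero, Fin.val_one, pow_zero, pow_one, iteratedDeriv_zero, iteratedDeriv_one,
    one_mul, neg_mul]
  rw [h3, sub_eq_add_neg]

variable {n : ℕ} {M : Type*} [TopologicalSpace M] [ChartedSpace (Coord n) M]

/-- The Euler-Lagrange covector of a first-order Lagrangian is g·x'' plus a remainder depending only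
on position and velocity. It vanishes on the path with the same position and velocity, where x'' =
-h for the normalized h; this identifies the remainder as g·h. The kernel of g comes from
`finsler_kernel`. -/
theorem IsFinsler.isVariational {P : PathStructure n M} (hP : IsFinsler P) : IsVariational P := by
  obtain ⟨Λ, hΛ, hE⟩ := hP
  refine ⟨1, Λ, le_rfl, hE, fun φ => ?_⟩
  set L := Λ.L φ with hL_def
  set W := slitTangent φ.1 with hW_def
  have hW : IsOpen W := isOpen_slitTangent φ.1
  have hL : ContDiffOn ℝ ∞ L {j | (j 0, j 1) ∈ W} := Λ.smooth φ
  have hWj := isOpen_jetDomain hW 1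
  set s₁ : Coord n →L[ℝ] (Fin (1 + 1) → Coord n) :=
    ContinuousLinearMap.single ℝ (fun _ : Fin (1 + 1) => Coord n) 1 with hs₁
  set R : (Fin (2 * 1 + 1) → Coord n) →L[ℝ] (Fin (1 + 1) → Coord n) :=
    ContinuousLinearMap.pi ![ContinuousLinearMap.proj 0, ContinuousLinearMap.proj 1] with hR
  have hR0 : ∀ j, R j 0 = j 0 := fun j => rfl
  have hR1 : ∀ j, R j 1 = j 1 := fun j => rfl
  set g : (Fin (2 * 1 + 1) → Coord n) → Coord n →L[ℝ] Coord n →L[ℝ] ℝ := fun j =>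
    -(((ContinuousLinearMap.compL ℝ (Coord n) (Fin (1 + 1) → Coord n) ℝ).flip s₁).comp
      ((fderiv ℝ (fderiv ℝ L) (R j)).comp s₁)) with hg_def
  have hg : ∀ j w ξ, g j w ξ = -fderiv ℝ (fderiv ℝ L) (R j) (Pi.single 1 w) (Pi.single 1 ξ) :=
    fun j w ξ => rfl
  have hRc : ∀ (c : ℝ → Coord n) t, R (jet (2 * 1) c t) = jet 1 c t := fun c t => by
    funext k; fin_cases k <;> rfl
  have hLat : ∀ j : Fin (1 + 1) → Coord n, (j 0, j 1) ∈ W → ContDiffAt ℝ ∞ L j := fun j hj =>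
    (hL j hj).contDiffAt (hWj.mem_nhds hj)
  have hker : ∀ j : Fin (2 * 1 + 1) → Coord n, (j 0, j 1) ∈ W → ∀ w,
      g j w = 0 ↔ ∃ ν : ℝ, w = ν • j 1 := by
    intro j hj w
    set f : Coord n → ℝ := fun u => L ![j 0, u] with hf_def
    have haff : ∀ u : Coord n, (![j 0, u] : Fin (1 + 1) → Coord n) = Pi.single 0 (j 0) + s₁ u := by
      intro u; funext k; fin_cases k <;> simp [hs₁]
    have hmem : ∀ u : Coord n, u ≠ 0 → ((![j 0, u] : Fin (1 + 1) → Coord n)) ∈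
        {j : Fin (1 + 1) → Coord n | (j 0, j 1) ∈ W} := fun u hu => ⟨hj.1, hu⟩
    have haffd : ∀ u : Coord n,
        HasFDerivAt (fun u : Coord n => (![j 0, u] : Fin (1 + 1) → Coord n)) s₁ u := fun u => by
      have : (fun u : Coord n => (![j 0, u] : Fin (1 + 1) → Coord n)) =
        fun u => Pi.single 0 (j 0) + s₁ u := funext haff
      rw [this]
      exact s₁.hasFDerivAt.const_add _
    have haffs : ContDiff ℝ ∞ (fun u : Coord n => (![j 0, u] : Fin (1 + 1) → Coord n)) := by
      have : (fun u : Coord n => (![j 0, u] : Fin (1 + 1) → Coord n)) =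
        fun u => Pi.single 0 (j 0) + s₁ u := funext haff
      rw [this]
      exact contDiff_const.add s₁.contDiff
    have hfs : ContDiffOn ℝ ∞ f {u | u ≠ 0} := hL.comp haffs.contDiffOn hmem
    have hRj : R j = ![j 0, j 1] := by funext k; fin_cases k <;> rfl
    have hfd : ∀ u : Coord n, u ≠ 0 → fderiv ℝ f u = (fderiv ℝ L ![j 0, u]).comp s₁ := fun u hu =>
      (((hLat _ (hmem u hu)).differentiableAt (by simp)).hasFDerivAt.comp u (haffd u)).fderiv
    have hfdd : ∀ ξ, fderiv ℝ (fderiv ℝ f) (j 1) w ξ =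
        fderiv ℝ (fderiv ℝ L) (R j) (Pi.single 1 w) (Pi.single 1 ξ) := fun ξ => by
      have ev : fderiv ℝ f =ᶠ[𝓝 (j 1)] fun u => (fderiv ℝ L ![j 0, u]).comp s₁ :=
        Filter.eventually_of_mem (isOpen_ne.mem_nhds hj.2) hfd
      have hd : HasFDerivAt (fderiv ℝ L) (fderiv ℝ (fderiv ℝ L) (R j)) ![j 0, j 1] := by
        rw [hRj]
        exact (((hLat _ (hmem _ hj.2)).fderiv_right (m := ∞) (by simp)).differentiableAt
          (by simp)).hasFDerivAt
      have h1 : HasFDerivAt (fun u => fderiv ℝ L ![j 0, u])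
        ((fderiv ℝ (fderiv ℝ L) (R j)).comp s₁) (j 1) := hd.comp (j 1) (haffd (j 1))
      have h2 := (((ContinuousLinearMap.compL ℝ (Coord n) (Fin (1 + 1) → Coord n) ℝ).flip
        s₁).hasFDerivAt).comp (j 1) h1
      rw [ev.fderiv_eq]
      have h3 := HasFDerivAt.fderiv (f := fun u => (fderiv ℝ L ![j 0, u]).comp s₁) h2
      rw [h3]; rfl
    have fin := hΛ φ (j 0) hj.1
    rw [← finsler_kernel hfs hj.2 (fin (j 1) hj.2).1 (fun u hu => (fin u hu).2.1)
      (fin (j 1) hj.2).2.2 w]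
    constructor
    · intro h0
      ext ξ
      rw [hfdd ξ]
      have := congrArg (fun T => T ξ) h0
      simp only [hg] at this
      simpa using this
    · intro h0
      ext ξ
      rw [hg, ← hfdd ξ, h0]; simp
  have hEL : ∀ (c : ℝ → Coord n) (t : ℝ), ContDiffAt ℝ ∞ c t → (c t, deriv c t) ∈ W → ∀ ξ,
      eulerLagrange 1 L c t ξ = (fderiv ℝ L ![c t, deriv c t] (Pi.single 0 ξ)
      - fderiv ℝ (fderiv ℝ L) ![c t, deriv c t] (Pi.single 0 (deriv c t)) (Pi.single 1 ξ))
      + g (jet (2 * 1) c t) (iteratedDeriv 2 c t) ξ := by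
    intro c t hc hct ξ
    have hj : jet 1 c t = ![c t, deriv c t] := by
      funext k; fin_cases k <;> simp [jet, iteratedDeriv_one]
    rw [eulerLagrange_one hc (hLat _ (by rw [hj]; exact hct)) ξ, hg, hRc, hj, map_add,
      _root_.add_apply]
    ring
  refine ⟨W, g, hW, Subset.rfl, subset_closure, ?_, hker, fun c t hc hct ξ => ?_⟩
  · have h2 : ContDiffOn ℝ ∞ (fun j => fderiv ℝ (fderiv ℝ L) (R j))
        {j : Fin (2 * 1 + 1) → Coord n | (j 0, j 1) ∈ W} :=
      ((hL.fderiv_infty hWj).fderiv_infty hWj).comp R.contDiff.contDiffOn fun j hj => hj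
    exact (contDiffOn_const.clm_comp (h2.clm_comp contDiffOn_const)).neg
  · obtain ⟨ε, b, hε, hb0, hb, hbW, hbpath⟩ :=
      exists_smooth_path hW (P.contDiffOn_normal φ) hct
    have h0 : (0 : ℝ) ∈ Ioo (-ε) ε := ⟨by linarith, hε⟩
    have hext := (hE φ (-ε) ε b (by linarith) hb (fun t ht => hbW t ht)).2 (fun t ht => by
      refine ⟨inner ℝ (deriv b t) (P.h φ (b t, deriv b t)) / ‖deriv b t‖ ^ 2, ?_⟩
      rw [hbpath t ht, neg_add_eq_iff_eq_add]
      exact P.h_eq_normal_add φ (b t, deriv b t)) 0 h0 ξ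
    have hbs : ContDiffAt ℝ ∞ b 0 := (hb 0 h0).contDiffAt (isOpen_Ioo.mem_nhds h0)
    rw [hEL b 0 hbs (hbW 0 h0)] at hext
    rw [hEL c t hc hct, map_add, P.h_eq_normal_add φ (c t, deriv c t), map_add]
    have hb0' : b 0 = c t := congrArg Prod.fst hb0
    have hb1' : deriv b 0 = deriv c t := congrArg Prod.snd hb0
    have hRR : R (jet (2 * 1) b 0) = R (jet (2 * 1) c t) := by
      funext k; fin_cases k
      · exact hb0'
      · simpa [hR, jet, iteratedDeriv_one] using hb1'
    have hgg : ∀ w ξ, g (jet (2 * 1) b 0) w ξ = g (jet (2 * 1) c t) w ξ := fun w ξ => by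
      rw [hg, hg, hRR]
    rw [hgg, hbpath 0 h0, hb0', hb1', map_neg] at hext
    have hk : g (jet (2 * 1) c t)
        ((inner ℝ (deriv c t) (P.h φ (c t, deriv c t)) / ‖deriv c t‖ ^ 2) • deriv c t) = 0 :=
      (hker _ (by rw [jet_zero, jet_one (by omega)]; exact hct) _).2
        ⟨_, by rw [jet_one (by omega)]⟩
    simp only [hk, add_zero, _root_.add_apply, _root_.neg_apply] at hext ⊢
    linarith

end Finsler

/-! ### Continuity of the obstruction in the 4-jet -/

section JetTendsto

open Filter

variable {G : Type} [NormedAddCommGroup G] [NormedSpace ℝ G]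

/-- Convergence of a family of functions at a point together with their derivatives up to
order `m`. -/
def JetTendsto {X : Type*} (l : Filter X) (z : G) : ℕ → ∀ (F : Type) [NormedAddCommGroup F]
    [NormedSpace ℝ F], (X → G → F) → (G → F) → Prop
  | 0, _, _, _, f, f₀ => Tendsto (fun P => f P z) l (𝓝 (f₀ z))
  | m + 1, F, _, _, f, f₀ => Tendsto (fun P => f P z) l (𝓝 (f₀ z)) ∧
      JetTendsto l z m (G →L[ℝ] F) (fun P => fderiv ℝ (f P)) (fderiv ℝ f₀)

variable {X : Type*} {l : Filter X} {z : G} {m : ℕ} {F F₁ F₂ F₃ : Type} [NormedAddCommGroup F]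
  [NormedSpace ℝ F] [NormedAddCommGroup F₁] [NormedSpace ℝ F₁] [NormedAddCommGroup F₂]
  [NormedSpace ℝ F₂] [NormedAddCommGroup F₃] [NormedSpace ℝ F₃]

namespace JetTendsto

theorem tendsto {f : X → G → F} {f₀ : G → F} (h : JetTendsto l z m F f f₀) :
    Tendsto (fun P => f P z) l (𝓝 (f₀ z)) := by
  cases m with
  | zero => exact h
  | succ m => exact h.1

theorem of_succ {f : X → G → F} {f₀ : G → F} (h : JetTendsto l z (m + 1) F f f₀) :
    JetTendsto l z m F f f₀ := by
  induction m generalizing F with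
  | zero => exact h.1
  | succ m ih => exact ⟨h.1, ih h.2⟩

theorem congr {f g : X → G → F} {f₀ g₀ : G → F} (h : JetTendsto l z m F f f₀)
    (hfg : ∀ P, f P =ᶠ[𝓝 z] g P) (hfg₀ : f₀ =ᶠ[𝓝 z] g₀) : JetTendsto l z m F g g₀ := by
  induction m generalizing F with
  | zero =>
    have h' : Tendsto (fun P => f P z) l (𝓝 (f₀ z)) := h
    simp only [(hfg _).eq_of_nhds, hfg₀.eq_of_nhds] at h'
    exact h'
  | succ m ih =>
    have h' := h.1
    simp only [(hfg _).eq_of_nhds, hfg₀.eq_of_nhds] at h'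
    exact ⟨h', ih h.2 (fun P => (hfg P).fderiv) hfg₀.fderiv⟩

theorem const (f₀ : G → F) : JetTendsto l z m F (fun _ => f₀) f₀ := by
  induction m generalizing F with
  | zero => exact tendsto_const_nhds
  | succ m ih => exact ⟨tendsto_const_nhds, ih _⟩

theorem eventually_differentiable {f : G → F} (h : ContDiffAt ℝ ∞ f z) :
    ∀ᶠ y in 𝓝 z, DifferentiableAt ℝ f y := by
  have h1 : ContDiffAt ℝ 1 f z := h.of_le (by exact_mod_cast le_top)
  exact (h1.eventually (by simp)).mono fun y hy => hy.differentiableAt (by simp)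

theorem fderiv_contDiffAt {f : G → F} (h : ContDiffAt ℝ ∞ f z) : ContDiffAt ℝ ∞ (fderiv ℝ f) z :=
  h.fderiv_right (by simp)

theorem add {f g : X → G → F} {f₀ g₀ : G → F} (hf : JetTendsto l z m F f f₀)
    (hg : JetTendsto l z m F g g₀) (sf : ∀ P, ContDiffAt ℝ ∞ (f P) z)
    (sg : ∀ P, ContDiffAt ℝ ∞ (g P) z) (sf₀ : ContDiffAt ℝ ∞ f₀ z) (sg₀ : ContDiffAt ℝ ∞ g₀ z) :
    JetTendsto l z m F (fun P y => f P y + g P y) (fun y => f₀ y + g₀ y) := by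
  induction m generalizing F with
  | zero => exact Tendsto.add hf hg
  | succ m ih =>
    refine ⟨hf.1.add hg.1, (ih hf.2 hg.2 (fun P => fderiv_contDiffAt (sf P))
      (fun P => fderiv_contDiffAt (sg P)) (fderiv_contDiffAt sf₀) (fderiv_contDiffAt sg₀)).congr
      (fun P => ?_) ?_⟩
    · filter_upwards [eventually_differentiable (sf P), eventually_differentiable (sg P)]
        with y h1 h2
      exact (fderiv_fun_add h1 h2).symm
    · filter_upwards [eventually_differentiable sf₀, eventually_differentiable sg₀] with y h1 h2
      exact (fderiv_fun_add h1 h2).symm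

theorem clm (A : F →L[ℝ] F₁) {f : X → G → F} {f₀ : G → F} (hf : JetTendsto l z m F f f₀)
    (sf : ∀ P, ContDiffAt ℝ ∞ (f P) z) (sf₀ : ContDiffAt ℝ ∞ f₀ z) :
    JetTendsto l z m F₁ (fun P y => A (f P y)) (fun y => A (f₀ y)) := by
  induction m generalizing F F₁ with
  | zero => exact (A.continuous.tendsto _).comp hf
  | succ m ih =>
    refine ⟨(A.continuous.tendsto _).comp hf.1, (ih (ContinuousLinearMap.compL ℝ G F F₁ A) hf.2
      (fun P => fderiv_contDiffAt (sf P)) (fderiv_contDiffAt sf₀)).congr (fun P => ?_) ?_⟩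
    · filter_upwards [eventually_differentiable (sf P)] with y h1
      exact (A.hasFDerivAt.comp y h1.hasFDerivAt).fderiv.symm
    · filter_upwards [eventually_differentiable sf₀] with y h1
      exact (A.hasFDerivAt.comp y h1.hasFDerivAt).fderiv.symm

theorem contDiffAt_bilin (B : F₁ →L[ℝ] F₂ →L[ℝ] F₃) {f : G → F₁} {g : G → F₂}
    (hf : ContDiffAt ℝ ∞ f z) (hg : ContDiffAt ℝ ∞ g z) :
    ContDiffAt ℝ ∞ (fun y => B (f y) (g y)) z :=
  B.isBoundedBilinearMap.contDiff.contDiffAt.comp z (hf.prodMk hg)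

theorem tendsto_bilin (B : F₁ →L[ℝ] F₂ →L[ℝ] F₃) {f : X → F₁} {g : X → F₂} {a : F₁} {b : F₂}
    (hf : Tendsto f l (𝓝 a)) (hg : Tendsto g l (𝓝 b)) :
    Tendsto (fun P => B (f P) (g P)) l (𝓝 (B a b)) :=
  (B.continuous₂.tendsto (a, b)).comp (hf.prodMk_nhds hg)

/-- Leibniz rule: the derivative of B(f, g) is again a sum of bilinear expressions, but with values
in other spaces, so the induction has to run over all target spaces and all bilinear maps at once.
-/
theorem bilin (B : F₁ →L[ℝ] F₂ →L[ℝ] F₃) {f : X → G → F₁} {f₀ : G → F₁} {g : X → G → F₂}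
    {g₀ : G → F₂} (hf : JetTendsto l z m F₁ f f₀) (hg : JetTendsto l z m F₂ g g₀)
    (sf : ∀ P, ContDiffAt ℝ ∞ (f P) z) (sg : ∀ P, ContDiffAt ℝ ∞ (g P) z)
    (sf₀ : ContDiffAt ℝ ∞ f₀ z) (sg₀ : ContDiffAt ℝ ∞ g₀ z) :
    JetTendsto l z m F₃ (fun P y => B (f P y) (g P y)) (fun y => B (f₀ y) (g₀ y)) := by
  induction m generalizing F₁ F₂ F₃ with
  | zero => exact tendsto_bilin B hf hg
  | succ m ih =>
    refine ⟨tendsto_bilin B hf.1 hg.1, ?_⟩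
    have h1 := ih (B.precompR G) hf.of_succ hg.2 sf (fun P => fderiv_contDiffAt (sg P)) sf₀
      (fderiv_contDiffAt sg₀)
    have h2 := ih (B.precompL G) hf.2 hg.of_succ (fun P => fderiv_contDiffAt (sf P)) sg
      (fderiv_contDiffAt sf₀) sg₀
    have sm : ∀ {f : G → F₁} {g : G → F₂}, ContDiffAt ℝ ∞ f z → ContDiffAt ℝ ∞ g z →
        ContDiffAt ℝ ∞ (fun y => B.precompR G (f y) (fderiv ℝ g y)) z := fun sf sg =>
      contDiffAt_bilin (B.precompR G) sf (fderiv_contDiffAt sg)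
    have sm' : ∀ {f : G → F₁} {g : G → F₂}, ContDiffAt ℝ ∞ f z → ContDiffAt ℝ ∞ g z →
        ContDiffAt ℝ ∞ (fun y => B.precompL G (fderiv ℝ f y) (g y)) z := fun sf sg =>
      contDiffAt_bilin (B.precompL G) (fderiv_contDiffAt sf) sg
    refine (add h1 h2 (fun P => sm (sf P) (sg P)) (fun P => sm' (sf P) (sg P)) (sm sf₀ sg₀)
      (sm' sf₀ sg₀)).congr (fun P => ?_) ?_
    · filter_upwards [eventually_differentiable (sf P), eventually_differentiable (sg P)]
        with y h1 h2
      exact (B.fderiv_of_bilinear h1 h2).symm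
    · filter_upwards [eventually_differentiable sf₀, eventually_differentiable sg₀] with y h1 h2
      exact (B.fderiv_of_bilinear h1 h2).symm

/-- Up to a currying isometry, the iterated derivative of order j + 1 of f is the one of order j of
`fderiv ℝ f`; this matches the recursion that defines `JetTendsto`. -/
theorem of_iteratedFDeriv {f : X → G → F} {f₀ : G → F}
    (h : ∀ j ≤ m, Tendsto (fun P => iteratedFDeriv ℝ j (f P) z) l (𝓝 (iteratedFDeriv ℝ j f₀ z))) :
    JetTendsto l z m F f f₀ := by
  have h0 : Tendsto (fun P => f P z) l (𝓝 (f₀ z)) := by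
    have := h 0 (Nat.zero_le _)
    have h2 := ((continuousMultilinearCurryFin0 ℝ G F).continuous.tendsto _).comp this
    simpa [Function.comp_def, iteratedFDeriv_zero_eq_comp] using h2
  induction m generalizing F with
  | zero => exact h0
  | succ m ih =>
    refine ⟨h0, ?_⟩
    have h' : ∀ j ≤ m, Tendsto (fun P => iteratedFDeriv ℝ j (fderiv ℝ (f P)) z) l
        (𝓝 (iteratedFDeriv ℝ j (fderiv ℝ f₀) z)) := fun j hj => by
      have := h (j + 1) (by omega)
      simp only [iteratedFDeriv_succ_eq_comp_right, Function.comp_apply] at this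
      have h2 := ((continuousMultilinearCurryRightEquiv' ℝ j G F).continuous.tendsto _).comp this
      simpa [Function.comp_def] using h2
    refine ih h' ?_
    have := h' 0 (Nat.zero_le _)
    have h2 := ((continuousMultilinearCurryFin0 ℝ G (G →L[ℝ] F)).continuous.tendsto _).comp this
    simpa [Function.comp_def, iteratedFDeriv_zero_eq_comp] using h2

end JetTendsto

section

variable {E : Type} [NormedAddCommGroup E] [NormedSpace ℝ E] {z : E × E} {U : Set (E × E)}
  {h : X → E × E → E} {h₀ : E × E → E}

theorem JetTendsto.velDeriv (hU : IsOpen U) (hz : z ∈ U) (sh : ∀ P, ContDiffOn ℝ ∞ (h P) U)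
    (sh₀ : ContDiffOn ℝ ∞ h₀ U) (hh : JetTendsto l z (m + 1) E h h₀) :
    JetTendsto l z m (E →L[ℝ] E) (fun P => _root_.velDeriv (h P)) (_root_.velDeriv h₀) :=
  clm ((ContinuousLinearMap.compL ℝ E (E × E) E).flip (ContinuousLinearMap.inr ℝ E E)) hh.2
    (fun P => fderiv_contDiffAt ((sh P).contDiffAt (hU.mem_nhds hz)))
    (fderiv_contDiffAt (sh₀.contDiffAt (hU.mem_nhds hz)))

theorem JetTendsto.posDeriv (hU : IsOpen U) (hz : z ∈ U) (sh : ∀ P, ContDiffOn ℝ ∞ (h P) U)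
    (sh₀ : ContDiffOn ℝ ∞ h₀ U) (hh : JetTendsto l z (m + 1) E h h₀) :
    JetTendsto l z m (E →L[ℝ] E) (fun P => _root_.posDeriv (h P)) (_root_.posDeriv h₀) :=
  clm ((ContinuousLinearMap.compL ℝ E (E × E) E).flip (ContinuousLinearMap.inl ℝ E E)) hh.2
    (fun P => fderiv_contDiffAt ((sh P).contDiffAt (hU.mem_nhds hz)))
    (fderiv_contDiffAt (sh₀.contDiffAt (hU.mem_nhds hz)))

theorem JetTendsto.sprayDeriv (hU : IsOpen U) (hz : z ∈ U) (sh : ∀ P, ContDiffOn ℝ ∞ (h P) U)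
    (sh₀ : ContDiffOn ℝ ∞ h₀ U) (hh : JetTendsto l z m E h h₀) {f : X → E × E → F}
    {f₀ : E × E → F} (sf : ∀ P, ContDiffOn ℝ ∞ (f P) U) (sf₀ : ContDiffOn ℝ ∞ f₀ U)
    (hf : JetTendsto l z (m + 1) F f f₀) :
    JetTendsto l z m F (fun P => _root_.sprayDeriv (h P) (f P)) (_root_.sprayDeriv h₀ f₀) := by
  have hn := hU.mem_nhds hz
  -- The spray (v, -h) is split into a part independent of `h` and a continuous linear image of `h`.
  set V : E × E → E × E := fun y => (y.2, 0) with hV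
  have sV : ContDiffAt ℝ ∞ V z := contDiffAt_snd.prodMk contDiffAt_const
  have h1 := clm (-(ContinuousLinearMap.inr ℝ E E)) hh (fun P => (sh P).contDiffAt hn)
    (sh₀.contDiffAt hn)
  have s1 : ∀ {h : E × E → E}, ContDiffAt ℝ ∞ h z →
      ContDiffAt ℝ ∞ (fun y => (-(ContinuousLinearMap.inr ℝ E E)) (h y)) z := fun sh =>
    (-(ContinuousLinearMap.inr ℝ E E)).contDiff.contDiffAt.comp z sh
  have h2 := (JetTendsto.const (l := l) (m := m) (z := z) V).add h1 (fun _ => sV)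
    (fun P => s1 ((sh P).contDiffAt hn)) sV (s1 (sh₀.contDiffAt hn))
  have h3 := bilin (ContinuousLinearMap.id ℝ (E × E →L[ℝ] F)) hf.2 h2
    (fun P => fderiv_contDiffAt ((sf P).contDiffAt hn))
    (fun P => sV.add (s1 ((sh P).contDiffAt hn))) (fderiv_contDiffAt (sf₀.contDiffAt hn))
    (sV.add (s1 (sh₀.contDiffAt hn)))
  have e : ∀ (h : E × E → E) y, V y + (-(ContinuousLinearMap.inr ℝ E E)) (h y) = (y.2, -h y) :=
    fun h y => by simp [hV]
  simp only [e] at h3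
  exact h3

/-- Two orders are lost, in the position derivative's companion term: the spray derivative of the
velocity derivative of h. -/
theorem JetTendsto.jacobiEnd (hU : IsOpen U) (hz : z ∈ U) (sh : ∀ P, ContDiffOn ℝ ∞ (h P) U)
    (sh₀ : ContDiffOn ℝ ∞ h₀ U) (hh : JetTendsto l z (m + 2) E h h₀) :
    JetTendsto l z m (E →L[ℝ] E) (fun P => _root_.jacobiEnd (h P)) (_root_.jacobiEnd h₀) := by
  have hn := hU.mem_nhds hz
  have hB := hh.velDeriv hU hz sh sh₀
  have sB := fun P => (sh P).velDeriv hU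
  have sB₀ := sh₀.velDeriv hU
  have hA := hh.of_succ.posDeriv hU hz sh sh₀
  have hS := JetTendsto.sprayDeriv hU hz sh sh₀ hh.of_succ.of_succ sB sB₀ hB
  have hS' := clm (-((1 / 2 : ℝ) • ContinuousLinearMap.id ℝ (E →L[ℝ] E))) hS
    (fun P => ((sh P).sprayDeriv (sB P) hU).contDiffAt hn)
    ((sh₀.sprayDeriv sB₀ hU).contDiffAt hn)
  have hBB := bilin (-((1 / 4 : ℝ) • ContinuousLinearMap.compL ℝ E E E)) hB.of_succ hB.of_succ
    (fun P => (sB P).contDiffAt hn) (fun P => (sB P).contDiffAt hn) (sB₀.contDiffAt hn)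
    (sB₀.contDiffAt hn)
  have s1 : ∀ {h : E × E → E}, ContDiffOn ℝ ∞ h U → ContDiffAt ℝ ∞ (fun y =>
      (-((1 / 2 : ℝ) • ContinuousLinearMap.id ℝ (E →L[ℝ] E)))
        (_root_.sprayDeriv h (_root_.velDeriv h) y)) z :=
    fun sh => (ContinuousLinearMap.contDiff _).contDiffAt.comp z
      ((sh.sprayDeriv (sh.velDeriv hU) hU).contDiffAt hn)
  have s2 : ∀ {h : E × E → E}, ContDiffOn ℝ ∞ h U → ContDiffAt ℝ ∞ (fun y =>
      (-((1 / 4 : ℝ) • ContinuousLinearMap.compL ℝ E E E)) (_root_.velDeriv h y)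
        (_root_.velDeriv h y)) z :=
    fun sh => contDiffAt_bilin _ ((sh.velDeriv hU).contDiffAt hn) ((sh.velDeriv hU).contDiffAt hn)
  have h1 := hA.add hS' (fun P => ((sh P).posDeriv hU).contDiffAt hn) (fun P => s1 (sh P))
    ((sh₀.posDeriv hU).contDiffAt hn) (s1 sh₀)
  have h2 := h1.add hBB (fun P => (((sh P).posDeriv hU).contDiffAt hn).add (s1 (sh P)))
    (fun P => s2 (sh P)) (((sh₀.posDeriv hU).contDiffAt hn).add (s1 sh₀)) (s2 sh₀)
  refine h2.congr (fun P => .of_forall fun y => ?_) (.of_forall fun y => ?_) <;>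
  · simp [_root_.jacobiEnd, sub_eq_add_neg]

theorem JetTendsto.dynDeriv (hU : IsOpen U) (hz : z ∈ U) (sh : ∀ P, ContDiffOn ℝ ∞ (h P) U)
    (sh₀ : ContDiffOn ℝ ∞ h₀ U) (hh : JetTendsto l z (m + 1) E h h₀) {T : X → E × E → E →L[ℝ] E}
    {T₀ : E × E → E →L[ℝ] E} (sT : ∀ P, ContDiffOn ℝ ∞ (T P) U) (sT₀ : ContDiffOn ℝ ∞ T₀ U)
    (hT : JetTendsto l z (m + 1) (E →L[ℝ] E) T T₀) :
    JetTendsto l z m (E →L[ℝ] E) (fun P => _root_.dynDeriv (h P) (T P))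
      (_root_.dynDeriv h₀ T₀) := by
  have hn := hU.mem_nhds hz
  have hB := hh.velDeriv hU hz sh sh₀
  have sB := fun P => (sh P).velDeriv hU
  have sB₀ := sh₀.velDeriv hU
  have hS := JetTendsto.sprayDeriv hU hz sh sh₀ hh.of_succ sT sT₀ hT
  set K : (E →L[ℝ] E) →L[ℝ] (E →L[ℝ] E) →L[ℝ] (E →L[ℝ] E) :=
    (1 / 2 : ℝ) • (ContinuousLinearMap.compL ℝ E E E - (ContinuousLinearMap.compL ℝ E E E).flip)
  have hBT := bilin K hB hT.of_succ (fun P => (sB P).contDiffAt hn) (fun P => (sT P).contDiffAt hn)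
    (sB₀.contDiffAt hn) (sT₀.contDiffAt hn)
  have s2 : ∀ {h : E × E → E} {T : E × E → E →L[ℝ] E}, ContDiffOn ℝ ∞ h U → ContDiffOn ℝ ∞ T U →
      ContDiffAt ℝ ∞ (fun y => K (_root_.velDeriv h y) (T y)) z :=
    fun sh sT => contDiffAt_bilin K ((sh.velDeriv hU).contDiffAt hn) (sT.contDiffAt hn)
  exact hS.add hBT (fun P => ((sh P).sprayDeriv (sT P) hU).contDiffAt hn)
    (fun P => s2 (sh P) (sT P)) ((sh₀.sprayDeriv sT₀ hU).contDiffAt hn) (s2 sh₀ sT₀)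

theorem tendsto_traceComm [FiniteDimensional ℝ E] {T₁ T₂ T₃ : X → E →L[ℝ] E}
    {S₁ S₂ S₃ : E →L[ℝ] E} (h₁ : Tendsto T₁ l (𝓝 S₁)) (h₂ : Tendsto T₂ l (𝓝 S₂))
    (h₃ : Tendsto T₃ l (𝓝 S₃)) :
    Tendsto (fun P => traceComm (T₁ P) (T₂ P) (T₃ P)) l (𝓝 (traceComm S₁ S₂ S₃)) :=
  ((continuous_traceComm (E := E)).tendsto (S₁, S₂, S₃)).comp
    (h₁.prodMk_nhds (h₂.prodMk_nhds h₃))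

/-- The count of derivatives is 2 for Φ, 3 for ∇Φ and 4 for ∇²Φ; the trace form is continuous in the
three endomorphisms. -/
theorem JetTendsto.tendsto_obstruction [FiniteDimensional ℝ E] (hU : IsOpen U) (hz : z ∈ U)
    (sh : ∀ P, ContDiffOn ℝ ∞ (h P) U) (sh₀ : ContDiffOn ℝ ∞ h₀ U)
    (hh : JetTendsto l z 4 E h h₀) :
    Tendsto (fun P => obstruction (h P) z) l (𝓝 (obstruction h₀ z)) := by
  have s1 := fun P => (sh P).jacobiEnd hU
  have s1₀ := sh₀.jacobiEnd hU
  have s2 := fun P => (sh P).dynDeriv (s1 P) hU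
  have s2₀ := sh₀.dynDeriv s1₀ hU
  have hh3 := of_succ (m := 3) hh
  have hh2 := of_succ (m := 2) hh3
  have hh1 := of_succ (m := 1) hh2
  have h1 := JetTendsto.jacobiEnd (m := 2) hU hz sh sh₀ hh
  have h2 := JetTendsto.dynDeriv (m := 1) hU hz sh sh₀ hh2 s1 s1₀ h1
  have h3 := JetTendsto.dynDeriv (m := 0) hU hz sh sh₀ hh1 s2 s2₀ h2
  have e1 : Tendsto (fun P => _root_.jacobiEnd (h P) z) l (𝓝 (_root_.jacobiEnd h₀ z)) := h1.tendsto
  have e2 : Tendsto (fun P => _root_.dynDeriv (h P) (_root_.jacobiEnd (h P)) z) l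
    (𝓝 (_root_.dynDeriv h₀ (_root_.jacobiEnd h₀) z)) := h2.tendsto
  have e3 : Tendsto (fun P => _root_.dynDeriv (h P) (_root_.dynDeriv (h P)
    (_root_.jacobiEnd (h P))) z) l
    (𝓝 (_root_.dynDeriv h₀ (_root_.dynDeriv h₀ (_root_.jacobiEnd h₀)) z)) := h3.tendsto
  exact tendsto_traceComm e1 e2 e3

end

end JetTendsto

/-! ### Openness in the weak topology -/

section Openness

open Filter

variable {n : ℕ} {M : Type*} [TopologicalSpace M] [ChartedSpace (Coord n) M]

/-- Non-vanishing of the obstruction at a point is an open condition in the weak `C⁴` topology. -/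
theorem isOpen_obstruction_ne_zero {k : ℕ} (hk : 4 ≤ k) (φ : atlas (Coord n) M) {p : M}
    (hp : p ∈ φ.1.source) {v : Coord n} (hv : ‖v‖ = 1) :
    IsOpen[weakTopology n M k] {P | obstruction (P.normal φ) (φ.1 p, v) ≠ 0} := by
  let _ := weakTopology n M k
  have hz : (φ.1 p, v) ∈ slitTangent φ.1 :=
    ⟨φ.1.map_source hp, fun h => by rw [show v = 0 from h] at hv; simp at hv⟩
  have hU := isOpen_slitTangent φ.1
  refine isOpen_iff_mem_nhds.2 fun P₀ hP₀ => ?_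
  have hjet : JetTendsto (𝓝 P₀) (φ.1 p, v) 4 (Coord n) (fun P => P.normal φ) (P₀.normal φ) := by
    refine JetTendsto.of_iteratedFDeriv fun j hj => ?_
    rw [Metric.tendsto_nhds]
    intro ε hε
    -- Since the obstruction is tested at one tangent vector, closeness over the compact set `{p}`
    -- is enough.
    have ho : IsOpen {Q : PathStructure n M | CkClose k φ {p} ε P₀ Q} :=
      TopologicalSpace.isOpen_generateFrom_of_mem ⟨P₀, φ, {p}, ε, isCompact_singleton,
        singleton_subset_iff.2 hp, hε, rfl⟩
    have hmem : P₀ ∈ {Q : PathStructure n M | CkClose k φ {p} ε P₀ Q} := by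
      intro q _ w _ i _
      have : (fun z => P₀.normal φ z - P₀.normal φ z) = fun _ => (0 : Coord n) := by
        funext; simp
      rw [this]
      simpa [iteratedFDeriv_fun_zero] using hε
    filter_upwards [ho.mem_nhds hmem] with Q hQ
    have := hQ p rfl v hv j (hj.trans hk)
    have sm : ∀ Q : PathStructure n M, ContDiffAt ℝ j (Q.normal φ) (φ.1 p, v) := fun Q =>
      ((Q.contDiffOn_normal φ).contDiffAt (hU.mem_nhds hz)).of_le (by exact_mod_cast le_top)
    rw [dist_eq_norm]
    have e := iteratedFDeriv_sub_apply (𝕜 := ℝ) (sm Q) (sm P₀)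
    rw [← e]
    exact this
  exact (hjet.tendsto_obstruction hU hz (fun P => P.contDiffOn_normal φ)
    (P₀.contDiffOn_normal φ)).eventually_ne hP₀

end Openness

/-! ### Perturbations vanishing to finite order on a hyperplane of positions -/

section Perturbation

variable {E F F₁ F₂ F₃ G : Type*} [NormedAddCommGroup E] [NormedSpace ℝ E] [NormedAddCommGroup F]
  [NormedSpace ℝ F] [NormedAddCommGroup F₁] [NormedSpace ℝ F₁] [NormedAddCommGroup F₂]
  [NormedSpace ℝ F₂] [NormedAddCommGroup F₃] [NormedSpace ℝ F₃]
  [NormedAddCommGroup G] [NormedSpace ℝ G]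

/-- Near `z`, the functions `f'` and `f` differ by `lam ^ k` times a smooth function with value `y`
at `z`. -/
def EqModPow (lam : G → ℝ) (z : G) (k : ℕ) (f' f : G → F) (y : F) : Prop :=
  ∃ r : G → F, ContDiffAt ℝ ∞ r z ∧ r z = y ∧ ∀ᶠ w in 𝓝 z, f' w = f w + lam w ^ k • r w

namespace EqModPow

variable {lam : G → ℝ} {z : G} {k : ℕ}

theorem apply_eq {f' f : G → F} {y : F} (h : EqModPow lam z 0 f' f y) : f' z = f z + y := by
  obtain ⟨r, -, rfl, hr⟩ := h
  simpa using hr.self_of_nhds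

theorem apply_eq_of_succ {f' f : G → F} {y : F} (hz : lam z = 0)
    (h : EqModPow lam z (k + 1) f' f y) : f' z = f z := by
  obtain ⟨r, -, rfl, hr⟩ := h
  simpa [hz] using hr.self_of_nhds

theorem add {f' f g' g : G → F} {a b : F} (hf : EqModPow lam z k f' f a)
    (hg : EqModPow lam z k g' g b) :
    EqModPow lam z k (fun w => f' w + g' w) (fun w => f w + g w) (a + b) := by
  obtain ⟨r, sr, rfl, hr⟩ := hf
  obtain ⟨q, sq, rfl, hq⟩ := hg
  refine ⟨fun w => r w + q w, sr.add sq, rfl, ?_⟩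
  filter_upwards [hr, hq] with w h1 h2
  rw [h1, h2, smul_add]; abel

theorem clm (A : F →L[ℝ] F₁) {f' f : G → F} {a : F} (hf : EqModPow lam z k f' f a) :
    EqModPow lam z k (fun w => A (f' w)) (fun w => A (f w)) (A a) := by
  obtain ⟨r, sr, rfl, hr⟩ := hf
  refine ⟨fun w => A (r w), A.contDiff.contDiffAt.comp z sr, rfl, ?_⟩
  filter_upwards [hr] with w h1
  rw [h1, map_add, map_smul]

/-- Every error term carries at least λ^(k+1). Read at order k, one factor λ is left in the
remainder, which therefore vanishes at z. -/
theorem bilin (B : F₁ →L[ℝ] F₂ →L[ℝ] F₃) {f' f : G → F₁} {g' g : G → F₂} {a : F₁} {b : F₂}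
    (hlam : ContDiffAt ℝ ∞ lam z) (hz : lam z = 0) (sf : ContDiffAt ℝ ∞ f z)
    (sg : ContDiffAt ℝ ∞ g z) (hf : EqModPow lam z (k + 1) f' f a)
    (hg : EqModPow lam z (k + 1) g' g b) :
    EqModPow lam z k (fun w => B (f' w) (g' w)) (fun w => B (f w) (g w)) 0 := by
  obtain ⟨r, sr, rfl, hr⟩ := hf
  obtain ⟨q, sq, rfl, hq⟩ := hg
  have sB : ∀ {f : G → F₁} {g : G → F₂}, ContDiffAt ℝ ∞ f z → ContDiffAt ℝ ∞ g z →
      ContDiffAt ℝ ∞ (fun w => B (f w) (g w)) z := fun sf sg =>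
    B.isBoundedBilinearMap.contDiff.contDiffAt.comp z (sf.prodMk sg)
  refine ⟨fun w => lam w • (B (r w) (g w) + B (f w) (q w) + lam w ^ (k + 1) • B (r w) (q w)),
    hlam.smul (((sB sr sg).add (sB sf sq)).add ((hlam.pow _).smul (sB sr sq))), by simp [hz], ?_⟩
  filter_upwards [hr, hq] with w h1 h2
  rw [h1, h2]
  simp only [map_add, map_smul, _root_.add_apply, _root_.smul_apply, smul_add, smul_smul]
  have e1 : lam w ^ k * lam w = lam w ^ (k + 1) := (pow_succ _ _).symm
  have e2 : lam w ^ k * (lam w * lam w ^ (k + 1)) = lam w ^ (k + 1) * lam w ^ (k + 1) := by ring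
  rw [e1, e2]
  abel

end EqModPow

section Spray

variable {l : E →L[ℝ] ℝ} {x₀ : E} {z : E × E} {k m : ℕ}

/-- The linear function on positions vanishing at `x₀`, seen on pairs. -/
def posFun (l : E →L[ℝ] ℝ) (x₀ : E) (w : E × E) : ℝ := l (w.1 - x₀)

theorem contDiff_posFun : ContDiff ℝ ∞ (posFun l x₀) :=
  l.contDiff.comp (contDiff_fst.sub contDiff_const)

theorem hasFDerivAt_posFun (w : E × E) :
    HasFDerivAt (posFun l x₀) (l.comp (ContinuousLinearMap.fst ℝ E E)) w :=
  l.hasFDerivAt.comp w ((ContinuousLinearMap.fst ℝ E E).hasFDerivAt.sub_const x₀)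

theorem eventually_hasFDerivAt {f : G → F} {z : G} (h : ContDiffAt ℝ ∞ f z) :
    ∀ᶠ y in 𝓝 z, HasFDerivAt f (fderiv ℝ f y) y :=
  (((h.of_le (by exact_mod_cast le_top : (1 : WithTop ℕ∞) ≤ ∞)).eventually (by simp))).mono
    fun _ hy => (hy.differentiableAt (by simp)).hasFDerivAt

/-- For k = 0 the truncated exponent k - 1 is harmless, because its coefficient is zero. -/
theorem eventually_fderiv_eq {f' f r : E × E → F}
    (sf : ContDiffAt ℝ ∞ f z) (sr : ContDiffAt ℝ ∞ r z)
    (h : ∀ᶠ w in 𝓝 z, f' w = f w + posFun l x₀ w ^ k • r w) :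
    ∀ᶠ w in 𝓝 z, ∀ v, fderiv ℝ f' w v = fderiv ℝ f w v + posFun l x₀ w ^ k • fderiv ℝ r w v
      + (k * posFun l x₀ w ^ (k - 1) * l v.1) • r w := by
  filter_upwards [h.eventually_nhds, eventually_hasFDerivAt sf, eventually_hasFDerivAt sr]
    with w hw hf hr v
  have ev : f' =ᶠ[𝓝 w] fun w => f w + posFun l x₀ w ^ k • r w := hw
  rw [ev.fderiv_eq]
  have h1 := hf.add (((hasFDerivAt_posFun (l := l) (x₀ := x₀) w).pow k).smul hr)
  rw [HasFDerivAt.fderiv (f := fun w => f w + posFun l x₀ w ^ k • r w) h1]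
  simp [add_assoc]

/-- The function λ does not depend on the velocity, so no order of vanishing is lost. -/
theorem EqModPow.velDeriv {h' h q : E × E → F} (sh : ContDiffAt ℝ ∞ h z)
    (sq : ContDiffAt ℝ ∞ q z) (hq : ∀ᶠ w in 𝓝 z, h' w = h w + posFun l x₀ w ^ m • q w) :
    EqModPow (posFun l x₀) z m (velDeriv h') (velDeriv h) (velDeriv q z) := by
  refine ⟨_root_.velDeriv q, ?_, rfl, ?_⟩
  · exact ContDiffAt.clm_comp (sq.fderiv_right (by simp)) contDiffAt_const
  · filter_upwards [eventually_fderiv_eq sh sq hq] with w hw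
    ext e
    simp [_root_.velDeriv, hw]

/-- One order is lost: the leading term comes from differentiating the power of λ. -/
theorem EqModPow.posDeriv {h' h q : E × E → F} (sh : ContDiffAt ℝ ∞ h z)
    (sq : ContDiffAt ℝ ∞ q z) (hz : posFun l x₀ z = 0)
    (hq : ∀ᶠ w in 𝓝 z, h' w = h w + posFun l x₀ w ^ (k + 1) • q w) :
    EqModPow (posFun l x₀) z k (posDeriv h') (posDeriv h)
      (((k + 1 : ℕ) : ℝ) • l.smulRight (q z)) := by
  refine ⟨fun w => posFun l x₀ w • _root_.posDeriv q w + ((k + 1 : ℕ) : ℝ) • l.smulRight (q w),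
    ?_, by simp [hz], ?_⟩
  · have s1 : ContDiffAt ℝ ∞ (_root_.posDeriv q) z :=
      ContDiffAt.clm_comp (sq.fderiv_right (by simp)) contDiffAt_const
    exact (contDiff_posFun.contDiffAt.smul s1).add
      ((((ContinuousLinearMap.smulRightL ℝ E F) l).contDiff.contDiffAt.comp z sq).const_smul _)
  · filter_upwards [eventually_fderiv_eq sh sq hq] with w hw
    ext e
    simp only [_root_.posDeriv, ContinuousLinearMap.comp_apply, hw, _root_.add_apply,
      _root_.smul_apply, ContinuousLinearMap.inl_apply, smul_add, smul_smul,
      ContinuousLinearMap.smulRight_apply, Nat.add_sub_cancel, add_assoc, pow_succ]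
    congr 3
    ring

/-- The spray derivative of λ is l(v), so λ^(k+1) r contributes (k+1) l(v) λ^k r to leading order.
The change of the spray itself has order m ≥ k + 1 and contributes nothing at order k. -/
theorem EqModPow.sprayDeriv {h' h q : E × E → E} (sh : ContDiffAt ℝ ∞ h z)
    (sq : ContDiffAt ℝ ∞ q z) (hz : posFun l x₀ z = 0) (hkm : k + 1 ≤ m)
    (hq : ∀ᶠ w in 𝓝 z, h' w = h w + posFun l x₀ w ^ m • q w) {f' f : E × E → F} {y : F}
    (sf : ContDiffAt ℝ ∞ f z) (hf : EqModPow (posFun l x₀) z (k + 1) f' f y) :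
    EqModPow (posFun l x₀) z k (sprayDeriv h' f') (sprayDeriv h f)
      ((((k + 1 : ℕ) : ℝ) * l z.2) • y) := by
  obtain ⟨r, sr, rfl, hr⟩ := hf
  obtain ⟨j, rfl⟩ := Nat.exists_eq_add_of_le hkm
  set lam := posFun l x₀ with hlam
  have slam : ContDiffAt ℝ ∞ lam z := contDiff_posFun.contDiffAt
  set H : E × E → E := fun w => h w + lam w ^ (k + 1 + j) • q w with hH
  have sH : ContDiffAt ℝ ∞ H z := sh.add ((slam.pow _).smul sq)
  refine ⟨fun w => (((k + 1 : ℕ) : ℝ) * l w.2) • r w + lam w • (fderiv ℝ r w (w.2, -H w)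
    - lam w ^ j • fderiv ℝ f w (0, q w)), ?_, by simp [hz], ?_⟩
  · have sl : ContDiffAt ℝ ∞ (fun w : E × E => l w.2) z :=
      l.contDiff.contDiffAt.comp z contDiffAt_snd
    refine ((contDiffAt_const.mul sl).smul sr).add (slam.smul (ContDiffAt.sub ?_ ?_))
    · exact ContDiffAt.clm_apply (sr.fderiv_right (by simp)) (contDiffAt_snd.prodMk sH.neg)
    · exact (slam.pow j).smul
        (ContDiffAt.clm_apply (sf.fderiv_right (by simp)) (contDiffAt_const.prodMk sq))
  · filter_upwards [eventually_fderiv_eq sf sr hr, hq] with w hw hhw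
    have e1 : (w.2, -h' w) = (w.2, -h w) - lam w ^ (k + 1 + j) • ((0 : E), q w) := by
      rw [hhw]; ext <;> simp; abel
    simp only [_root_.sprayDeriv, hw]
    have e2 : fderiv ℝ f w (w.2, -h' w) = fderiv ℝ f w (w.2, -h w)
        - lam w ^ (k + 1 + j) • fderiv ℝ f w (0, q w) := by rw [e1, map_sub, map_smul]
    have e3 : h' w = H w := hhw
    rw [e2, e3]
    simp only [Nat.add_sub_cancel, smul_add, smul_sub, smul_smul]
    have p1 : lam w ^ k * lam w = lam w ^ (k + 1) := (pow_succ _ _).symm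
    have p2 : lam w ^ k * (lam w * lam w ^ j) = lam w ^ (k + 1 + j) := by ring
    have p3 : lam w ^ k * (((k + 1 : ℕ) : ℝ) * l w.2) = ((k + 1 : ℕ) : ℝ) * lam w ^ k * l w.2 := by
      ring
    rw [p1, p2, p3]
    abel

/-- At order k the position derivative contributes (k+1) l⊗q and the spray derivative of B
contributes -½(k+1) l(v) times the velocity derivative of q. The change of B² has remainder zero at
z. -/
theorem EqModPow.jacobiEnd {h' h q : E × E → E} (sh : ContDiffAt ℝ ∞ h z)
    (sq : ContDiffAt ℝ ∞ q z) (hz : posFun l x₀ z = 0)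
    (hq : ∀ᶠ w in 𝓝 z, h' w = h w + posFun l x₀ w ^ (k + 1) • q w) :
    EqModPow (posFun l x₀) z k (jacobiEnd h') (jacobiEnd h)
      (((k + 1 : ℕ) : ℝ) • (l.smulRight (q z) - (l z.2 / 2) • _root_.velDeriv q z)) := by
  have slam : ContDiffAt ℝ ∞ (posFun l x₀) z := contDiff_posFun.contDiffAt
  have sB : ContDiffAt ℝ ∞ (_root_.velDeriv h) z :=
    ContDiffAt.clm_comp (sh.fderiv_right (by simp)) contDiffAt_const
  have hB := EqModPow.velDeriv sh sq hq
  have hS := EqModPow.sprayDeriv sh sq hz le_rfl hq sB hB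
  have hA := EqModPow.posDeriv sh sq hz hq
  have hBB := EqModPow.bilin (ContinuousLinearMap.compL ℝ E E E) slam hz sB sB hB hB
  obtain ⟨r, sr, hr, hr'⟩ := (hA.add (hS.clm (-((1 / 2 : ℝ) • ContinuousLinearMap.id ℝ _)))).add
    (hBB.clm (-((1 / 4 : ℝ) • ContinuousLinearMap.id ℝ _)))
  refine ⟨r, sr, ?_, ?_⟩
  · rw [hr]
    ext e
    simp only [_root_.add_apply, _root_.smul_apply, _root_.neg_apply, _root_.sub_apply, map_zero,
      ContinuousLinearMap.id_apply, add_zero, smul_sub, smul_smul]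
    rw [sub_eq_add_neg]
    congr 3
    ring
  · filter_upwards [hr'] with w hw
    convert hw using 1
    · simp [_root_.jacobiEnd, sub_eq_add_neg]
    · simp [_root_.jacobiEnd, sub_eq_add_neg]

/-- Only the spray derivative of T contributes to leading order; the commutator with B is bilinear
in quantities perturbed at order k + 1. -/
theorem EqModPow.dynDeriv {h' h q : E × E → E} (sh : ContDiffAt ℝ ∞ h z)
    (sq : ContDiffAt ℝ ∞ q z) (hz : posFun l x₀ z = 0) (hkm : k + 1 ≤ m)
    (hq : ∀ᶠ w in 𝓝 z, h' w = h w + posFun l x₀ w ^ m • q w) {T' T : E × E → E →L[ℝ] E}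
    {y : E →L[ℝ] E} (sT : ContDiffAt ℝ ∞ T z) (hT : EqModPow (posFun l x₀) z (k + 1) T' T y) :
    EqModPow (posFun l x₀) z k (dynDeriv h' T') (dynDeriv h T)
      ((((k + 1 : ℕ) : ℝ) * l z.2) • y) := by
  have slam : ContDiffAt ℝ ∞ (posFun l x₀) z := contDiff_posFun.contDiffAt
  have sB : ContDiffAt ℝ ∞ (_root_.velDeriv h) z :=
    ContDiffAt.clm_comp (sh.fderiv_right (by simp)) contDiffAt_const
  obtain ⟨j, rfl⟩ := Nat.exists_eq_add_of_le hkm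
  have hB : ∃ b, EqModPow (posFun l x₀) z (k + 1) (_root_.velDeriv h') (_root_.velDeriv h) b := by
    have := EqModPow.velDeriv sh sq hq
    clear hq hkm
    obtain ⟨r, sr, -, hr⟩ := this
    refine ⟨_, fun w => posFun l x₀ w ^ j • r w, (slam.pow j).smul sr, rfl, ?_⟩
    filter_upwards [hr] with w hw
    rw [hw, pow_add, mul_smul]
  obtain ⟨b, hB⟩ := hB
  have hS := EqModPow.sprayDeriv sh sq hz hkm hq sT hT
  have hBT := EqModPow.bilin ((1 / 2 : ℝ) • (ContinuousLinearMap.compL ℝ E E E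
    - (ContinuousLinearMap.compL ℝ E E E).flip)) slam hz sB sT hB hT
  obtain ⟨r, sr, hr, hr'⟩ := hS.add hBT
  exact ⟨r, sr, by rw [hr, add_zero], hr'⟩

/-- The effect on the Jacobi endomorphism of adding a field that vanishes to first order on a
hyperplane in the position. -/
theorem curvature_perturb_one {h' h q : E × E → E} (sh : ContDiffAt ℝ ∞ h z)
    (sq : ContDiffAt ℝ ∞ q z) (hz : posFun l x₀ z = 0) (hl : l z.2 = 1) (hq0 : q z = 0)
    (hq : ∀ᶠ w in 𝓝 z, h' w = h w + posFun l x₀ w ^ 1 • q w) :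
    jacobiEnd h' z = jacobiEnd h z + (-(1 / 2) : ℝ) • velDeriv q z := by
  rw [(EqModPow.jacobiEnd (k := 0) sh sq hz hq).apply_eq, hq0, hl]
  congr 1
  ext e
  simp

/-- Adding a field that vanishes to second order on a hyperplane changes only the covariant
derivative of the Jacobi endomorphism. -/
theorem curvature_perturb_two {h' h q : E × E → E} {U : Set (E × E)} (hU : IsOpen U) (hzU : z ∈ U)
    (sh : ContDiffOn ℝ ∞ h U) (sq : ContDiffAt ℝ ∞ q z) (hz : posFun l x₀ z = 0)
    (hl : l z.2 = 1) (hq0 : q z = 0)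
    (hq : ∀ᶠ w in 𝓝 z, h' w = h w + posFun l x₀ w ^ 2 • q w) :
    jacobiEnd h' z = jacobiEnd h z ∧
    dynDeriv h' (jacobiEnd h') z = dynDeriv h (jacobiEnd h) z + (-1 : ℝ) • velDeriv q z := by
  have hn := hU.mem_nhds hzU
  have e1 := EqModPow.jacobiEnd (k := 1) (sh.contDiffAt hn) sq hz hq
  have e2 := EqModPow.dynDeriv (k := 0) (sh.contDiffAt hn) sq hz (by norm_num) hq
    ((sh.jacobiEnd hU).contDiffAt hn) e1
  refine ⟨e1.apply_eq_of_succ hz, ?_⟩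
  rw [e2.apply_eq, hq0, hl]
  congr 1
  ext e
  simp

/-- Adding a field that vanishes to third order on a hyperplane changes only the second covariant
derivative of the Jacobi endomorphism. -/
theorem curvature_perturb_three {h' h q : E × E → E} {U : Set (E × E)} (hU : IsOpen U)
    (hzU : z ∈ U) (sh : ContDiffOn ℝ ∞ h U) (sq : ContDiffAt ℝ ∞ q z) (hz : posFun l x₀ z = 0)
    (hl : l z.2 = 1) (hq0 : q z = 0)
    (hq : ∀ᶠ w in 𝓝 z, h' w = h w + posFun l x₀ w ^ 3 • q w) :
    jacobiEnd h' z = jacobiEnd h z ∧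
    dynDeriv h' (jacobiEnd h') z = dynDeriv h (jacobiEnd h) z ∧
    dynDeriv h' (dynDeriv h' (jacobiEnd h')) z =
      dynDeriv h (dynDeriv h (jacobiEnd h)) z + (-3 : ℝ) • velDeriv q z := by
  have hn := hU.mem_nhds hzU
  have s1 := sh.jacobiEnd hU
  have e1 := EqModPow.jacobiEnd (k := 2) (sh.contDiffAt hn) sq hz hq
  have e2 := EqModPow.dynDeriv (k := 1) (sh.contDiffAt hn) sq hz (by norm_num) hq
    (s1.contDiffAt hn) e1
  have e3 := EqModPow.dynDeriv (k := 0) (sh.contDiffAt hn) sq hz (by norm_num) hq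
    ((sh.dynDeriv s1 hU).contDiffAt hn) e2
  refine ⟨e1.apply_eq_of_succ hz, e2.apply_eq_of_succ hz, ?_⟩
  -- Each of the three operators lowers the power of λ by one and brings the exponent down as a
  -- factor: -½·3·2·1 = -3.
  rw [e3.apply_eq, hq0, hl]
  congr 1
  ext e
  simp
  module

end Spray

end Perturbation

/-! ### Transition maps and transport of vertical fields between charts -/

section Transition

variable {n : ℕ} {M : Type*} [TopologicalSpace M] [ChartedSpace (Coord n) M]

/-- The transition map between two charts. -/
def transition (φ ψ : atlas (Coord n) M) (x : Coord n) : Coord n := ψ.1 (φ.1.symm x)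

/-- The domain of the transition map. -/
def transitionDomain (φ ψ : atlas (Coord n) M) : Set (Coord n) :=
  φ.1.target ∩ φ.1.symm ⁻¹' ψ.1.source

theorem isOpen_transitionDomain (φ ψ : atlas (Coord n) M) : IsOpen (transitionDomain φ ψ) :=
  φ.1.isOpen_inter_preimage_symm ψ.1.open_source

theorem symm_transition {φ ψ : atlas (Coord n) M} {x : Coord n} (hx : x ∈ transitionDomain φ ψ) :
    ψ.1.symm (transition φ ψ x) = φ.1.symm x :=
  ψ.1.left_inv hx.2

theorem transition_mem_target {φ ψ : atlas (Coord n) M} {x : Coord n}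
    (hx : x ∈ transitionDomain φ ψ) : transition φ ψ x ∈ ψ.1.target :=
  ψ.1.map_source hx.2

theorem transition_transition {φ ψ χ : atlas (Coord n) M} {x : Coord n}
    (hx : x ∈ transitionDomain φ ψ) : transition ψ χ (transition φ ψ x) = transition φ χ x := by
  rw [transition, symm_transition hx, transition]

theorem transition_mem {φ ψ χ : atlas (Coord n) M} {x : Coord n}
    (hx : x ∈ transitionDomain φ ψ) (hx' : x ∈ transitionDomain φ χ) :
    transition φ ψ x ∈ transitionDomain ψ χ :=
  ⟨transition_mem_target hx, by rw [mem_preimage, symm_transition hx]; exact hx'.2⟩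

theorem mem_transitionDomain_self {φ : atlas (Coord n) M} {x : Coord n} (hx : x ∈ φ.1.target) :
    x ∈ transitionDomain φ φ :=
  ⟨hx, φ.1.map_target hx⟩

theorem transition_self {φ : atlas (Coord n) M} {x : Coord n} (hx : x ∈ φ.1.target) :
    transition φ φ x = x := φ.1.right_inv hx

theorem fderiv_transition_self {φ : atlas (Coord n) M} {x : Coord n} (hx : x ∈ φ.1.target) :
    fderiv ℝ (transition φ φ) x = ContinuousLinearMap.id ℝ (Coord n) := by
  have : transition φ φ =ᶠ[𝓝 x] id :=
    Filter.eventually_of_mem (φ.1.open_target.mem_nhds hx) fun y hy => transition_self hy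
  rw [this.fderiv_eq, fderiv_id]

open Classical in
/-- A vertical vector field given in the chart `φ₀`, seen in the chart `ψ`, extended by zero. -/
noncomputable def transport (φ₀ : atlas (Coord n) M) (b : Coord n × Coord n → Coord n)
    (ψ : atlas (Coord n) M) (z : Coord n × Coord n) : Coord n :=
  if z.1 ∈ transitionDomain ψ φ₀ then
    fderiv ℝ (transition φ₀ ψ) (transition ψ φ₀ z.1)
      (b (transition ψ φ₀ z.1, fderiv ℝ (transition ψ φ₀) z.1 z.2))
  else 0

variable {φ₀ : atlas (Coord n) M} {b : Coord n × Coord n → Coord n}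

theorem transport_self {z : Coord n × Coord n} (hz : z.1 ∈ φ₀.1.target) :
    transport φ₀ b φ₀ z = b z := by
  rw [transport, if_pos (mem_transitionDomain_self hz), transition_self hz,
    fderiv_transition_self hz]
  rfl

theorem transport_smul (hb : ∀ x v (lam : ℝ), 0 < lam → b (x, lam • v) = lam ^ 2 • b (x, v))
    (ψ : atlas (Coord n) M) (x v : Coord n) {lam : ℝ} (hlam : 0 < lam) :
    transport φ₀ b ψ (x, lam • v) = lam ^ 2 • transport φ₀ b ψ (x, v) := by
  unfold transport
  split_ifs with h
  · simp only [map_smul, hb _ _ _ hlam]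
  · simp

/-- The transported field vanishes off the support of the original one. -/
theorem transport_eq_zero {K : Set (Coord n)} (hbK : ∀ x v, x ∉ K → b (x, v) = 0)
    {ψ : atlas (Coord n) M} {z : Coord n × Coord n}
    (hz : ψ.1.symm z.1 ∉ φ₀.1.symm '' K) : transport φ₀ b ψ z = 0 := by
  unfold transport
  split_ifs with h
  · rw [hbK, map_zero]
    intro hK
    exact hz ⟨_, hK, by rw [symm_transition h]⟩
  · rfl

variable [IsManifold (𝓡 (n + 1)) ∞ M]

theorem contDiffOn_transition (φ ψ : atlas (Coord n) M) :
    ContDiffOn ℝ ∞ (transition φ ψ) (transitionDomain φ ψ) := by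
  have h := HasGroupoid.compatible (G := contDiffGroupoid ∞ (𝓡 (n + 1))) φ.2 ψ.2
  rw [contDiffGroupoid, mem_groupoid_of_pregroupoid] at h
  have h2 := h.1
  simp only [contDiffPregroupoid, OpenPartialHomeomorph.trans_source, modelWithCornersSelf_coe,
    modelWithCornersSelf_coe_symm, Function.id_comp, Function.comp_id, preimage_id_eq, id_eq,
    range_id, inter_univ, OpenPartialHomeomorph.symm_source] at h2
  exact h2

theorem hasFDerivAt_transition {φ ψ : atlas (Coord n) M} {x : Coord n}
    (hx : x ∈ transitionDomain φ ψ) :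
    HasFDerivAt (transition φ ψ) (fderiv ℝ (transition φ ψ) x) x :=
  (((contDiffOn_transition φ ψ).contDiffAt
    ((isOpen_transitionDomain φ ψ).mem_nhds hx)).differentiableAt (by simp)).hasFDerivAt

theorem fderiv_transition_comp {φ ψ χ : atlas (Coord n) M} {x : Coord n}
    (hx : x ∈ transitionDomain φ ψ) (hx' : x ∈ transitionDomain φ χ) (v : Coord n) :
    fderiv ℝ (transition ψ χ) (transition φ ψ x) (fderiv ℝ (transition φ ψ) x v) =
      fderiv ℝ (transition φ χ) x v := by
  have h := (hasFDerivAt_transition (transition_mem hx hx')).comp x (hasFDerivAt_transition hx)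
  have ev : transition φ χ =ᶠ[𝓝 x] transition ψ χ ∘ transition φ ψ :=
    Filter.eventually_of_mem ((isOpen_transitionDomain φ ψ).mem_nhds hx)
      fun y hy => (transition_transition hy).symm
  rw [ev.fderiv_eq, h.fderiv]
  rfl

/-- Over the overlap of the charts this is a composition of smooth maps. A base point outside the
overlap is not in the image of K, which is compact and hence closed in the Hausdorff space M; so the
field is zero in a neighbourhood. -/
theorem contDiffOn_transport [T2Space M] {K : Set (Coord n)} (hb : ContDiff ℝ ∞ b)
    (hK : IsCompact K) (hKφ : K ⊆ φ₀.1.target) (hbK : ∀ x v, x ∉ K → b (x, v) = 0)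
    (ψ : atlas (Coord n) M) : ContDiffOn ℝ ∞ (transport φ₀ b ψ) (slitTangent ψ.1) := by
  intro z hz
  refine ContDiffAt.contDiffWithinAt ?_
  by_cases h : z.1 ∈ transitionDomain ψ φ₀
  · set O : Set (Coord n × Coord n) := Prod.fst ⁻¹' transitionDomain ψ φ₀ with hO
    have hOo : IsOpen O := (isOpen_transitionDomain ψ φ₀).preimage continuous_fst
    have s1 : ContDiffOn ℝ ∞ (fun w : Coord n × Coord n => transition ψ φ₀ w.1) O :=
      (contDiffOn_transition ψ φ₀).comp contDiffOn_fst fun w hw => hw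
    have s2 : ContDiffOn ℝ ∞ (fun w : Coord n × Coord n => fderiv ℝ (transition ψ φ₀) w.1 w.2) O :=
      (((contDiffOn_transition ψ φ₀).fderiv_infty (isOpen_transitionDomain ψ φ₀)).comp
        contDiffOn_fst fun w hw => hw).clm_apply contDiffOn_snd
    have s3 : ContDiffOn ℝ ∞ (fun w : Coord n × Coord n =>
        fderiv ℝ (transition φ₀ ψ) (transition ψ φ₀ w.1)) O :=
      ((contDiffOn_transition φ₀ ψ).fderiv_infty (isOpen_transitionDomain φ₀ ψ)).comp s1
        fun w hw => transition_mem hw (mem_transitionDomain_self hw.1)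
    have s4 := s3.clm_apply (hb.comp_contDiffOn (s1.prodMk s2))
    have : ContDiffOn ℝ ∞ (transport φ₀ b ψ) O := s4.congr fun w hw => by
      rw [transport, if_pos (show w.1 ∈ transitionDomain ψ φ₀ from hw)]
      rfl
    exact this.contDiffAt (hOo.mem_nhds h)
  · have hcl : IsClosed (φ₀.1.symm '' K) :=
      (hK.image_of_continuousOn (φ₀.1.continuousOn_symm.mono hKφ)).isClosed
    have hnot : ψ.1.symm z.1 ∉ φ₀.1.symm '' K := by
      rintro ⟨x, hx, hxz⟩
      exact h ⟨hz.1, by rw [mem_preimage, ← hxz]; exact φ₀.1.map_target (hKφ hx)⟩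
    have ev : transport φ₀ b ψ =ᶠ[𝓝 z] fun _ => 0 := by
      have hO := (ψ.1.isOpen_inter_preimage_symm hcl.isOpen_compl).preimage
        (continuous_fst : Continuous (Prod.fst : Coord n × Coord n → Coord n))
      filter_upwards [hO.mem_nhds ⟨hz.1, hnot⟩] with w hw
      exact transport_eq_zero hbK hw.2
    exact contDiffAt_const.congr_of_eventuallyEq ev

/-- Vertical fields transform linearly, without the second-derivative term that h itself acquires.
This is why adding one to a path structure keeps the systems in different charts compatible. -/
theorem transport_transition {φ ψ : atlas (Coord n) M} {x : Coord n}
    (hx : x ∈ transitionDomain φ ψ) (v : Coord n) :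
    transport φ₀ b ψ (transition φ ψ x, fderiv ℝ (transition φ ψ) x v) =
      fderiv ℝ (transition φ ψ) x (transport φ₀ b φ (x, v)) := by
  have hxx := mem_transitionDomain_self hx.1
  by_cases h : x ∈ transitionDomain φ φ₀
  · have h' : transition φ ψ x ∈ transitionDomain ψ φ₀ := transition_mem hx h
    have h0 : transition φ φ₀ x ∈ transitionDomain φ₀ φ := transition_mem h hxx
    have h0' : transition φ φ₀ x ∈ transitionDomain φ₀ ψ := transition_mem h hx
    rw [transport, transport, if_pos h', if_pos h]
    simp only
    rw [transition_transition hx, fderiv_transition_comp hx h]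
    have := fderiv_transition_comp h0 h0' (b (transition φ φ₀ x, fderiv ℝ (transition φ φ₀) x v))
    rw [transition_transition h, transition_self hx.1] at this
    exact this.symm
  · have h' : transition φ ψ x ∉ transitionDomain ψ φ₀ := fun h' => h ⟨hx.1, by
      have := h'.2
      rwa [mem_preimage, symm_transition hx] at this⟩
    rw [transport, transport, if_neg h', if_neg h, map_zero]

end Transition

/-! ### Velocity and acceleration under a change of coordinates -/

section SecondDerivative

variable {E F : Type*} [NormedAddCommGroup E] [NormedSpace ℝ E] [NormedAddCommGroup F]
  [NormedSpace ℝ F]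

theorem deriv_comp_curve {τ : E → F} {c : ℝ → E} {t : ℝ} (hτ : ContDiffAt ℝ ∞ τ (c t))
    (hc : ContDiffAt ℝ ∞ c t) : deriv (fun s => τ (c s)) t = fderiv ℝ τ (c t) (deriv c t) :=
  ((hτ.differentiableAt (by simp)).hasFDerivAt.comp_hasDerivAt t
    (hc.differentiableAt (by simp)).hasDerivAt).deriv

theorem iteratedDeriv_two_comp_curve {τ : E → F} {c : ℝ → E} {t : ℝ}
    (hτ : ContDiffAt ℝ ∞ τ (c t)) (hc : ContDiffAt ℝ ∞ c t) :
    iteratedDeriv 2 (fun s => τ (c s)) t = fderiv ℝ (fderiv ℝ τ) (c t) (deriv c t) (deriv c t)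
      + fderiv ℝ τ (c t) (iteratedDeriv 2 c t) := by
  have ev : deriv (fun s => τ (c s)) =ᶠ[𝓝 t] fun s => fderiv ℝ τ (c s) (deriv c s) := by
    filter_upwards [hc.continuousAt.eventually (eventually_hasFDerivAt hτ),
      eventually_hasFDerivAt hc] with s h1 h2
    exact (h1.comp_hasDerivAt s h2.differentiableAt.hasDerivAt).deriv
  have h2 : ContDiffAt ℝ ∞ (deriv c) t := by
    have h1 : ContDiffAt ℝ ∞ (fderiv ℝ c) t := hc.fderiv_right (by simp)
    exact h1.clm_apply contDiffAt_const
  have hd : DifferentiableAt ℝ (fderiv ℝ τ) (c t) :=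
    (hτ.fderiv_right (m := ∞) (by simp)).differentiableAt (by simp)
  have h3 : HasDerivAt (fun s => fderiv ℝ τ (c s))
      (fderiv ℝ (fderiv ℝ τ) (c t) (deriv c t)) t :=
    hd.hasFDerivAt.comp_hasDerivAt t (hc.differentiableAt (by simp)).hasDerivAt
  have h4 := h3.clm_apply (h2.differentiableAt (by simp)).hasDerivAt
  simp only [iteratedDeriv_succ, iteratedDeriv_zero]
  rw [ev.deriv_eq]
  exact h4.deriv

end SecondDerivative

/-! ### Compactly supported perturbations of a path structure -/

section Perturb

variable {n : ℕ} {M : Type*} [TopologicalSpace M] [T2Space M] [ChartedSpace (Coord n) M]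
  [IsManifold (𝓡 (n + 1)) ∞ M]

/-- Adding a vertical vector field with compact support in a chart to a path structure. -/
noncomputable def PathStructure.perturb (P : PathStructure n M) (φ₀ : atlas (Coord n) M)
    {b : Coord n × Coord n → Coord n} (hb : ContDiff ℝ ∞ b)
    (hhom : ∀ x v (lam : ℝ), 0 < lam → b (x, lam • v) = lam ^ 2 • b (x, v))
    {K : Set (Coord n)} (hK : IsCompact K) (hKφ : K ⊆ φ₀.1.target)
    (hbK : ∀ x v, x ∉ K → b (x, v) = 0) (s : ℝ) : PathStructure n M where
  h φ z := P.h φ z + s • transport φ₀ b φ z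
  smooth φ := (P.smooth φ).add ((contDiffOn_transport hb hK hKφ hbK φ).const_smul s)
  homogeneous φ x hx v hv lam hlam := by
    rw [P.homogeneous φ x hx v hv lam hlam, transport_smul hhom φ x v hlam, smul_add,
      smul_comm]
  compatible φ ψ c t hc hct hcs hne := by
    set x := c t with hx_def
    have hx : x ∈ transitionDomain φ ψ := ⟨hct, hcs⟩
    set v := deriv c t with hv_def
    set w := s • transport φ₀ b φ (x, v) with hw
    -- The curve c₁ = c + p has the same position and velocity as c at time t, and its acceleration
    -- is shifted by w. Hence c solves the perturbed system at t exactly when c₁ solves the original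
    -- one, and compatibility of `P` is applied to c₁.
    set p : ℝ → Coord n := fun u => ((u - t) ^ 2 / 2) • w with hp
    have hps : ContDiff ℝ ∞ p := by fun_prop
    have hpd : ∀ u, HasDerivAt p ((u - t) • w) u := fun u => by
      have h := ((((hasDerivAt_id u).sub_const t).pow 2).div_const 2).smul_const w
      refine HasDerivAt.congr_deriv (f := p) h ?_
      simp
    have hp1 : deriv p = fun u => (u - t) • w := funext fun u => (hpd u).deriv
    have hp2 : iteratedDeriv 2 p t = w := by
      simp only [iteratedDeriv_succ, iteratedDeriv_zero]
      rw [hp1]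
      simpa using (((hasDerivAt_id t).sub_const t).smul_const w).deriv
    set c₁ : ℝ → Coord n := fun u => c u + p u with hc₁
    have hc₁s : ContDiffAt ℝ ∞ c₁ t := hc.add hps.contDiffAt
    have hc₁t : c₁ t = x := by simp [hc₁, hp, hx_def]
    have hc₁d : deriv c₁ t = v := by
      rw [hc₁, deriv_fun_add (hc.differentiableAt (by simp)) (hpd t).differentiableAt, hp1]
      simp [hv_def]
    have hc₁2 : iteratedDeriv 2 c₁ t = iteratedDeriv 2 c t + w := by
      have := iteratedDeriv_fun_add (n := 2) (hc.of_le ENat.LEInfty.out)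
        (hps.contDiffAt (x := t) |>.of_le ENat.LEInfty.out)
      rw [hc₁, this, hp2]
    have hτ : ContDiffAt ℝ ∞ (transition φ ψ) x :=
      (contDiffOn_transition φ ψ).contDiffAt ((isOpen_transitionDomain φ ψ).mem_nhds hx)
    have key := P.compatible φ ψ c₁ t hc₁s (by rw [hc₁t]; exact hct) (by rw [hc₁t]; exact hcs)
      (by rw [hc₁d]; exact hne)
    have e1 : SolvesAt (fun z => P.h φ z + s • transport φ₀ b φ z) c t ↔
        SolvesAt (P.h φ) c₁ t := by
      simp only [SolvesAt, hc₁t, hc₁d, hc₁2]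
      rw [← hx_def, ← hv_def, ← hw]
      simp only [add_assoc, add_comm w]
    have d1 : deriv (fun u => transition φ ψ (c u)) t = fderiv ℝ (transition φ ψ) x v :=
      deriv_comp_curve hτ hc
    have d2 : deriv (fun u => transition φ ψ (c₁ u)) t = fderiv ℝ (transition φ ψ) x v := by
      rw [deriv_comp_curve (by rwa [hc₁t]) hc₁s, hc₁t, hc₁d]
    -- The quadratic term of the transformed acceleration depends on position and velocity only and
    -- is common to both curves; the shift w is mapped by the differential of the transition map.
    have d3 : iteratedDeriv 2 (fun u => transition φ ψ (c₁ u)) t =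
        iteratedDeriv 2 (fun u => transition φ ψ (c u)) t
          + s • transport φ₀ b ψ (transition φ ψ x, fderiv ℝ (transition φ ψ) x v) := by
      rw [iteratedDeriv_two_comp_curve (by rwa [hc₁t]) hc₁s, iteratedDeriv_two_comp_curve hτ hc,
        hc₁t, hc₁d, hc₁2, transport_transition hx, map_add, hw, map_smul, add_assoc]
    have e2 : SolvesAt (fun z => P.h ψ z + s • transport φ₀ b ψ z)
        (fun u => transition φ ψ (c u)) t ↔
        SolvesAt (P.h ψ) (fun u => transition φ ψ (c₁ u)) t := by
      simp only [SolvesAt, d1, d2, d3, hc₁t]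
      rw [← hx_def]
      simp only [add_assoc, add_comm (s • _)]
    exact e1.trans (key.trans e2.symm)

end Perturb

/-! ### Small compactly supported perturbations in the strong topology -/

section StrongConvergence

open Filter

/-- The part of a vertical vector field that is orthogonal to the velocity. -/
noncomputable def normalPart {n : ℕ} (b : Coord n × Coord n → Coord n) (z : Coord n × Coord n) :
    Coord n :=
  b z - (inner ℝ z.2 (b z) / ‖z.2‖ ^ 2) • z.2

theorem ContDiffOn.normalPart {n : ℕ} {b : Coord n × Coord n → Coord n}
    {U : Set (Coord n × Coord n)} (hb : ContDiffOn ℝ ∞ b U) (hU : ∀ z ∈ U, z.2 ≠ 0) :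
    ContDiffOn ℝ ∞ (normalPart b) U :=
  hb.sub (ContDiffOn.smul (ContDiffOn.div (contDiffOn_snd.inner ℝ hb)
    ((contDiffOn_snd.norm ℝ hU).pow 2) fun z hz => pow_ne_zero 2 (norm_ne_zero_iff.2 (hU z hz)))
    contDiffOn_snd)

theorem continuousAt_iteratedFDeriv_of_contDiffOn {E F : Type*} [NormedAddCommGroup E]
    [NormedSpace ℝ E] [NormedAddCommGroup F] [NormedSpace ℝ F] {f : E → F} {U : Set E}
    (hU : IsOpen U) (hf : ContDiffOn ℝ ∞ f U) (j : ℕ) {z : E} (hz : z ∈ U) :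
    ContinuousAt (iteratedFDeriv ℝ j f) z :=
  ((hf.contDiffAt (hU.mem_nhds hz)).iteratedFDeriv_right (m := 0) (i := j)
    (by rw [zero_add]; exact_mod_cast le_top)).continuousAt

variable {n : ℕ} {M : Type*} [TopologicalSpace M] [T2Space M] [ChartedSpace (Coord n) M]
  [IsManifold (𝓡 (n + 1)) ∞ M] {φ₀ : atlas (Coord n) M} {b : Coord n × Coord n → Coord n}
  (hb : ContDiff ℝ ∞ b)
  (hhom : ∀ x v (lam : ℝ), 0 < lam → b (x, lam • v) = lam ^ 2 • b (x, v))
  {K : Set (Coord n)} (hK : IsCompact K) (hKφ : K ⊆ φ₀.1.target)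
  (hbK : ∀ x v, x ∉ K → b (x, v) = 0)

theorem PathStructure.normal_perturb (P : PathStructure n M) (s : ℝ) (φ : atlas (Coord n) M)
    (z : Coord n × Coord n) : (P.perturb φ₀ hb hhom hK hKφ hbK s).normal φ z =
      P.normal φ z + s • normalPart (transport φ₀ b φ) z := by
  simp only [PathStructure.normal, PathStructure.perturb, normalPart, inner_add_right,
    real_inner_smul_right, smul_sub, add_div, add_smul, mul_div_assoc, mul_smul]
  abel

/-- The strict bound holds at s = 0 on the compact set of unit vectors over C. The derivatives
depend jointly continuously on s and the point, so the bound persists for small s. -/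
theorem CkClose.eventually_perturb {k : ℕ} {φ : atlas (Coord n) M} {C : Set M} {ε : ℝ}
    (hC : IsCompact C) (hCφ : C ⊆ φ.1.source) {P₀ P : PathStructure n M}
    (h : CkClose k φ C ε P₀ P) :
    ∀ᶠ s in 𝓝 (0 : ℝ), CkClose k φ C ε P₀ (P.perturb φ₀ hb hhom hK hKφ hbK s) := by
  have hU := isOpen_slitTangent φ.1
  set D : Coord n × Coord n → Coord n := fun z => P.normal φ z - P₀.normal φ z with hD
  set B := normalPart (transport φ₀ b φ) with hB
  have sD : ContDiffOn ℝ ∞ D (slitTangent φ.1) :=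
    (P.contDiffOn_normal φ).sub (P₀.contDiffOn_normal φ)
  have sB : ContDiffOn ℝ ∞ B (slitTangent φ.1) :=
    (contDiffOn_transport hb hK hKφ hbK φ).normalPart fun z hz => hz.2
  set Z : Set (Coord n × Coord n) := (φ.1 '' C) ×ˢ Metric.sphere 0 1 with hZ
  have hZc : IsCompact Z :=
    (hC.image_of_continuousOn (φ.1.continuousOn.mono hCφ)).prod (isCompact_sphere 0 1)
  have hZU : Z ⊆ slitTangent φ.1 := by
    rintro ⟨x, v⟩ ⟨⟨p, hp, rfl⟩, hv⟩
    refine ⟨φ.1.map_source (hCφ hp), fun h0 => ?_⟩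
    rw [show v = 0 from h0] at hv
    simp at hv
  have key : ∀ j ≤ k, ∀ᶠ s in 𝓝 (0 : ℝ), ∀ z ∈ Z,
      ‖iteratedFDeriv ℝ j D z + s • iteratedFDeriv ℝ j B z‖ < ε := fun j hj => by
    refine hZc.eventually_forall_of_forall_eventually fun z hz => ?_
    have c1 : ContinuousAt (fun p : ℝ × (Coord n × Coord n) =>
        ‖iteratedFDeriv ℝ j D p.2 + p.1 • iteratedFDeriv ℝ j B p.2‖) (0, z) := by
      have cD : ContinuousAt (fun p : ℝ × (Coord n × Coord n) => iteratedFDeriv ℝ j D p.2) (0, z) :=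
        ContinuousAt.comp (f := Prod.snd)
          (continuousAt_iteratedFDeriv_of_contDiffOn hU sD j (hZU hz)) continuousAt_snd
      have cB : ContinuousAt (fun p : ℝ × (Coord n × Coord n) => iteratedFDeriv ℝ j B p.2) (0, z) :=
        ContinuousAt.comp (f := Prod.snd)
          (continuousAt_iteratedFDeriv_of_contDiffOn hU sB j (hZU hz)) continuousAt_snd
      exact (cD.add (continuousAt_fst.smul cB)).norm
    refine c1.eventually (gt_mem_nhds ?_)
    obtain ⟨⟨p, hp, hpz⟩, hv⟩ := hz
    have := h p hp z.2 (by simpa using hv) j hj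
    simp only [zero_smul, add_zero]
    rwa [hpz] at this
  have key' : ∀ᶠ s in 𝓝 (0 : ℝ), ∀ j ∈ Iic k, ∀ z ∈ Z,
      ‖iteratedFDeriv ℝ j D z + s • iteratedFDeriv ℝ j B z‖ < ε :=
    (eventually_all_finite (finite_Iic k)).2 key
  filter_upwards [key'] with s hs p hp v hv j hj
  have hz : (φ.1 p, v) ∈ Z := ⟨⟨p, hp, rfl⟩, by simpa using hv⟩
  have e : (fun z => (P.perturb φ₀ hb hhom hK hKφ hbK s).normal φ z - P₀.normal φ z) =
      D + s • B := by
    funext z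
    simp only [PathStructure.normal_perturb, hD, hB, Pi.add_apply, Pi.smul_apply]
    abel
  have cD : ContDiffAt ℝ j D (φ.1 p, v) :=
    (sD.contDiffAt (hU.mem_nhds (hZU hz))).of_le (by exact_mod_cast le_top)
  have cB : ContDiffAt ℝ j B (φ.1 p, v) :=
    (sB.contDiffAt (hU.mem_nhds (hZU hz))).of_le (by exact_mod_cast le_top)
  have csB : ContDiffAt ℝ j (s • B) (φ.1 p, v) := cB.const_smul s
  rw [e, iteratedFDeriv_add_apply cD csB, iteratedFDeriv_const_smul_apply cB]
  exact hs j hj _ hz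

/-- The image of K is closed, so near every point of C the perturbation is identically zero and no
derivative changes. -/
theorem CkClose.perturb_of_disjoint {k : ℕ} {φ : atlas (Coord n) M} {C : Set M} {ε : ℝ}
    (hCφ : C ⊆ φ.1.source) {P₀ P : PathStructure n M} (h : CkClose k φ C ε P₀ P)
    (hCK : ¬ (C ∩ φ₀.1.symm '' K).Nonempty) (s : ℝ) :
    CkClose k φ C ε P₀ (P.perturb φ₀ hb hhom hK hKφ hbK s) := by
  intro p hp v hv j hj
  have hcl : IsClosed (φ₀.1.symm '' K) :=
    (hK.image_of_continuousOn (φ₀.1.continuousOn_symm.mono hKφ)).isClosed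
  have hO := (φ.1.isOpen_inter_preimage_symm hcl.isOpen_compl).preimage
    (continuous_fst : Continuous (Prod.fst : Coord n × Coord n → Coord n))
  have hmem : (φ.1 p, v) ∈ Prod.fst ⁻¹' (φ.1.target ∩ φ.1.symm ⁻¹' (φ₀.1.symm '' K)ᶜ) := by
    refine ⟨φ.1.map_source (hCφ hp), ?_⟩
    simp only [mem_preimage, φ.1.left_inv (hCφ hp)]
    exact fun hpK => hCK ⟨p, hp, hpK⟩
  have ev : (fun z => (P.perturb φ₀ hb hhom hK hKφ hbK s).normal φ z - P₀.normal φ z)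
      =ᶠ[𝓝 (φ.1 p, v)] fun z => P.normal φ z - P₀.normal φ z := by
    filter_upwards [hO.mem_nhds hmem] with z hz
    rw [PathStructure.normal_perturb, normalPart, transport_eq_zero hbK hz.2]
    simp
  rw [(ev.iteratedFDeriv ℝ j).eq_of_nhds]
  exact h p hp v hv j hj

/-- Small perturbations with compact support are small in the strong topology. -/
theorem PathStructure.tendsto_perturb (P : PathStructure n M) (k : ℕ) :
    Tendsto (fun s => P.perturb φ₀ hb hhom hK hKφ hbK s) (𝓝 0)
      (@nhds _ (strongTopology n M k) P) := by
  rw [TopologicalSpace.tendsto_nhds_generateFrom_iff]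
  rintro N ⟨P₀, φ, C, ε, hlf, hC, rfl⟩ hP
  -- By local finiteness only finitely many of the sets `C i` meet the compact support. The
  -- conditions on the others hold for every `s`.
  have hfin := hlf.finite_nonempty_inter_compact
    (hK.image_of_continuousOn (φ₀.1.continuousOn_symm.mono hKφ))
  have h1 := (eventually_all_finite hfin).2 fun i _ =>
    CkClose.eventually_perturb hb hhom hK hKφ hbK (hC i).1 (hC i).2.1 (hP i)
  filter_upwards [h1] with s hs i
  by_cases hi : (C i ∩ φ₀.1.symm '' K).Nonempty
  · exact hs i hi
  · exact CkClose.perturb_of_disjoint hb hhom hK hKφ hbK (hC i).2.1 (hP i) hi s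

end StrongConvergence

/-! ### Matrix units, quadratic fields and density in the strong topology -/

section Density

open Filter InnerProductSpace

section Trace

variable {E : Type*} [NormedAddCommGroup E] [NormedSpace ℝ E]

theorem traceComm_add_smul_left (X X' Y Z : E →L[ℝ] E) (s : ℝ) :
    traceComm (X + s • X') Y Z = traceComm X Y Z + s * traceComm X' Y Z := by
  simp only [traceComm, ContinuousLinearMap.add_comp, ContinuousLinearMap.smul_comp,
    ContinuousLinearMap.toLinearMap_add, ContinuousLinearMap.toLinearMap_smul, map_add, map_smul,
    smul_eq_mul]

theorem traceComm_add_smul_mid (X Y Y' Z : E →L[ℝ] E) (s : ℝ) :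
    traceComm X (Y + s • Y') Z = traceComm X Y Z + s * traceComm X Y' Z := by
  have : X.comp ((Y + s • Y').comp Z - Z.comp (Y + s • Y')) =
      X.comp (Y.comp Z - Z.comp Y) + s • X.comp (Y'.comp Z - Z.comp Y') := by
    ext v
    simp only [ContinuousLinearMap.comp_apply, sub_apply,
      add_apply, smul_apply, map_add, map_smul, map_sub]
    module
  simp only [traceComm, this, ContinuousLinearMap.toLinearMap_add,
    ContinuousLinearMap.toLinearMap_smul, map_add, map_smul, smul_eq_mul]

theorem traceComm_add_smul_right (X Y Z Z' : E →L[ℝ] E) (s : ℝ) :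
    traceComm X Y (Z + s • Z') = traceComm X Y Z + s * traceComm X Y Z' := by
  have : X.comp (Y.comp (Z + s • Z') - (Z + s • Z').comp Y) =
      X.comp (Y.comp Z - Z.comp Y) + s • X.comp (Y.comp Z' - Z'.comp Y) := by
    ext v
    simp only [ContinuousLinearMap.comp_apply, sub_apply,
      add_apply, smul_apply, map_add, map_smul, map_sub]
    module
  simp only [traceComm, this, ContinuousLinearMap.toLinearMap_add,
    ContinuousLinearMap.toLinearMap_smul, map_add, map_smul, smul_eq_mul]

/-- The product (u⊗v)(v⊗u)(u⊗u) collapses to ‖v‖² u⊗u, while (u⊗v)(u⊗u)(v⊗u) contains the factor ⟨v,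
u⟩ = 0. -/
theorem traceComm_rankOne {E : Type*} [NormedAddCommGroup E] [InnerProductSpace ℝ E]
    [FiniteDimensional ℝ E] {u v : E} (hu : ‖u‖ = 1) (huv : inner ℝ u v = 0) :
    traceComm (rankOne ℝ u v) (rankOne ℝ v u) (rankOne ℝ u u) = ‖v‖ ^ 2 := by
  have : (rankOne ℝ u v).comp ((rankOne ℝ v u).comp (rankOne ℝ u u) -
      (rankOne ℝ u u).comp (rankOne ℝ v u)) = ‖v‖ ^ 2 • rankOne ℝ u u := by
    ext w
    simp [rankOne_apply, huv, hu, smul_smul]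
    ring_nf
  rw [traceComm, this]
  simp [trace_rankOne, hu]

end Trace

section VerticalField

variable {E : Type*} [NormedAddCommGroup E] [InnerProductSpace ℝ E]

/-- The quadratic vertical field that is orthogonal to the velocity and, at the velocity `u`, has
the vertical derivative `N`. -/
noncomputable def quadraticField (u : E) (N : E →L[ℝ] E) (v : E) : E :=
  (inner ℝ u v : ℝ) • N v - (inner ℝ v (N v) : ℝ) • u

variable {u : E} {N : E →L[ℝ] E}

theorem contDiff_quadraticField : ContDiff ℝ ∞ (quadraticField u N) := by
  unfold quadraticField
  have h1 : ContDiff ℝ ∞ fun v => N v := N.contDiff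
  exact ((contDiff_const.inner ℝ contDiff_id).smul h1).sub
    ((contDiff_id.inner ℝ h1).smul contDiff_const)

theorem quadraticField_smul (v : E) (lam : ℝ) :
    quadraticField u N (lam • v) = lam ^ 2 • quadraticField u N v := by
  simp only [quadraticField, map_smul, real_inner_smul_left, real_inner_smul_right]
  module

/-- Because of this orthogonality, passing to the normalized representative leaves the added field
unchanged. -/
theorem inner_quadraticField (v : E) : inner ℝ v (quadraticField u N v) = 0 := by
  simp only [quadraticField, inner_sub_right, real_inner_smul_right, real_inner_comm u v]
  ring

theorem quadraticField_self (hN : N u = 0) : quadraticField u N u = 0 := by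
  simp [quadraticField, hN]

/-- The product rule at u gives N plus terms containing N u or ⟨u, N v⟩, all of which vanish by
assumption. -/
theorem fderiv_quadraticField (hu : ‖u‖ = 1) (hN : N u = 0) (hN' : ∀ v, inner ℝ u (N v) = 0) :
    fderiv ℝ (quadraticField u N) u = N := by
  have h1 : HasFDerivAt (fun v => N v) N u := N.hasFDerivAt
  have h2 := (((hasFDerivAt_const u u).inner ℝ (hasFDerivAt_id u)).smul h1).sub
    (((hasFDerivAt_id u).inner ℝ h1).smul (hasFDerivAt_const u u))
  refine (HasFDerivAt.fderiv (f := quadraticField u N) h2).trans ?_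
  ext v
  simp [hN, hN', hu]

end VerticalField

variable {n : ℕ} {M : Type*} [TopologicalSpace M] [T2Space M] [ChartedSpace (Coord n) M]
  [IsManifold (𝓡 (n + 1)) ∞ M]

/-- In every strong neighbourhood, a path structure can be deformed near a point by a multiple `s`
of a quadratic field that vanishes to a given order on a hyperplane, where `s` can be chosen so
that a given nonconstant affine function of `s` is nonzero. -/
theorem exists_perturb_mem {k : ℕ} (φ : atlas (Coord n) M) {x₀ : Coord n} (hx : x₀ ∈ φ.1.target)
    (u : Coord n) (N : Coord n →L[ℝ] Coord n) (m : ℕ)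
    {O : Set (PathStructure n M)} (hO : IsOpen[strongTopology n M k] O)
    {P : PathStructure n M} (hP : P ∈ O) (a : ℝ) {c : ℝ} (hc : c ≠ 0) :
    ∃ P' ∈ O, ∃ s : ℝ, a + s * c ≠ 0 ∧ ∀ᶠ w in 𝓝 (x₀, u),
      P'.normal φ w = P.normal φ w +
        posFun (innerSL ℝ u) x₀ w ^ m • (s • quadraticField u N w.2) := by
  obtain ⟨χ, hχ, hχc, hχt, hχ1⟩ := exists_bump_eventuallyEq_one φ.1.open_target hx
  let b : Coord n × Coord n → Coord n := fun z =>
    (χ z.1 * innerSL ℝ u (z.1 - x₀) ^ m) • quadraticField u N z.2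
  have hb : ContDiff ℝ ∞ b := by
    have h1 : ContDiff ℝ ∞ fun z : Coord n × Coord n => innerSL ℝ u (z.1 - x₀) :=
      (innerSL ℝ u).contDiff.comp (contDiff_fst.sub contDiff_const)
    exact ((hχ.comp contDiff_fst).mul (h1.pow m)).smul (contDiff_quadraticField.comp contDiff_snd)
  have hhom : ∀ x v (lam : ℝ), 0 < lam → b (x, lam • v) = lam ^ 2 • b (x, v) := fun x v lam _ => by
    simp only [b, quadraticField_smul]
    rw [smul_comm]
  have hbK : ∀ x v, x ∉ tsupport χ → b (x, v) = 0 := fun x v hx => by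
    simp [b, image_eq_zero_of_notMem_tsupport hx]
  have ht := P.tendsto_perturb hb hhom hχc.isCompact hχt hbK k
  have hev := ht (@IsOpen.mem_nhds _ (strongTopology n M k) P O hO hP)
  obtain ⟨δ, hδ, hball⟩ := Metric.mem_nhds_iff.1 hev
  -- Arbitrarily small `s` is available: `s = 0` if `a ≠ 0`, and any small nonzero `s` otherwise.
  obtain ⟨s, hs, hsa⟩ : ∃ s ∈ Metric.ball (0 : ℝ) δ, a + s * c ≠ 0 := by
    by_cases ha : a = 0
    · refine ⟨δ / 2, ?_, ?_⟩
      · rw [mem_ball_zero_iff, Real.norm_of_nonneg (by positivity)]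
        linarith
      · rw [ha, zero_add]
        positivity
    · exact ⟨0, Metric.mem_ball_self hδ, by simpa using ha⟩
  refine ⟨_, hball hs, s, hsa, ?_⟩
  have e1 : ∀ᶠ w : Coord n × Coord n in 𝓝 (x₀, u), χ w.1 = 1 :=
    (continuousAt_fst (p := (x₀, u))).eventually hχ1
  have e2 : ∀ᶠ w : Coord n × Coord n in 𝓝 (x₀, u), w.1 ∈ φ.1.target :=
    (continuousAt_fst (p := (x₀, u))).eventually (φ.1.open_target.mem_nhds hx)
  filter_upwards [e1, e2] with w h1 h2
  rw [PathStructure.normal_perturb, normalPart, transport_self h2]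
  simp only [b, h1, real_inner_smul_right, inner_quadraticField, one_mul, mul_zero, zero_div,
    zero_smul, sub_zero, posFun]
  rw [smul_comm]

/-- The structures with nonzero obstruction at a given tangent vector are dense. -/
theorem dense_obstruction_ne_zero (hn : 2 ≤ n) (k : ℕ) (φ : atlas (Coord n) M) {x₀ : Coord n}
    (hx : x₀ ∈ φ.1.target) :
    @Dense _ (strongTopology n M k)
      {P : PathStructure n M | obstruction (P.normal φ) (x₀, EuclideanSpace.single 0 1) ≠ 0} := by
  have hin : ∀ i j : Fin (n + 1), i ≠ j →
      inner ℝ (EuclideanSpace.single i 1 : Coord n) (EuclideanSpace.single j 1) = 0 :=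
    fun i j h => by simp [EuclideanSpace.inner_single_left, h]
  set u : Coord n := EuclideanSpace.single 0 1
  let e : Coord n := EuclideanSpace.single ⟨1, by omega⟩ 1
  let f : Coord n := EuclideanSpace.single ⟨2, by omega⟩ 1
  have hu : ‖u‖ = 1 := by simp [u]
  have hue : inner ℝ u e = 0 := hin _ _ (by simp [Fin.ext_iff])
  have huf : inner ℝ u f = 0 := hin _ _ (by simp [Fin.ext_iff])
  -- These are the three directions in which Φ, ∇Φ and ∇²Φ are going to be moved.
  have htr : traceComm (rankOne ℝ e f) (rankOne ℝ f e) (rankOne ℝ e e) = 1 := by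
    rw [traceComm_rankOne (by simp) (hin _ _ (by simp))]
    simp
  have hz0 : posFun (innerSL ℝ u) x₀ (x₀, u) = 0 := by simp [posFun]
  have hl : innerSL ℝ u u = 1 := by simp [hu]
  have hq0 : ∀ {a c : Coord n}, inner ℝ u c = 0 → ∀ s : ℝ,
      s • quadraticField u (rankOne ℝ a c) u = 0 := fun hc s => by
    rw [quadraticField_self (by rw [rankOne_apply, real_inner_comm, hc, zero_smul]), smul_zero]
  have sq : ∀ (N : Coord n →L[ℝ] Coord n) (s : ℝ),
      ContDiffAt ℝ ∞ (fun w : Coord n × Coord n => s • quadraticField u N w.2) (x₀, u) :=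
    fun N s => ((contDiff_quadraticField.comp contDiff_snd).const_smul s).contDiffAt
  have hv : ∀ {a c : Coord n}, inner ℝ u a = 0 → inner ℝ u c = 0 → ∀ s : ℝ,
      velDeriv (fun w : Coord n × Coord n => s • quadraticField u (rankOne ℝ a c) w.2) (x₀, u) =
        s • rankOne ℝ a c := fun {a c} ha hc s => by
    have hd : HasFDerivAt (quadraticField u (rankOne ℝ a c))
        (rankOne ℝ a c : Coord n →L[ℝ] Coord n) u := by
      have := (contDiff_quadraticField (u := u) (N := rankOne ℝ a c)).differentiable (by simp) u
      have h2 := this.hasFDerivAt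
      rwa [fderiv_quadraticField hu (by rw [rankOne_apply, real_inner_comm, hc, zero_smul])
        (fun v => by simp [rankOne_apply, inner_smul_right, ha])] at h2
    have := (HasFDerivAt.comp (x₀, u) (f := Prod.snd) hd
      (hasFDerivAt_snd (𝕜 := ℝ) (E := Coord n) (F := Coord n))).const_smul s
    rw [velDeriv, HasFDerivAt.fderiv (f := fun w : Coord n × Coord n =>
      s • quadraticField u (rankOne ℝ a c) w.2) this]
    ext w
    simp
  have hzU : (x₀, u) ∈ slitTangent φ.1 := ⟨hx, by rintro h; simp [show u = 0 from h] at hu⟩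
  have hU := isOpen_slitTangent φ.1
  rw [@dense_iff_inter_open _ (strongTopology n M k)]
  rintro O hO ⟨P, hP⟩
  -- The slots of the trace form are filled from left to right. With the reference endomorphisms f⊗e
  -- and e⊗e in the other two slots, Φ is moved until the trace is nonzero. Up to the constants -1
  -- and -3, this number is the coefficient of `s₂` when ∇Φ replaces f⊗e, and the resulting one is
  -- the coefficient of `s₃` when ∇²Φ replaces e⊗e. The slots already filled are not disturbed, by
  -- the higher order of vanishing.
  obtain ⟨P₁, hP₁, s₁, hs₁, h₁⟩ := exists_perturb_mem φ hx u (rankOne ℝ e f) 1 hO hP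
    (traceComm (jacobiEnd (P.normal φ) (x₀, u)) (rankOne ℝ f e) (rankOne ℝ e e))
    (c := -(1 / 2)) (by norm_num)
  have j₁ := curvature_perturb_one ((P.contDiffOn_normal φ).contDiffAt (hU.mem_nhds hzU))
    (sq _ _) hz0 hl (hq0 huf s₁) h₁
  have t₁ : traceComm (jacobiEnd (P₁.normal φ) (x₀, u)) (rankOne ℝ f e) (rankOne ℝ e e) ≠ 0 := by
    rw [j₁, hv hue huf, smul_smul, traceComm_add_smul_left, htr]
    convert hs₁ using 1
    ring
  obtain ⟨P₂, hP₂, s₂, hs₂, h₂⟩ := exists_perturb_mem φ hx u (rankOne ℝ f e) 2 hO hP₁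
    (traceComm (jacobiEnd (P₁.normal φ) (x₀, u))
      (dynDeriv (P₁.normal φ) (jacobiEnd (P₁.normal φ)) (x₀, u)) (rankOne ℝ e e))
    (neg_ne_zero.2 t₁)
  obtain ⟨j₂, k₂⟩ := curvature_perturb_two hU hzU (P₁.contDiffOn_normal φ)
    (sq _ _) hz0 hl (hq0 hue s₂) h₂
  have t₂ : traceComm (jacobiEnd (P₂.normal φ) (x₀, u))
      (dynDeriv (P₂.normal φ) (jacobiEnd (P₂.normal φ)) (x₀, u)) (rankOne ℝ e e) ≠ 0 := by
    rw [j₂, k₂, hv huf hue, smul_smul, traceComm_add_smul_mid]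
    convert hs₂ using 1
    ring
  obtain ⟨P₃, hP₃, s₃, hs₃, h₃⟩ := exists_perturb_mem φ hx u (rankOne ℝ e e) 3 hO hP₂
    (obstruction (P₂.normal φ) (x₀, u)) (mul_ne_zero (by norm_num : (-3 : ℝ) ≠ 0) t₂)
  obtain ⟨j₃, k₃, l₃⟩ := curvature_perturb_three hU hzU (P₂.contDiffOn_normal φ)
    (sq _ _) hz0 hl (hq0 hue s₃) h₃
  refine ⟨P₃, hP₃, ?_⟩
  change obstruction _ _ ≠ 0
  rw [obstruction, j₃, k₃, l₃, hv hue hue, smul_smul, traceComm_add_smul_right]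
  convert hs₃ using 1
  rw [obstruction]
  ring

end Density

theorem mainTheorem2 (n : ℕ) (hn : 2 ≤ n) (M : Type*) [TopologicalSpace M] [T2Space M]
    [SecondCountableTopology M] [Nonempty M] [ChartedSpace (Coord n) M]
    [IsManifold (𝓡 (n + 1)) ∞ M] :
    ∃ 𝒰 : Set (PathStructure n M),
      IsOpen[weakTopology n M (if n = 2 then 5 else 4)] 𝒰 ∧
      @Dense (PathStructure n M) (strongTopology n M (if n = 2 then 5 else 4)) 𝒰 ∧
      ∀ P ∈ 𝒰, ¬ IsVariational P ∧ ¬ IsFinsler P := by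
  obtain ⟨p⟩ := ‹Nonempty M›
  let φ : atlas (Coord n) M := ⟨chartAt (Coord n) p, chart_mem_atlas _ _⟩
  have hp : p ∈ φ.1.source := mem_chart_source _ p
  have hu : ‖(EuclideanSpace.single 0 1 : Coord n)‖ = 1 := by simp
  -- A single tangent vector suffices. Openness needs four derivatives, so both values of ℓ are
  -- covered, and density holds in the strong topology of every order.
  refine ⟨{P | obstruction (P.normal φ) (φ.1 p, EuclideanSpace.single 0 1) ≠ 0},
    isOpen_obstruction_ne_zero (by split_ifs <;> norm_num) φ hp hu,
    dense_obstruction_ne_zero hn _ φ (φ.1.map_source hp), fun P hP => ?_⟩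
  have hvar : ¬ IsVariational P := fun h => hP (h.obstruction_eq_zero φ
    ⟨φ.1.map_source hp, fun h0 => by
      rw [show (EuclideanSpace.single 0 1 : Coord n) = 0 from h0] at hu
      simp at hu⟩)
  exact ⟨hvar, fun h => hvar h.isVariational⟩
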